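/- Let $C$ be a smooth, geometrically irreducible projective curve of genus $g$ over the finite field $\mathbb{F}_q$, and set $2\delta := \#C(\mathbb{F}_{q^2}) - \#C(\mathbb{F}_q)$. Let $C_{[q,2]}$ be the curve over $\mathbb{F}_q$ obtained from $C$ by gluing each point $P\in C(\mathbb{F}_{q^2})\setminus C(\mathbb{F}_q)$ to its Frobenius conjugate $F_q(P)$ so that each orbit $\{P,F_q(P)\}$ becomes an ordinary node; that is, $C_{[q,2]}$ is the quotient of $C$, as a locally ringed space over $\mathbb{F}_q$, whose functions are the functions $f$ on $C$ with $f(P)=f(F_q(P))$ for all $P\in C(\mathbb{F}_{q^2})$ in the domain of $f$. Let $Y$ be an (integral) projective curve over $\mathbb{F}_q$ with normalization $C$, and let $p_a(Y) = 1-\chi(\mathcal{O}_Y)$ be its arithmetic genus. Then one has both $$\#Y(\mathbb{F}_q) \ge \#C(\mathbb{F}_q) + \delta \quad\text{and}\quad p_a(Y)\le g+\delta$$ if and only if $Y$ is isomorphic to $C_{[q,2]}$ over $\mathbb{F}_q$. -/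

import Mathlib

open CategoryTheory AlgebraicGeometry Limits TopologicalSpace

universe u

noncomputable section

namespace CurvesOverFiniteFields

variable {k : Type u} [Field k]

/-! ### Projective curves -/

attribute [local instance] MvPolynomial.gradedAlgebra

/-- Projective `n`-space over the field `k`, that is, `Proj k[x₀, …, xₙ]`. -/
def projectiveSpace (k : Type u) [Field k] (n : ℕ) : Scheme.{u} :=
  Proj (MvPolynomial.homogeneousSubmodule (Fin (n + 1)) k)

/-- The structure morphism of projective `n`-space over `k`. -/
def projectiveSpaceToSpec (k : Type u) [Field k] (n : ℕ) :
    projectiveSpace k n ⟶ Spec (CommRingCat.of k) :=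
  Proj.toSpecZero (MvPolynomial.homogeneousSubmodule (Fin (n + 1)) k) ≫
    Spec.map (CommRingCat.ofHom
      (algebraMap k (MvPolynomial.homogeneousSubmodule (Fin (n + 1)) k 0)))

/-- A `k`-scheme is projective if it is isomorphic to a closed subscheme of some projective
space over `k`. -/
def IsProjective {X : Scheme.{u}} (s : X ⟶ Spec (CommRingCat.of k)) : Prop :=
  ∃ (n : ℕ) (i : X ⟶ projectiveSpace k n),
    IsClosedImmersion i ∧ i ≫ projectiveSpaceToSpec k n = s

/-- A projective curve over `k`: an integral projective `k`-scheme of dimension one. -/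
structure IsProjectiveCurve {X : Scheme.{u}} (s : X ⟶ Spec (CommRingCat.of k)) : Prop where
  isIntegral : IsIntegral X
  isProjective : IsProjective s
  dim_eq_one : topologicalKrullDim X = 1

/-- `u : C ⟶ Y` is the normalization of the integral scheme `Y`: up to an isomorphism it is the
relative normalization of `Y` in its generic point. -/
def IsNormalizationMap {C Y : Scheme.{u}} [IsIntegral Y] [QuasiSeparatedSpace Y]
    (u : C ⟶ Y) : Prop :=
  ∃ e : C ≅ (Y.fromSpecStalk (genericPoint Y)).normalization,
    e.hom ≫ (Y.fromSpecStalk (genericPoint Y)).fromNormalization = u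

/-! ### Coherent cohomology of the structure sheaf and the arithmetic genus -/

/-- The structure sheaf of a scheme, as a sheaf of abelian groups. -/
def structureSheafAb (X : Scheme.{u}) :
    Sheaf (Opens.grothendieckTopology X) AddCommGrpCat.{u} :=
  (sheafCompose _ (forget₂ CommRingCat.{u} RingCat.{u} ⋙ forget₂ RingCat.{u} AddCommGrpCat.{u})).obj
    X.sheaf

/-- The ring homomorphism from `k` to the sections over `U` of a `k`-scheme. -/
def scalar {X : Scheme.{u}} (s : X ⟶ Spec (CommRingCat.of k)) (U : X.Opens) : k →+* Γ(X, U) :=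
  ((Scheme.ΓSpecIso (CommRingCat.of k)).inv ≫ s.appTop ≫
    X.presheaf.map (homOfLE (le_top : U ≤ ⊤)).op).hom

theorem map_scalar {X : Scheme.{u}} (s : X ⟶ Spec (CommRingCat.of k)) {U V : X.Opens} (i : U ⟶ V)
    (c : k) : (X.presheaf.map i.op).hom (scalar s V c) = scalar s U c := by
  simp only [scalar]
  rw [← CommRingCat.comp_apply, Category.assoc, Category.assoc, ← X.presheaf.map_comp]
  rfl

/-- Multiplication by `c : k` on the structure sheaf of a `k`-scheme. -/
def mulSheaf {X : Scheme.{u}} (s : X ⟶ Spec (CommRingCat.of k)) (c : k) :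
    structureSheafAb X ⟶ structureSheafAb X :=
  ⟨{ app := fun U => AddCommGrpCat.ofHom (AddMonoidHom.mulLeft (scalar s U.unop c))
     naturality := by
       intro U V i
       ext (x : Γ(X, U.unop))
       change scalar s V.unop c * (X.presheaf.map i).hom x =
         (X.presheaf.map i).hom (scalar s U.unop c * x)
       rw [map_mul]
       exact congrArg (· * _) (map_scalar s i.unop c).symm }⟩

theorem mulSheaf_app {X : Scheme.{u}} (s : X ⟶ Spec (CommRingCat.of k)) (c : k) (U : X.Opens)
    (x : Γ(X, U)) : ((mulSheaf s c).hom.app (Opposite.op U)).hom x = scalar s U c * x := rfl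

/-- The cohomology group `Hⁿ(X, 𝒪_X)` of a `k`-scheme `X`. -/
def StructureCohomology {X : Scheme.{u}} (_s : X ⟶ Spec (CommRingCat.of k)) (n : ℕ) : Type u :=
  Sheaf.H (structureSheafAb X) n

instance {X : Scheme.{u}} (s : X ⟶ Spec (CommRingCat.of k)) (n : ℕ) :
    AddCommGroup (StructureCohomology s n) :=
  inferInstanceAs (AddCommGroup (Sheaf.H (structureSheafAb X) n))

/-- `k` acts on `Hⁿ(X, 𝒪_X)` by functoriality, through its action on `𝒪_X`. -/
def cohomologyAction {X : Scheme.{u}} (s : X ⟶ Spec (CommRingCat.of k)) (n : ℕ) :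
    k →+* AddMonoid.End (StructureCohomology s n) where
  toFun c := Sheaf.H.map (mulSheaf s c) n
  map_one' := by
    have h : mulSheaf s 1 = 𝟙 _ := by
      refine Sheaf.hom_ext (NatTrans.ext (funext fun U =>
        AddCommGrpCat.hom_ext (AddMonoidHom.ext fun (x : Γ(X, U.unop)) => ?_)))
      change scalar s U.unop 1 * x = x
      rw [map_one, one_mul]
    rw [h]
    ext x
    exact Sheaf.H.map_id_apply x
  map_mul' a b := by
    have h : mulSheaf s (a * b) = mulSheaf s b ≫ mulSheaf s a := by
      refine Sheaf.hom_ext (NatTrans.ext (funext fun U =>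
        AddCommGrpCat.hom_ext (AddMonoidHom.ext fun (x : Γ(X, U.unop)) => ?_)))
      change scalar s U.unop (a * b) * x = scalar s U.unop a * (scalar s U.unop b * x)
      rw [map_mul, mul_assoc]
    rw [h]
    ext x
    exact Sheaf.H.map_comp_apply _ _ x
  map_zero' := by
    have h : mulSheaf s 0 = 0 := by
      refine Sheaf.hom_ext (NatTrans.ext (funext fun U =>
        AddCommGrpCat.hom_ext (AddMonoidHom.ext fun (x : Γ(X, U.unop)) => ?_)))
      change scalar s U.unop 0 * x = 0
      rw [map_zero, zero_mul]
    rw [h]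
    ext x
    change Sheaf.H.map 0 n x = 0
    simp [Sheaf.H.map_apply]
  map_add' a b := by
    have h : mulSheaf s (a + b) = mulSheaf s a + mulSheaf s b := by
      refine Sheaf.hom_ext (NatTrans.ext (funext fun U =>
        AddCommGrpCat.hom_ext (AddMonoidHom.ext fun (x : Γ(X, U.unop)) => ?_)))
      change scalar s U.unop (a + b) * x = scalar s U.unop a * x + scalar s U.unop b * x
      rw [map_add, add_mul]
    rw [h]
    ext x
    exact Sheaf.H.map_add_apply _ _ x

instance {X : Scheme.{u}} (s : X ⟶ Spec (CommRingCat.of k)) (n : ℕ) :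
    Module k (StructureCohomology s n) :=
  Module.compHom (StructureCohomology s n) (cohomologyAction s n)

/-- The arithmetic genus `1 - χ(𝒪_X) = 1 - dim H⁰(X, 𝒪_X) + dim H¹(X, 𝒪_X)` of a projective
curve `X` over `k`. -/
def arithmeticGenus {X : Scheme.{u}} (s : X ⟶ Spec (CommRingCat.of k)) : ℤ :=
  1 - (Module.finrank k (StructureCohomology s 0) : ℤ)
    + (Module.finrank k (StructureCohomology s 1) : ℤ)

/-! ### Rational points -/

/-- The set `X(K)` of `K`-rational points of a `k`-scheme `X`. -/
def RationalPoint {X : Scheme.{u}} (s : X ⟶ Spec (CommRingCat.of k)) (K : Type u) [Field K]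
    [Algebra k K] : Type u :=
  {P : Spec (CommRingCat.of K) ⟶ X // P ≫ s = Spec.map (CommRingCat.ofHom (algebraMap k K))}

/-- The number `#X(K)` of `K`-rational points of a `k`-scheme `X`. -/
def numPoints {X : Scheme.{u}} (s : X ⟶ Spec (CommRingCat.of k)) (K : Type u) [Field K]
    [Algebra k K] : ℕ :=
  Nat.card (RationalPoint s K)

/-- The `q`-Frobenius `F_q` on `X(K)`, where `q = #k`. -/
def frobenius [Fintype k] {X : Scheme.{u}} (s : X ⟶ Spec (CommRingCat.of k)) (K : Type u)
    [Field K] [Algebra k K] (P : RationalPoint s K) : RationalPoint s K :=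
  ⟨Spec.map (CommRingCat.ofHom (FiniteField.frobeniusAlgHom k K).toRingHom) ≫ P.1, by
    rw [Category.assoc, P.2, ← Spec.map_comp, ← CommRingCat.ofHom_comp]
    congr 2
    exact (FiniteField.frobeniusAlgHom k K).comp_algebraMap⟩

/-! ### Gluing the orbits of Frobenius -/

/-- The disjoint union of one copy of `Spec K` for each `K`-rational point of `C`. -/
abbrev pointsSpace {C : Scheme.{u}} (s : C ⟶ Spec (CommRingCat.of k)) (K : Type u) [Field K]
    [Algebra k K] : LocallyRingedSpace.{u} :=
  ∐ fun _ : RationalPoint s K => (Spec (CommRingCat.of K)).toLocallyRingedSpace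

/-- The morphism to `C` given by `P` on the copy of `Spec K` with index `P`. -/
def pointsMap {C : Scheme.{u}} (s : C ⟶ Spec (CommRingCat.of k)) (K : Type u) [Field K]
    [Algebra k K] : pointsSpace s K ⟶ C.toLocallyRingedSpace :=
  Sigma.desc fun P => P.1.toLRSHom

/-- The morphism to `C` given by `F_q(P)` on the copy of `Spec K` with index `P`. -/
def frobeniusPointsMap [Fintype k] {C : Scheme.{u}} (s : C ⟶ Spec (CommRingCat.of k))
    (K : Type u) [Field K] [Algebra k K] : pointsSpace s K ⟶ C.toLocallyRingedSpace :=
  Sigma.desc fun P => (frobenius s K P).1.toLRSHom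

/-- The curve obtained from `C` by gluing each point of `C(K)` transversally to its image under
the Frobenius `F_q`, that is, the quotient of `C` in locally ringed spaces which identifies the
`K`-rational point `P` with the `K`-rational point `F_q(P)`, for every `P ∈ C(K)`. Its functions
are the functions `f` on `C` with `f(P) = f(F_q(P))` for all `P`. If `K` has degree two over
`k = 𝔽_q`, this is the curve `C_{[q,2]}`. -/
def gluedCurve [Fintype k] {C : Scheme.{u}} (s : C ⟶ Spec (CommRingCat.of k))
    (K : Type u) [Field K] [Algebra k K] : LocallyRingedSpace.{u} :=
  coequalizer (pointsMap s K) (frobeniusPointsMap s K)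

/-- The structure morphism of the glued curve. -/
def gluedCurveToSpec [Fintype k] {C : Scheme.{u}} (s : C ⟶ Spec (CommRingCat.of k))
    (K : Type u) [Field K] [Algebra k K] :
    gluedCurve s K ⟶ (Spec (CommRingCat.of k)).toLocallyRingedSpace :=
  coequalizer.desc s.toLRSHom (by
    apply Sigma.hom_ext
    intro P
    simp only [pointsMap, frobeniusPointsMap, colimit.ι_desc_assoc, Cofan.mk_ι_app]
    have h : P.1 ≫ s = (frobenius s K P).1 ≫ s := P.2.trans (frobenius s K P).2.symm
    exact congrArg Scheme.Hom.toLRSHom h)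

/-- The `k`-scheme `Y` is isomorphic over `k` to the curve obtained from `C` by gluing each point
of `C(K)` to its image under the Frobenius `F_q`. -/
def IsIsoToGluedCurve [Fintype k] {C Y : Scheme.{u}} (sY : Y ⟶ Spec (CommRingCat.of k))
    (sC : C ⟶ Spec (CommRingCat.of k)) (K : Type u) [Field K] [Algebra k K] : Prop :=
  ∃ e : Y.toLocallyRingedSpace ≅ gluedCurve sC K, e.hom ≫ gluedCurveToSpec sC K = sY.toLRSHom

end CurvesOverFiniteFields

end

/-! Let `U` be an affine open subset of `Y` containing every point over which `v : C ⟶ Y` fails to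
be an isomorphism, and let `A ⊆ B` be the functions on `U` and on its preimage in `C`. Everything
rests on the formula p_a(Y) = p_a(C) + dim B/A (`arithmeticGenus_eq_add_finrank`). Take a second
affine open set `V`, over which `v` is an isomorphism, such that `U` and `V` cover `Y`.
Mayer–Vietoris (`nonempty_H_one_addEquiv`) expresses both genera through functions on `U ⊓ V`, which
are the same for `C` and `Y`, and linear algebra gives the difference. The needed finiteness of H¹
follows from the valuative criterion (`finite_sections_quotient`), and such charts exist by
homogeneous prime avoidance (`IsProjectiveCurve.exists_twoChart`).

Assume the two inequalities. At least δ rational points of `Y` do not come from rational points of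
`C`. Each of them lies in `U` and below a maximal ideal of `B` whose residue field is larger than
`k`. By the Chinese remainder theorem `B` maps onto the product of the spaces (residue field)/`k`,
and `A` maps to zero, so dim B/A ≥ δ. The genus bound makes this an equality
(`finrank_eq_two_of_gaps`): all these residue fields are quadratic, and `A` consists of the
functions whose values at these ideals lie in `k`. Each ideal yields a conjugate pair of `K`-points.
There are only 2δ non-rational `K`-points on `C`, so every pair occurs (`exists_points_of_gaps`),
and `A` is the ring of functions with f(P) = f(F_q(P)). Localizing gives the same statement for all
open sets.

Conversely, conjugate `K`-points have the same underlying scheme point. Hence gluing leaves the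
topological space unchanged and only shrinks the structure sheaf (`isIso_gluedProj_base`,
`mem_range_gluedProj_app_iff`). Each of the δ pairs contributes a new rational point
(`IsGluing.card_le`) and at most one linear condition on functions (`IsGluing.finrank_le`), which
gives both inequalities. The predicate `IsGluing` is the common ground of the two directions. -/

noncomputable section

namespace CurvesOverFiniteFields

open Opposite Abelian

/-! ### First cohomology of abelian sheaves through injective sheaves. -/

section SheafCohomology

variable {X : TopCat.{u}}

/-- Sections of an injective abelian sheaf extend. -/
theorem injective_sheaf_restrict_surjective (I : Sheaf (Opens.grothendieckTopology X) AddCommGrpCat.{u}) [Injective I]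
    {U V : Opens X} (i : U ⟶ V) : Function.Surjective (I.obj.map i.op).hom := by
  intro s
  let J := Opens.grothendieckTopology X
  -- Maps to `I` from the sheafified free abelian presheaf on `W` are sections of `I` over `W`.
  -- Extending a section from `U` to `V` is thus extending a map along `Z.map i`, which is mono
  -- because `Opens X` is a poset.
  let Z : Opens X ⥤ (Opens X)ᵒᵖ ⥤ AddCommGrpCat.{u} :=
    yoneda ⋙ (Functor.whiskeringRight _ _ _).obj AddCommGrpCat.free
  have hm : Mono (Z.map i) := by
    rw [NatTrans.mono_iff_mono_app]
    intro W
    have : Mono ((yoneda.map i).app W) := by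
      rw [mono_iff_injective]
      intro a b _
      exact Subsingleton.elim (α := W.unop ⟶ U) a b
    exact inferInstanceAs (Mono (AddCommGrpCat.free.map ((yoneda.map i).app W)))
  have hm' : Mono ((presheafToSheaf J AddCommGrpCat.{u}).map (Z.map i)) := inferInstance
  let e (W : Opens X) : ((presheafToSheaf J AddCommGrpCat.{u}).obj (Z.obj W) ⟶ I) ≃ (I.obj.obj (op W)) :=
    ((sheafificationAdjunction J AddCommGrpCat.{u}).homEquiv (Z.obj W) I).trans
      (((AddCommGrpCat.adj.whiskerRight (Opens X)ᵒᵖ).homEquiv _ _).trans yonedaEquiv)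
  have he (φ : (presheafToSheaf J AddCommGrpCat.{u}).obj (Z.obj V) ⟶ I) :
      e U ((presheafToSheaf J AddCommGrpCat.{u}).map (Z.map i) ≫ φ) = (I.obj.map i.op).hom (e V φ) := by
    simp only [e, Equiv.trans_apply]
    rw [Adjunction.homEquiv_naturality_left]
    erw [Adjunction.homEquiv_naturality_left]
    exact (yonedaEquiv_naturality _ i).symm
  refine ⟨e V (Injective.factorThru ((e U).symm s)
    ((presheafToSheaf J AddCommGrpCat.{u}).map (Z.map i))), ?_⟩
  rw [← he, Injective.comp_factorThru, Equiv.apply_symm_apply]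

/-- Sections over `U` lift along any surjection of abelian sheaves with kernel `F`. -/
def LiftsOn (F : Sheaf (Opens.grothendieckTopology X) AddCommGrpCat.{u}) (U : Opens X) : Prop :=
  ∀ (I Q : Sheaf (Opens.grothendieckTopology X) AddCommGrpCat.{u}) (f : F ⟶ I) (g : I ⟶ Q)
    (zero : f ≫ g = 0), (ShortComplex.mk f g zero).ShortExact →
    Function.Surjective (g.hom.app (op U)).hom

/-- The first cohomology group of the kernel of a surjection from an injective sheaf. -/
theorem nonempty_H_one_addEquiv_of_shortExact
    {S : ShortComplex (Sheaf (Opens.grothendieckTopology X) AddCommGrpCat.{u})} (hS : S.ShortExact) [Injective S.X₂] :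
    Nonempty (Sheaf.H S.X₁ 1 ≃+
      (S.X₃.obj.obj (op ⊤)) ⧸ (S.g.hom.app (op ⊤)).hom.range) := by
  have hT : IsTerminal (⊤ : Opens X) := isTerminalTop
  let d : S.X₃.obj.obj (op ⊤) →+ Sheaf.H S.X₁ 1 :=
    (hS.extClass.postcomp _ (zero_add 1)).comp (Sheaf.H.equiv₀ S.X₃ hT).symm.toAddMonoidHom
  have hsurj : Function.Surjective d := by
    intro x
    obtain ⟨y, hy⟩ := Ext.covariant_sequence_exact₁ _ hS x (Ext.eq_zero_of_injective _) (zero_add 1)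
    exact ⟨Sheaf.H.equiv₀ S.X₃ hT y, by simpa [d] using hy⟩
  have hker : d.ker = (S.g.hom.app (op ⊤)).hom.range := by
    ext x
    constructor
    · intro hx
      obtain ⟨y, hy⟩ := Ext.covariant_sequence_exact₃ _ hS
        ((Sheaf.H.equiv₀ S.X₃ hT).symm x) (zero_add 1) hx
      refine ⟨Sheaf.H.equiv₀ S.X₂ hT y, ?_⟩
      have := Sheaf.H.equiv₀_naturality hT S.g y
      rw [Sheaf.H.map_apply, hy, AddEquiv.apply_symm_apply] at this
      exact this
    · rintro ⟨y, rfl⟩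
      change hS.extClass.postcomp _ (zero_add 1) ((Sheaf.H.equiv₀ S.X₃ hT).symm _) = 0
      have h := Sheaf.H.equiv₀_symm_naturality hT S.g y
      erw [← h]
      rw [Sheaf.H.map_apply]
      change (Ext.comp ((Sheaf.H.equiv₀ S.X₂ hT).symm y) (Ext.mk₀ S.g) (add_zero 0)).comp
        hS.extClass (zero_add 1) = 0
      rw [Ext.comp_assoc _ _ _ (add_zero 0) (zero_add 1) (by omega)]
      simp
  exact ⟨(QuotientAddGroup.quotientKerEquivOfSurjective d hsurj).symm.trans
    (QuotientAddGroup.quotientAddEquivOfEq hker)⟩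

end SheafCohomology
end CurvesOverFiniteFields

end

/-! ### Sections of abelian sheaves and Mayer–Vietoris for two open sets. -/

noncomputable section

namespace CurvesOverFiniteFields

open Opposite Abelian

section SheafCohomology

variable {X : TopCat.{u}}

/-- Restriction of sections of an abelian sheaf. -/
def secRes (F : Sheaf (Opens.grothendieckTopology X) AddCommGrpCat.{u}) {U V : Opens X}
    (h : U ≤ V) : F.obj.obj (op V) →+ F.obj.obj (op U) :=
  (F.obj.map (homOfLE h).op).hom

section

variable {F G : Sheaf (Opens.grothendieckTopology X) AddCommGrpCat.{u}}

@[simp]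
theorem secRes_secRes {U V W : Opens X} (h : U ≤ V) (h' : V ≤ W) (s : F.obj.obj (op W)) :
    secRes F h (secRes F h' s) = secRes F (h.trans h') s := by
  simp only [secRes]
  rw [← AddCommGrpCat.comp_apply, ← F.obj.map_comp]
  rfl

/-- The map on sections over `U` induced by a morphism of abelian sheaves. -/
def secMap (f : F ⟶ G) (U : Opens X) : F.obj.obj (op U) →+ G.obj.obj (op U) :=
  (f.hom.app (op U)).hom

theorem secMap_secRes (f : F ⟶ G) {U V : Opens X} (h : U ≤ V) (s : F.obj.obj (op V)) :
    secMap f U (secRes F h s) = secRes G h (secMap f V s) :=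
  congr($(f.hom.naturality (homOfLE h).op) s)

theorem eq_of_secRes_eq {ι : Type*} (U : ι → Opens X) (V : Opens X) (h : ∀ i, U i ≤ V)
    (hV : V ≤ iSup U) {s t : F.obj.obj (op V)} (hst : ∀ i, secRes F (h i) s = secRes F (h i) t) :
    s = t :=
  TopCat.Sheaf.eq_of_locally_eq' F U V (fun i => homOfLE (h i)) hV s t hst

theorem exists_secRes_eq {ι : Type*} (U : ι → Opens X) (V : Opens X) (h : ∀ i, U i ≤ V)
    (hV : V ≤ iSup U) (s : ∀ i, F.obj.obj (op (U i)))
    (hs : ∀ i j, secRes F (inf_le_left : U i ⊓ U j ≤ U i) (s i) =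
      secRes F (inf_le_right : U i ⊓ U j ≤ U j) (s j)) :
    ∃ t : F.obj.obj (op V), ∀ i, secRes F (h i) t = s i := by
  obtain ⟨t, ht, -⟩ := TopCat.Sheaf.existsUnique_gluing' F U V (fun i => homOfLE (h i)) hV s hs
  exact ⟨t, ht⟩

theorem eq_of_secRes_eq_two {U V W : Opens X} (hU : U ≤ W) (hV : V ≤ W) (hW : W ≤ U ⊔ V)
    {s t : F.obj.obj (op W)} (h₁ : secRes F hU s = secRes F hU t)
    (h₂ : secRes F hV s = secRes F hV t) : s = t :=
  TopCat.Sheaf.eq_of_locally_eq₂ F (homOfLE hU) (homOfLE hV) hW s t h₁ h₂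

theorem exists_secRes_eq_two {U V W : Opens X} (hU : U ≤ W) (hV : V ≤ W) (hW : W ≤ U ⊔ V)
    (s : F.obj.obj (op U)) (t : F.obj.obj (op V))
    (h : secRes F (inf_le_left : U ⊓ V ≤ U) s = secRes F (inf_le_right : U ⊓ V ≤ V) t) :
    ∃ r : F.obj.obj (op W), secRes F hU r = s ∧ secRes F hV r = t := by
  obtain ⟨r, hr⟩ := exists_secRes_eq (F := F) (fun b : Bool => bif b then U else V) W
    (by rintro (_ | _) <;> assumption) (by rw [iSup_bool_eq]; exact hW)
    (fun b => match b with | true => s | false => t) (by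
      rintro (_ | _) (_ | _)
      · rfl
      · have := congrArg (secRes F (inf_comm V U).le) h.symm
        simpa using this
      · exact h
      · rfl)
  exact ⟨r, hr true, hr false⟩

end

section

variable {S : ShortComplex (Sheaf (Opens.grothendieckTopology X) AddCommGrpCat.{u})}

theorem secMap_exact (hS : S.ShortExact) {U : Opens X} (s : S.X₂.obj.obj (op U))
    (h : secMap S.g U s = 0) : ∃ t, secMap S.f U t = s :=
  TopCat.Sheaf.sections_exact_of_left_exact hS.1 hS.2 s h

theorem secMap_comp_apply (U : Opens X) (s : S.X₁.obj.obj (op U)) :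
    secMap S.g U (secMap S.f U s) = 0 := by
  change ((S.f ≫ S.g).hom.app (op U)).hom s = 0
  rw [S.zero]
  rfl

theorem secMap_injective (hS : S.ShortExact) (U : Opens X) :
    Function.Injective (secMap S.f U) := by
  have := hS.2
  have h : Mono ((sheafToPresheaf _ _).map S.f) := inferInstance
  have := (NatTrans.mono_iff_mono_app _).1 h (op U)
  exact (AddCommGrpCat.mono_iff_injective _).1 this

theorem secMap_locally_surjective (hS : S.ShortExact) {U : Opens X} (s : S.X₃.obj.obj (op U))
    {x : X} (hx : x ∈ U) : ∃ (V : Opens X) (h : V ≤ U) (t : S.X₂.obj.obj (op V)),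
      x ∈ V ∧ secMap S.g V t = secRes S.X₃ h s := by
  have := (TopCat.Sheaf.isLocallySurjective_iff_epi S.g).mpr hS.epi_g
  obtain ⟨W, Wle, ⟨t, ht⟩, hW⟩ := (TopCat.Presheaf.isLocallySurjective_iff S.g.hom).mp this U s x hx
  exact ⟨W, Wle, t, hW, ht⟩

end

/-- An additive relation between `A` and `B`, total on both sides, induces an isomorphism from
`A` modulo the elements related to zero to `B` modulo the elements related to zero. -/
theorem nonempty_quotient_addEquiv_of_relation {A B : Type*} [AddCommGroup A] [AddCommGroup B]
    (R : AddSubgroup (A × B)) (A₀ : AddSubgroup A) (B₀ : AddSubgroup B)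
    (hA : ∀ a, ∃ b, (a, b) ∈ R) (hB : ∀ b, ∃ a, (a, b) ∈ R)
    (hA₀ : ∀ a, (a, 0) ∈ R ↔ a ∈ A₀) (hB₀ : ∀ b, (0, b) ∈ R ↔ b ∈ B₀) :
    Nonempty (A ⧸ A₀ ≃+ B ⧸ B₀) := by
  let φ : R →+ A ⧸ A₀ := (QuotientAddGroup.mk' A₀).comp ((AddMonoidHom.fst A B).comp R.subtype)
  let ψ : R →+ B ⧸ B₀ := (QuotientAddGroup.mk' B₀).comp ((AddMonoidHom.snd A B).comp R.subtype)
  have hφ : Function.Surjective φ := by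
    intro x
    obtain ⟨a, rfl⟩ := QuotientAddGroup.mk'_surjective A₀ x
    obtain ⟨b, hb⟩ := hA a
    exact ⟨⟨(a, b), hb⟩, rfl⟩
  have hψ : Function.Surjective ψ := by
    intro x
    obtain ⟨b, rfl⟩ := QuotientAddGroup.mk'_surjective B₀ x
    obtain ⟨a, ha⟩ := hB b
    exact ⟨⟨(a, b), ha⟩, rfl⟩
  have hker : φ.ker = ψ.ker := by
    ext ⟨⟨a, b⟩, hab⟩
    change (a : A ⧸ A₀) = 0 ↔ (b : B ⧸ B₀) = 0
    rw [QuotientAddGroup.eq_zero_iff, QuotientAddGroup.eq_zero_iff, ← hA₀, ← hB₀]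
    constructor
    · intro h
      simpa using R.sub_mem hab h
    · intro h
      simpa using R.sub_mem hab h
  exact ⟨(QuotientAddGroup.quotientKerEquivOfSurjective φ hφ).symm.trans
    ((QuotientAddGroup.quotientAddEquivOfEq hker).trans
      (QuotientAddGroup.quotientKerEquivOfSurjective ψ hψ))⟩

/-- Mayer–Vietoris for the first cohomology group, for a cover by two open sets over which sections
lift. -/
theorem nonempty_H_one_addEquiv (F : Sheaf (Opens.grothendieckTopology X) AddCommGrpCat.{u})
    {U V : Opens X} (hUV : U ⊔ V = ⊤) (hU : LiftsOn F U) (hV : LiftsOn F V) :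
    Nonempty (Sheaf.H F 1 ≃+ (F.obj.obj (op (U ⊓ V))) ⧸
      ((secRes F (inf_le_left : U ⊓ V ≤ U)).range ⊔
        (secRes F (inf_le_right : U ⊓ V ≤ V)).range)) := by
  let S : ShortComplex (Sheaf (Opens.grothendieckTopology X) AddCommGrpCat.{u}) :=
    ShortComplex.mk (Injective.ι F) (cokernel.π _) (cokernel.condition _)
  have hS : S.ShortExact :=
    { exact := ShortComplex.exact_cokernel _
      mono_f := inferInstanceAs (Mono (Injective.ι F))
      epi_g := inferInstanceAs (Epi (cokernel.π _)) }
  have : Injective S.X₂ := inferInstanceAs (Injective (Injective.under F))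
  obtain ⟨e⟩ := nonempty_H_one_addEquiv_of_shortExact hS
  have hU' : Function.Surjective (secMap S.g U) := hU _ _ _ _ _ hS
  have hV' : Function.Surjective (secMap S.g V) := hV _ _ _ _ _ hS
  -- The connecting map as a relation, so that no lifts are chosen: `c` and `q` correspond when `q`
  -- lifts to `s` on `U` and to `t` on `V` with difference `c`.
  let R : AddSubgroup (S.X₁.obj.obj (op (U ⊓ V)) × S.X₃.obj.obj (op ⊤)) :=
    { carrier := {p | ∃ s t, secRes S.X₂ inf_le_left s - secRes S.X₂ inf_le_right t =
          secMap S.f (U ⊓ V) p.1 ∧ secMap S.g U s = secRes S.X₃ le_top p.2 ∧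
          secMap S.g V t = secRes S.X₃ le_top p.2}
      zero_mem' := ⟨0, 0, by simp, by simp, by simp⟩
      add_mem' := by
        rintro p p' ⟨s, t, h, h₁, h₂⟩ ⟨s', t', h', h₁', h₂'⟩
        refine ⟨s + s', t + t', ?_, ?_, ?_⟩
        · rw [Prod.fst_add, map_add, map_add, map_add, ← h, ← h']
          abel
        · rw [Prod.snd_add, map_add, map_add, h₁, h₁']
        · rw [Prod.snd_add, map_add, map_add, h₂, h₂']
      neg_mem' := by
        rintro p ⟨s, t, h, h₁, h₂⟩
        refine ⟨-s, -t, ?_, ?_, ?_⟩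
        · rw [Prod.fst_neg, map_neg, map_neg, map_neg, ← h]
          abel
        · rw [Prod.snd_neg, map_neg, map_neg, h₁]
        · rw [Prod.snd_neg, map_neg, map_neg, h₂] }
  have key : Nonempty (_ ≃+ _) := nonempty_quotient_addEquiv_of_relation R
    ((secRes S.X₁ (inf_le_left : U ⊓ V ≤ U)).range ⊔ (secRes S.X₁ (inf_le_right : U ⊓ V ≤ V)).range)
    (secMap S.g ⊤).range ?_ ?_ ?_ ?_
  · obtain ⟨e'⟩ := key
    exact ⟨e.trans e'.symm⟩
  · intro c
    -- Injectivity extends `c` to a section `s` over `U`. The image of `s` in the quotient vanishes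
    -- on the overlap, hence glues with zero on `V`, and `t = 0` serves as the second lift.
    obtain ⟨s, hs⟩ := injective_sheaf_restrict_surjective S.X₂
      (homOfLE (inf_le_left : U ⊓ V ≤ U)) (secMap S.f (U ⊓ V) c)
    change secRes S.X₂ _ s = _ at hs
    obtain ⟨q, hq, hq'⟩ := exists_secRes_eq_two (F := S.X₃) le_top le_top hUV.ge
      (secMap S.g U s) (0 : S.X₃.obj.obj (op V)) (by
        rw [← secMap_secRes, hs, secMap_comp_apply, map_zero])
    exact ⟨q, s, 0, by simpa using hs, hq.symm, by simpa using hq'.symm⟩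
  · intro q
    obtain ⟨s, hs⟩ := hU' (secRes S.X₃ le_top q)
    obtain ⟨t, ht⟩ := hV' (secRes S.X₃ le_top q)
    obtain ⟨c, hc⟩ := secMap_exact hS
      (secRes S.X₂ (inf_le_left : U ⊓ V ≤ U) s - secRes S.X₂ (inf_le_right : U ⊓ V ≤ V) t) (by
        rw [map_sub, secMap_secRes, secMap_secRes, hs, ht, secRes_secRes, secRes_secRes, sub_self])
    exact ⟨c, s, t, hc.symm, hs, ht⟩
  · intro c
    rw [AddSubgroup.mem_sup]
    constructor
    · rintro ⟨s, t, h, h₁, h₂⟩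
      obtain ⟨x, hx⟩ := secMap_exact hS s (by rw [h₁, map_zero])
      obtain ⟨y, hy⟩ := secMap_exact hS t (by rw [h₂, map_zero])
      refine ⟨_, ⟨x, rfl⟩, -_, neg_mem ⟨y, rfl⟩, secMap_injective hS _ ?_⟩
      rw [map_add, map_neg, secMap_secRes, secMap_secRes, hx, hy, ← sub_eq_add_neg]
      exact h
    · rintro ⟨_, ⟨x, rfl⟩, _, ⟨y, rfl⟩, rfl⟩
      refine ⟨secMap S.f U x, -secMap S.f V y, ?_, ?_, ?_⟩
      · rw [map_neg, map_add, secMap_secRes, secMap_secRes, sub_neg_eq_add]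
      · rw [secMap_comp_apply, map_zero]
      · rw [map_neg, secMap_comp_apply, map_zero, neg_zero]
  · intro q
    constructor
    · rintro ⟨s, t, h, h₁, h₂⟩
      rw [map_zero, sub_eq_zero] at h
      obtain ⟨r, hr, hr'⟩ := exists_secRes_eq_two (F := S.X₂) le_top le_top hUV.ge s t h
      refine ⟨r, eq_of_secRes_eq_two (F := S.X₃) le_top le_top hUV.ge ?_ ?_⟩
      · rw [← secMap_secRes, hr, h₁]
      · rw [← secMap_secRes, hr', h₂]
    · rintro ⟨r, rfl⟩
      refine ⟨secRes S.X₂ le_top r, secRes S.X₂ le_top r, ?_, ?_, ?_⟩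
      · simp
      · exact secMap_secRes _ _ _
      · exact secMap_secRes _ _ _

end SheafCohomology
end CurvesOverFiniteFields

end

/-! ### Lifting sections over affine open sets of an integral scheme. -/

noncomputable section

namespace CurvesOverFiniteFields

open Opposite Abelian

section AffineLifting

/-- Čech 1-cocycles of a domain with respect to a standard cover are coboundaries. -/
theorem exists_coboundary {A K : Type*} [CommRing A] [Field K] (φ : A →+* K) {ι : Type*} [Finite ι]
    (f : ι → A) (hspan : Ideal.span (Set.range f) = ⊤) (k : ι → ι → K)
    (hk : ∀ i j l, k i j + k j l = k i l)
    (hk' : ∀ i j, ∃ (n : ℕ) (a : A), k i j * φ (f i * f j) ^ n = φ a) :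
    ∃ c : ι → K, (∀ i, ∃ (n : ℕ) (a : A), c i * φ (f i) ^ n = φ a) ∧ ∀ i j, c i - c j = k i j := by
  cases nonempty_fintype ι
  choose n a hna using hk'
  obtain ⟨N, hN⟩ : ∃ N, ∀ i j, n i j ≤ N := by
    obtain ⟨N, hN⟩ := (Set.finite_range fun p : ι × ι => n p.1 p.2).bddAbove
    exact ⟨N, fun i j => hN ⟨(i, j), rfl⟩⟩
  have ha (i j) : ∃ b, k i j * φ (f i * f j) ^ N = φ b := by
    refine ⟨a i j * (f i * f j) ^ (N - n i j), ?_⟩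
    rw [RingHom.map_mul φ (a i j), ← hna, RingHom.map_pow, mul_assoc, ← pow_add,
      Nat.add_sub_of_le (hN i j)]
  choose b hb using ha
  have hspan' : Ideal.span (Set.range fun i => f i ^ N) = ⊤ := by
    have := Ideal.span_pow_eq_top _ hspan N
    rwa [← Set.range_comp] at this
  have h1 : (1 : A) ∈ Ideal.span (Set.range fun i => f i ^ N) := by rw [hspan']; trivial
  obtain ⟨h, hh⟩ := Ideal.mem_span_range_iff_exists_fun.1 h1
  have hh' : ∑ j, φ (h j) * φ (f j) ^ N = 1 := by
    simpa using congrArg φ hh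
  -- The usual contraction with the partition of unity `∑ h j * f j ^ N = 1`. The common exponent
  -- `N` clears the denominators of all `k i j` at once.
  refine ⟨fun i => ∑ j, φ (h j) * φ (f j) ^ N * k i j, fun i => ⟨N, ∑ j, h j * b i j, ?_⟩,
    fun i j => ?_⟩
  · rw [Finset.sum_mul, map_sum]
    refine Finset.sum_congr rfl fun j _ => ?_
    rw [map_mul, ← hb, map_mul]
    ring
  · rw [← Finset.sum_sub_distrib, ← one_mul (k i j), ← hh', Finset.sum_mul]
    refine Finset.sum_congr rfl fun l _ => ?_
    rw [← hk i j l]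
    ring

variable {X : Scheme.{u}}

section FunctionField

variable [IsIntegral X]

/-- The embedding of the sections over a nonempty open set into the function field. -/
def toFunctionField (U : X.Opens) (h : genericPoint X ∈ U) : Γ(X, U) →+* X.functionField :=
  (X.presheaf.germ U (genericPoint X) h).hom

theorem toFunctionField_injective (U : X.Opens) (h : genericPoint X ∈ U) :
    Function.Injective (toFunctionField U h) :=
  germ_injective_of_isIntegral X _ h

theorem genericPoint_mem_of_mem {U : X.Opens} {x : X} (hx : x ∈ U) : genericPoint X ∈ U :=
  ((genericPoint_spec X).mem_open_set_iff U.isOpen).mpr ⟨x, trivial, hx⟩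

theorem toFunctionField_map {U V : X.Opens} (hUV : U ≤ V) (h : genericPoint X ∈ U) (s : Γ(X, V)) :
    toFunctionField U h ((X.presheaf.map (homOfLE hUV).op).hom s) =
      toFunctionField V (hUV h) s :=
  X.presheaf.germ_res_apply (homOfLE hUV) (genericPoint X) h s

/-- On an integral scheme the localization of the sections at `f` can be described inside the
function field. The set `W` is kept separate from the basic open set so that it can be an
intersection of two basic open sets. -/
theorem mem_range_toFunctionField_basicOpen_iff {U : X.Opens} (hU : IsAffineOpen U) (f : Γ(X, U))
    {W : X.Opens} (hW : W = X.basicOpen f) (h : genericPoint X ∈ W) (z : X.functionField) :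
    (∃ y, toFunctionField W h y = z) ↔
      ∃ (n : ℕ) (a : Γ(X, U)),
        z * toFunctionField U (X.basicOpen_le f (hW ▸ h)) f ^ n =
          toFunctionField U (X.basicOpen_le f (hW ▸ h)) a := by
  subst hW
  have hloc := hU.isLocalization_basicOpen f
  have hmap (s : Γ(X, U)) : toFunctionField (X.basicOpen f) h
      (algebraMap Γ(X, U) Γ(X, X.basicOpen f) s) = toFunctionField U (X.basicOpen_le f h) s :=
    toFunctionField_map (X.basicOpen_le f) h s
  constructor
  · rintro ⟨y, rfl⟩
    obtain ⟨n, a, hna⟩ := IsLocalization.Away.surj f y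
    refine ⟨n, a, ?_⟩
    rw [← hmap, ← hmap, ← hna, map_mul, map_pow]
  · rintro ⟨n, a, hna⟩
    obtain ⟨u, hu⟩ := IsLocalization.Away.algebraMap_isUnit (S := Γ(X, X.basicOpen f)) f
    refine ⟨algebraMap _ _ a * ↑(u⁻¹ ^ n), ?_⟩
    rw [map_mul, hmap, ← hna, ← hmap, ← hu, mul_assoc, ← map_pow, ← map_mul, ← Units.val_pow_eq_pow_val,
      ← Units.val_mul, ← mul_pow, mul_inv_cancel, one_pow, Units.val_one, map_one, mul_one]

end FunctionField

/-- Lifts exist on finitely many basic open sets. Their differences form a 1-cocycle of functions,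
which `exists_coboundary` splits inside the function field; subtracting the splitting makes the
local lifts agree, so that they glue. -/
theorem liftsOn_structureSheafAb [IsIntegral X] {U : X.Opens} (hU : IsAffineOpen U) :
    LiftsOn (structureSheafAb X) U := by
  rintro I Q f g zero hS s
  change ∃ t, secMap g U t = s
  have hloc (x : {x : X // x ∈ U}) : ∃ (r : Γ(X, U)) (t : I.obj.obj (op (X.basicOpen r))),
      x.1 ∈ X.basicOpen r ∧ secMap g _ t = secRes Q (X.basicOpen_le r) s := by
    obtain ⟨V, hV, t, hxV, ht⟩ := secMap_locally_surjective hS s x.2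
    obtain ⟨r, hr, hxr⟩ := hU.exists_basicOpen_le ⟨x.1, hxV⟩ x.2
    refine ⟨r, secRes I hr t, hxr, ?_⟩
    rw [secMap_secRes, ← secRes_secRes hr hV s]
    exact congrArg _ ht
  choose r t hxr ht using hloc
  obtain ⟨σ, hσ⟩ : ∃ σ : Finset {x : X // x ∈ U}, U ≤ ⨆ i : σ, X.basicOpen (r i) := by
    obtain ⟨σ, hσ⟩ := hU.isCompact.elim_finite_subcover (fun x : {x : X // x ∈ U} => (X.basicOpen (r x)).1)
      (fun x => (X.basicOpen (r x)).2) (fun x hx => Set.mem_iUnion.2 ⟨⟨x, hx⟩, hxr _⟩)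
    refine ⟨σ, fun x hx => ?_⟩
    obtain ⟨i, hi, hx⟩ := Set.mem_iUnion₂.1 (hσ hx)
    exact Opens.mem_iSup.2 ⟨⟨i, hi⟩, hx⟩
  have hgen (i : σ) : genericPoint X ∈ X.basicOpen (r i) := genericPoint_mem_of_mem (hxr i)
  have hgen2 (i j : σ) : genericPoint X ∈ X.basicOpen (r i) ⊓ X.basicOpen (r j) :=
    ⟨hgen i, hgen j⟩
  have hspan : Ideal.span (Set.range fun i : σ => r i) = ⊤ := by
    rw [← IsAffineOpen.self_le_iSup_basicOpen_iff hU]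
    refine hσ.trans (iSup_le fun i => ?_)
    exact le_iSup (fun x : Set.range fun i : σ => r i => X.basicOpen x.1) ⟨_, i, rfl⟩
  have hc (i j : σ) : ∃ c : Γ(X, X.basicOpen (r i) ⊓ X.basicOpen (r j)),
      secMap f _ c = secRes I inf_le_left (t i) - secRes I inf_le_right (t j) := by
    refine secMap_exact hS (U := X.basicOpen (r i) ⊓ X.basicOpen (r j)) _ ?_
    have h₁ := secMap_secRes g (inf_le_left : X.basicOpen (r i) ⊓ X.basicOpen (r j) ≤ _) (t i)
    have h₂ := secMap_secRes g (inf_le_right : X.basicOpen (r i) ⊓ X.basicOpen (r j) ≤ _) (t j)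
    rw [ht, secRes_secRes] at h₁ h₂
    rw [map_sub]
    exact sub_eq_zero.2 (h₁.trans h₂.symm)
  choose c hc using hc
  have hinj := secMap_injective hS
  obtain ⟨t', ht'⟩ : ∃ t' : ∀ i : σ, Γ(X, X.basicOpen (r i)), ∀ i j,
      secRes (structureSheafAb X) inf_le_left (t' i) -
        secRes (structureSheafAb X) inf_le_right (t' j) = c i j := by
    -- An index is needed to know that the generic point lies in `U`.
    rcases isEmpty_or_nonempty σ with h | ⟨⟨i₀⟩⟩
    · exact ⟨fun i => h.elim i, fun i => h.elim i⟩
    have hη : genericPoint X ∈ U := X.basicOpen_le _ (hgen i₀)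
    have hk (i j l : σ) : toFunctionField _ (hgen2 i j) (c i j) +
        toFunctionField _ (hgen2 j l) (c j l) = toFunctionField _ (hgen2 i l) (c i l) := by
      let D (i : σ) := X.basicOpen (r i)
      have hij : D i ⊓ D j ⊓ D l ≤ D i ⊓ D j := inf_le_left
      have hjl : D i ⊓ D j ⊓ D l ≤ D j ⊓ D l := inf_le_inf_right _ inf_le_right
      have hil : D i ⊓ D j ⊓ D l ≤ D i ⊓ D l := inf_le_inf_right _ inf_le_left
      have hW : genericPoint X ∈ D i ⊓ D j ⊓ D l := ⟨hgen2 i j, hgen l⟩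
      rw [← toFunctionField_map hij hW, ← toFunctionField_map hjl hW, ← toFunctionField_map hil hW,
        ← map_add]
      refine congrArg _ (hinj _ ?_)
      refine ((secMap f (D i ⊓ D j ⊓ D l)).map_add _ _).trans ?_
      refine (congrArg₂ _ (secMap_secRes f hij (c i j)) (secMap_secRes f hjl (c j l))).trans ?_
      refine Eq.trans ?_ (secMap_secRes f hil (c i l)).symm
      rw [hc, hc, hc, map_sub, map_sub, map_sub, secRes_secRes, secRes_secRes, secRes_secRes,
        secRes_secRes, secRes_secRes, secRes_secRes]
      exact sub_add_sub_cancel _ _ _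
    obtain ⟨k, hk, hk'⟩ := exists_coboundary (toFunctionField U hη) (fun i : σ => r i) hspan
      (fun i j => toFunctionField _ (hgen2 i j) (c i j)) hk
      (fun i j => (mem_range_toFunctionField_basicOpen_iff hU (r i * r j) (X.basicOpen_mul _ _).symm
        (hgen2 i j) _).1 ⟨_, rfl⟩)
    have hk'' (i : σ) := (mem_range_toFunctionField_basicOpen_iff hU (r i) rfl (hgen i) (k i)).2 (hk i)
    choose t' ht' using hk''
    refine ⟨t', fun i j => toFunctionField_injective _ (hgen2 i j) ?_⟩
    rw [← hk', ← ht', ← ht']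
    refine (RingHom.map_sub _ _ _).trans ?_
    exact congrArg₂ _ (toFunctionField_map _ _ _) (toFunctionField_map _ _ _)
  obtain ⟨w, hw⟩ := exists_secRes_eq (F := I) (fun i : σ => X.basicOpen (r i)) U
    (fun i => X.basicOpen_le _) hσ (fun i => t i - secMap f _ (t' i)) (by
      intro i j
      have h := congrArg (secMap f _) (ht' i j)
      have h₁ := secMap_secRes f (inf_le_left : X.basicOpen (r i) ⊓ X.basicOpen (r j) ≤ _) (t' i)
      have h₂ := secMap_secRes f (inf_le_right : X.basicOpen (r i) ⊓ X.basicOpen (r j) ≤ _) (t' j)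
      have h' := (map_sub (secMap f (X.basicOpen (r i) ⊓ X.basicOpen (r j))) _ _).symm.trans
        (h.trans (hc i j))
      rw [h₁, h₂] at h'
      rw [map_sub, map_sub]
      exact sub_eq_sub_iff_sub_eq_sub.2 h'.symm)
  refine ⟨w, eq_of_secRes_eq (F := Q) (fun i : σ => X.basicOpen (r i)) U
    (fun i => X.basicOpen_le _) hσ fun i => ?_⟩
  rw [← secMap_secRes, hw, map_sub, ht]
  refine (congrArg _ (secMap_comp_apply (S := ShortComplex.mk f g zero) _ (t' i))).trans (sub_zero _)

end AffineLifting
end CurvesOverFiniteFields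

end

/-! ### Linear algebra for comparing genera. -/

noncomputable section

namespace CurvesOverFiniteFields

open Opposite Abelian

section LinearAlgebra

variable {k : Type*} [Field k]

/-- Over a finite field, the dimension of a vector space only depends on its additive group. -/
theorem finrank_eq_of_addEquiv [Finite k] {M N : Type*} [AddCommGroup M] [AddCommGroup N]
    [Module k M] [Module k N] (e : M ≃+ N) : Module.finrank k M = Module.finrank k N := by
  by_cases hM : Finite M
  · have hN : Finite N := Finite.of_equiv M e
    have h := Nat.card_congr e.toEquiv
    rw [Module.natCard_eq_pow_finrank (K := k) (V := M),
      Module.natCard_eq_pow_finrank (K := k) (V := N)] at h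
    exact Nat.pow_right_injective (Finite.one_lt_card (α := k)) h
  -- An infinite vector space over a finite field is infinite dimensional, so both values of
  -- `finrank` are zero by convention.
  · have hN : ¬ Finite N := fun h => hM (Finite.of_equiv N e.symm)
    rw [Module.finrank_of_not_finite, Module.finrank_of_not_finite]
    · exact fun h => hN (Module.finite_of_finite k)
    · exact fun h => hM (Module.finite_of_finite k)

variable {M : Type*} [AddCommGroup M] [Module k M]

/-- The exact sequence `0 → A ⊓ N → B ⊓ N → B / A → M / (A ⊔ N) → M / (B ⊔ N) → 0`. -/
theorem finrank_quotient_sup_add_finrank_inf {A B : Submodule k M} (hAB : A ≤ B) (N : Submodule k M)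
    [FiniteDimensional k ↥(B ⊓ N)] [FiniteDimensional k (M ⧸ (A ⊔ N))] :
    FiniteDimensional k (B ⧸ A.submoduleOf B) ∧
      Module.finrank k (M ⧸ (A ⊔ N)) + Module.finrank k ↥(B ⊓ N) =
        Module.finrank k (B ⧸ A.submoduleOf B) + Module.finrank k (M ⧸ (B ⊔ N)) +
          Module.finrank k ↥(A ⊓ N) := by
  let ψ : ↥(B ⊓ N) →ₗ[k] B ⧸ A.submoduleOf B :=
    (Submodule.mkQ _).comp (Submodule.inclusion inf_le_left)
  let φ : B ⧸ A.submoduleOf B →ₗ[k] M ⧸ (A ⊔ N) :=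
    Submodule.mapQ _ _ B.subtype (fun x hx => (le_sup_left : A ≤ A ⊔ N) hx)
  let χ : M ⧸ (A ⊔ N) →ₗ[k] M ⧸ (B ⊔ N) := Submodule.factor (sup_le_sup_right hAB N)
  have hψ : Module.finrank k (LinearMap.ker ψ) = Module.finrank k ↥(A ⊓ N) := by
    refine LinearEquiv.finrank_eq ?_
    refine LinearEquiv.ofBijective
      (LinearMap.codRestrict (A ⊓ N) ((B ⊓ N).subtype.comp (LinearMap.ker ψ).subtype) ?_) ⟨?_, ?_⟩
    · rintro ⟨⟨x, hx⟩, h⟩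
      exact ⟨(Submodule.Quotient.mk_eq_zero (A.submoduleOf B)).1 (LinearMap.mem_ker.1 h), hx.2⟩
    · intro x y h
      exact Subtype.ext (Subtype.ext congr(($h).1))
    · rintro ⟨x, hx⟩
      exact ⟨⟨⟨x, hAB hx.1, hx.2⟩, (Submodule.Quotient.mk_eq_zero _).2 hx.1⟩, rfl⟩
  have hψφ : LinearMap.range ψ = LinearMap.ker φ := by
    ext x
    obtain ⟨⟨b, hb⟩, rfl⟩ := Submodule.mkQ_surjective _ x
    constructor
    · rintro ⟨y, hy⟩
      rw [← hy]
      exact (Submodule.Quotient.mk_eq_zero _).2 ((le_sup_right : N ≤ A ⊔ N) y.2.2)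
    · intro h
      obtain ⟨a, ha, n, hn, rfl⟩ := Submodule.mem_sup.1 ((Submodule.Quotient.mk_eq_zero _).1 h)
      refine ⟨⟨n, ?_, hn⟩, ?_⟩
      · simpa using B.sub_mem hb (hAB ha)
      · refine (Submodule.Quotient.eq _).2 ?_
        change n - (a + n) ∈ A
        simpa using ha
  have hφχ : LinearMap.range φ = LinearMap.ker χ := by
    ext x
    obtain ⟨m, rfl⟩ := Submodule.mkQ_surjective _ x
    constructor
    · rintro ⟨y, hy⟩
      obtain ⟨b, rfl⟩ := Submodule.mkQ_surjective _ y
      rw [← hy]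
      exact (Submodule.Quotient.mk_eq_zero _).2 ((le_sup_left : B ≤ B ⊔ N) b.2)
    · intro h
      obtain ⟨b, hb, n, hn, rfl⟩ := Submodule.mem_sup.1 ((Submodule.Quotient.mk_eq_zero _).1 h)
      refine ⟨Submodule.mkQ _ ⟨b, hb⟩, (Submodule.Quotient.eq _).2 ?_⟩
      change b - (b + n) ∈ A ⊔ N
      simpa using (le_sup_right : N ≤ A ⊔ N) hn
  have hχ : Function.Surjective χ := Submodule.factor_surjective _
  have h1 := LinearMap.finrank_range_add_finrank_ker ψ
  -- The kernel of `φ` is an image of `B ⊓ N`, and its range lies in `M ⧸ (A ⊔ N)`; both are finite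
  -- dimensional.
  have hfin : FiniteDimensional k (B ⧸ A.submoduleOf B) := by
    have : FiniteDimensional k (LinearMap.ker φ) := by
      rw [← hψφ]
      infer_instance
    have : FiniteDimensional k ((B ⧸ A.submoduleOf B) ⧸ LinearMap.ker φ) :=
      Module.Finite.equiv φ.quotKerEquivRange.symm
    exact Module.Finite.of_submodule_quotient (LinearMap.ker φ)
  refine ⟨hfin, ?_⟩
  have h2 := LinearMap.finrank_range_add_finrank_ker φ
  have h3 := LinearMap.finrank_range_add_finrank_ker χ
  rw [LinearMap.range_eq_top.2 hχ, finrank_top] at h3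
  rw [hψφ] at h1
  rw [hφχ] at h2
  omega

end LinearAlgebra

/-! ### The arithmetic genus from two affine charts. -/

section Sections

variable {k : Type u} [Field k] {X : Scheme.{u}} (s : X ⟶ Spec (CommRingCat.of k))

/-- The `k`-algebra of sections of the structure sheaf of a `k`-scheme. -/
def Sec (_s : X ⟶ Spec (CommRingCat.of k)) (U : X.Opens) : Type u := Γ(X, U)

instance (U : X.Opens) : CommRing (Sec s U) := inferInstanceAs (CommRing Γ(X, U))

instance (U : X.Opens) : Algebra k (Sec s U) := (scalar s U).toAlgebra

/-- Restriction of sections. -/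
def Sec.res {U V : X.Opens} (h : U ≤ V) : Sec s V →ₐ[k] Sec s U :=
  { (X.presheaf.map (homOfLE h).op).hom with
    commutes' := fun c => map_scalar s (homOfLE h) c }

theorem Sec.res_injective [IsIntegral X] {U V : X.Opens} (h : U ≤ V) (hU : genericPoint X ∈ U) :
    Function.Injective (Sec.res s h) := by
  have : Nonempty U := ⟨⟨_, hU⟩⟩
  exact map_injective_of_isIntegral X (homOfLE h)

variable [IsIntegral X] {U V : X.Opens}

/-- A global section is a pair of sections agreeing on the overlap. By integrality it is determined
by its restriction there, so H⁰ becomes an intersection of two subspaces. -/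
theorem finrank_structureCohomology_zero [Finite k] (hUV : U ⊔ V = ⊤)
    (hη : genericPoint X ∈ U ⊓ V) :
    Module.finrank k (StructureCohomology s 0) = Module.finrank k
      ↥(LinearMap.range (Sec.res s (inf_le_left : U ⊓ V ≤ U)).toLinearMap ⊓
        LinearMap.range (Sec.res s (inf_le_right : U ⊓ V ≤ V)).toLinearMap) := by
  let e : StructureCohomology s 0 ≃+ Sec s ⊤ :=
    Sheaf.H.equiv₀ (structureSheafAb X) (isTerminalTop (α := Opens X))
  rw [finrank_eq_of_addEquiv (k := k) e]
  let F := structureSheafAb X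
  let A := LinearMap.range (Sec.res s (inf_le_left : U ⊓ V ≤ U)).toLinearMap
  let N := LinearMap.range (Sec.res s (inf_le_right : U ⊓ V ≤ V)).toLinearMap
  refine LinearEquiv.finrank_eq (LinearEquiv.ofBijective (LinearMap.codRestrict (A ⊓ N)
    (Sec.res s (le_top : U ⊓ V ≤ ⊤)).toLinearMap fun x => Submodule.mem_inf.2
      ⟨⟨Sec.res s le_top x, secRes_secRes (F := F) inf_le_left le_top x⟩,
        ⟨Sec.res s le_top x, secRes_secRes (F := F) inf_le_right le_top x⟩⟩) ⟨?_, ?_⟩)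
  · intro x y h
    exact Sec.res_injective s _ hη congr(($h).1)
  · rintro ⟨z, ⟨x, hx⟩, ⟨y, hy⟩⟩
    obtain ⟨r, hr, -⟩ := exists_secRes_eq_two (F := F) le_top le_top hUV.ge x y (hx.trans hy.symm)
    refine ⟨r, Subtype.ext (Eq.trans ?_ hx)⟩
    rw [← hr]
    exact (secRes_secRes (F := F) inf_le_left le_top r).symm

/-- The Mayer–Vietoris isomorphism is only known to be additive. Over a finite field this determines
the dimension, so the linearity of the connecting map never has to be checked. -/
theorem finrank_structureCohomology_one [Finite k] (hU : IsAffineOpen U) (hV : IsAffineOpen V)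
    (hUV : U ⊔ V = ⊤) :
    Module.finrank k (StructureCohomology s 1) = Module.finrank k
      (Sec s (U ⊓ V) ⧸ (LinearMap.range (Sec.res s (inf_le_left : U ⊓ V ≤ U)).toLinearMap ⊔
        LinearMap.range (Sec.res s (inf_le_right : U ⊓ V ≤ V)).toLinearMap)) := by
  obtain ⟨e⟩ := nonempty_H_one_addEquiv (structureSheafAb X) hUV (liftsOn_structureSheafAb hU)
    (liftsOn_structureSheafAb hV)
  let A := LinearMap.range (Sec.res s (inf_le_left : U ⊓ V ≤ U)).toLinearMap
  let N := LinearMap.range (Sec.res s (inf_le_right : U ⊓ V ≤ V)).toLinearMap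
  let e' : StructureCohomology s 1 ≃+ Sec s (U ⊓ V) ⧸ (A.toAddSubgroup ⊔ N.toAddSubgroup) := e
  refine finrank_eq_of_addEquiv (e'.trans ((QuotientAddGroup.quotientAddEquivOfEq ?_).trans
    (QuotientAddGroup.quotientKerEquivOfSurjective (Submodule.mkQ (A ⊔ N)).toAddMonoidHom
      (Submodule.mkQ_surjective _))))
  ext x
  refine Iff.trans ?_ (Submodule.Quotient.mk_eq_zero (A ⊔ N)).symm
  rw [AddSubgroup.mem_sup, Submodule.mem_sup]
  rfl

theorem arithmeticGenus_eq [Finite k] (hU : IsAffineOpen U) (hV : IsAffineOpen V)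
    (hUV : U ⊔ V = ⊤) (hη : genericPoint X ∈ U ⊓ V) :
    arithmeticGenus s = 1 - (Module.finrank k
      ↥(LinearMap.range (Sec.res s (inf_le_left : U ⊓ V ≤ U)).toLinearMap ⊓
        LinearMap.range (Sec.res s (inf_le_right : U ⊓ V ≤ V)).toLinearMap) : ℤ) +
      (Module.finrank k
        (Sec s (U ⊓ V) ⧸ (LinearMap.range (Sec.res s (inf_le_left : U ⊓ V ≤ U)).toLinearMap ⊔
          LinearMap.range (Sec.res s (inf_le_right : U ⊓ V ≤ V)).toLinearMap)) : ℤ) := by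
  rw [arithmeticGenus, finrank_structureCohomology_zero s hUV hη,
    finrank_structureCohomology_one s hU hV hUV]

end Sections

/-! ### Change of the genus along a morphism. -/

section Pullback

variable {k : Type u} [Field k] {C Y : Scheme.{u}} {sC : C ⟶ Spec (CommRingCat.of k)}
  {sY : Y ⟶ Spec (CommRingCat.of k)} {v : C ⟶ Y} (hv : v ≫ sY = sC)

theorem app_scalar (hv : v ≫ sY = sC) (U : Y.Opens) (c : k) :
    (v.app U).hom (scalar sY U c) = scalar sC (v ⁻¹ᵁ U) c := by
  subst hv
  simp only [scalar]
  rw [← CommRingCat.comp_apply, Category.assoc, Category.assoc, v.naturality]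
  rfl

/-- Pullback of sections along a morphism of `k`-schemes. -/
def Sec.pull (hv : v ≫ sY = sC) (U : Y.Opens) : Sec sY U →ₐ[k] Sec sC (v ⁻¹ᵁ U) :=
  { (v.app U).hom with
    commutes' := fun c => app_scalar hv U c }

theorem Sec.pull_res {U V : Y.Opens} (h : U ≤ V) (x : Sec sY V) :
    Sec.pull hv U (Sec.res sY h x) = Sec.res sC (v.preimage_mono h) (Sec.pull hv V x) :=
  congr($(v.naturality (homOfLE h).op) x)

/-- If `v` is an isomorphism on sections over the subsets of one member `V` of a cover by two
affine open sets `U` and `V`, then the difference of the arithmetic genera is the codimension of the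
sections over `U`. -/
theorem arithmeticGenus_eq_add_finrank [Finite k] [IsIntegral C] [IsIntegral Y] {U V : Y.Opens}
    (hU : IsAffineOpen U) (hV : IsAffineOpen V) (hUV : U ⊔ V = ⊤)
    (hU' : IsAffineOpen (v ⁻¹ᵁ U)) (hV' : IsAffineOpen (v ⁻¹ᵁ V))
    (hη : genericPoint C ∈ v ⁻¹ᵁ U ⊓ v ⁻¹ᵁ V)
    (hbij : ∀ W ≤ V, Function.Bijective (Sec.pull hv W))
    [FiniteDimensional k ↥(LinearMap.range (Sec.res sC
      (inf_le_left : v ⁻¹ᵁ U ⊓ v ⁻¹ᵁ V ≤ v ⁻¹ᵁ U)).toLinearMap ⊓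
        LinearMap.range (Sec.res sC (inf_le_right : v ⁻¹ᵁ U ⊓ v ⁻¹ᵁ V ≤ v ⁻¹ᵁ V)).toLinearMap)]
    [FiniteDimensional k (Sec sY (U ⊓ V) ⧸
      (LinearMap.range (Sec.res sY (inf_le_left : U ⊓ V ≤ U)).toLinearMap ⊔
        LinearMap.range (Sec.res sY (inf_le_right : U ⊓ V ≤ V)).toLinearMap))] :
    FiniteDimensional k (Sec sC (v ⁻¹ᵁ U) ⧸ LinearMap.range (Sec.pull hv U).toLinearMap) ∧
      arithmeticGenus sY = arithmeticGenus sC +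
        (Module.finrank k (Sec sC (v ⁻¹ᵁ U) ⧸ LinearMap.range (Sec.pull hv U).toLinearMap) : ℤ) := by
  let M := Sec sC (v ⁻¹ᵁ U ⊓ v ⁻¹ᵁ V)
  let AY := LinearMap.range (Sec.res sY (inf_le_left : U ⊓ V ≤ U)).toLinearMap
  let NY := LinearMap.range (Sec.res sY (inf_le_right : U ⊓ V ≤ V)).toLinearMap
  let B := LinearMap.range (Sec.res sC (inf_le_left : v ⁻¹ᵁ U ⊓ v ⁻¹ᵁ V ≤ v ⁻¹ᵁ U)).toLinearMap
  let N := LinearMap.range (Sec.res sC (inf_le_right : v ⁻¹ᵁ U ⊓ v ⁻¹ᵁ V ≤ v ⁻¹ᵁ V)).toLinearMap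
  -- The overlap lies in `V`, so `E` moves the Čech data of `Y` into the functions on the overlap in
  -- `C`. There the contributions of `V` coincide and those of `U` become `A ≤ B`.
  let E : Sec sY (U ⊓ V) ≃ₗ[k] M :=
    LinearEquiv.ofBijective (Sec.pull hv (U ⊓ V)).toLinearMap (hbij _ inf_le_right)
  let A := AY.map E.toLinearMap
  have hN : NY.map E.toLinearMap = N := by
    ext x
    constructor
    · rintro ⟨_, ⟨y, rfl⟩, rfl⟩
      exact ⟨Sec.pull hv V y, (Sec.pull_res hv inf_le_right y).symm⟩
    · rintro ⟨y, rfl⟩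
      obtain ⟨y, rfl⟩ := (hbij V le_rfl).2 y
      exact ⟨_, ⟨y, rfl⟩, Sec.pull_res hv inf_le_right y⟩
  have hAB : A ≤ B := by
    rintro _ ⟨_, ⟨y, rfl⟩, rfl⟩
    exact ⟨Sec.pull hv U y, (Sec.pull_res hv inf_le_left y).symm⟩
  have hinf : (AY ⊓ NY).map E.toLinearMap = A ⊓ N := by
    rw [← hN]
    exact Submodule.map_inf _ E.injective
  have hsup : (AY ⊔ NY).map E.toLinearMap = A ⊔ N := by
    rw [← hN]
    exact Submodule.map_sup _ _ _
  let eq : (Sec sY (U ⊓ V) ⧸ (AY ⊔ NY)) ≃ₗ[k] M ⧸ (A ⊔ N) := Submodule.Quotient.equiv _ _ E hsup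
  let ei : ↥(AY ⊓ NY) ≃ₗ[k] ↥(A ⊓ N) := (E.submoduleMap _).trans (LinearEquiv.ofEq _ _ hinf)
  let r := LinearEquiv.ofInjective (Sec.res sC (inf_le_left : v ⁻¹ᵁ U ⊓ v ⁻¹ᵁ V ≤ v ⁻¹ᵁ U)).toLinearMap
    (Sec.res_injective sC _ hη)
  let eB : (Sec sC (v ⁻¹ᵁ U) ⧸ LinearMap.range (Sec.pull hv U).toLinearMap) ≃ₗ[k]
      B ⧸ A.submoduleOf B := Submodule.Quotient.equiv _ _ r (by
    ext ⟨x, hx⟩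
    constructor
    · rintro ⟨_, ⟨y, rfl⟩, h⟩
      refine ⟨Sec.res sY inf_le_left y, ⟨y, rfl⟩, ?_⟩
      exact (Sec.pull_res hv inf_le_left y).trans congr(($h).1)
    · rintro ⟨_, ⟨y, rfl⟩, h⟩
      exact ⟨_, ⟨y, rfl⟩, Subtype.ext ((Sec.pull_res hv inf_le_left y).symm.trans h)⟩)
  have : FiniteDimensional k (M ⧸ (A ⊔ N)) := Module.Finite.equiv eq
  have : FiniteDimensional k ↥(B ⊓ N) := ‹_›
  obtain ⟨hfin, h⟩ := finrank_quotient_sup_add_finrank_inf hAB N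
  refine ⟨Module.Finite.equiv eB.symm, ?_⟩
  have hηY : genericPoint Y ∈ U ⊓ V := genericPoint_mem_of_mem (x := v (genericPoint C)) hη
  rw [arithmeticGenus_eq sY hU hV hUV hηY, arithmeticGenus_eq sC hU' hV'
    (by rw [← Scheme.Hom.preimage_sup, hUV]; rfl) hη, eB.finrank_eq]
  have h1 : Module.finrank k (Sec sY (U ⊓ V) ⧸ (AY ⊔ NY)) = Module.finrank k (M ⧸ (A ⊔ N)) :=
    eq.finrank_eq
  have h2 : Module.finrank k ↥(AY ⊓ NY) = Module.finrank k ↥(A ⊓ N) := ei.finrank_eq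
  change Module.finrank k (M ⧸ (A ⊔ N)) + Module.finrank k ↥(B ⊓ N) =
    Module.finrank k (B ⧸ A.submoduleOf B) + Module.finrank k (M ⧸ (B ⊔ N)) +
      Module.finrank k ↥(A ⊓ N) at h
  change 1 - (Module.finrank k ↥(AY ⊓ NY) : ℤ) + (Module.finrank k (Sec sY (U ⊓ V) ⧸ (AY ⊔ NY)) : ℤ) =
    1 - (Module.finrank k ↥(B ⊓ N) : ℤ) + (Module.finrank k (M ⧸ (B ⊔ N)) : ℤ) +
      (Module.finrank k (B ⧸ A.submoduleOf B) : ℤ)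
  omega

end Pullback
end CurvesOverFiniteFields

end

/-! ### Values of sections at points with coordinates in a ring. -/

noncomputable section

namespace CurvesOverFiniteFields

open Opposite

section Eval

variable {X : Scheme.{u}} {R : Type u} [CommRing R]

/-- Evaluation of sections at a point with values in a ring. -/
def evalAt (P : Spec (CommRingCat.of R) ⟶ X) (U : X.Opens) (h : ⊤ ≤ P ⁻¹ᵁ U) : Γ(X, U) →+* R :=
  (P.appLE U ⊤ h ≫ (Scheme.ΓSpecIso (CommRingCat.of R)).hom).hom

theorem evalAt_res (P : Spec (CommRingCat.of R) ⟶ X) {U V : X.Opens} (hUV : U ≤ V)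
    (h : ⊤ ≤ P ⁻¹ᵁ U) (x : Γ(X, V)) :
    evalAt P U h ((X.presheaf.map (homOfLE hUV).op).hom x) =
      evalAt P V (h.trans (P.preimage_mono hUV)) x := by
  simp only [evalAt]
  rw [← CommRingCat.comp_apply, ← Category.assoc, Scheme.Hom.map_appLE]

theorem evalAt_specMap {S : Type u} [CommRing S] (φ : R →+* S) (P : Spec (CommRingCat.of R) ⟶ X)
    (U : X.Opens) (h : ⊤ ≤ P ⁻¹ᵁ U) (h' : ⊤ ≤ (Spec.map (CommRingCat.ofHom φ) ≫ P) ⁻¹ᵁ U)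
    (x : Γ(X, U)) :
    evalAt (Spec.map (CommRingCat.ofHom φ) ≫ P) U h' x = φ (evalAt P U h x) := by
  have e : (Spec.map (CommRingCat.ofHom φ) ≫ P).appLE U ⊤ h' =
      P.appLE U ⊤ h ≫ (Spec.map (CommRingCat.ofHom φ)).appTop := by
    have := Scheme.Hom.appLE_comp_appLE (Spec.map (CommRingCat.ofHom φ)) P U ⊤ ⊤ h le_rfl
    rw [← this]
    exact congrArg (P.appLE U ⊤ h ≫ ·) (Scheme.Hom.appLE_eq_app (Spec.map (CommRingCat.ofHom φ)))
  simp only [evalAt, e]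
  rw [Category.assoc, Scheme.ΓSpecIso_naturality]
  rfl

theorem evalAt_comp {Y : Scheme.{u}} (P : Spec (CommRingCat.of R) ⟶ X) (v : X ⟶ Y) (U : Y.Opens)
    (h : ⊤ ≤ P ⁻¹ᵁ (v ⁻¹ᵁ U)) (h' : ⊤ ≤ (P ≫ v) ⁻¹ᵁ U) (x : Γ(Y, U)) :
    evalAt (P ≫ v) U h' x = evalAt P (v ⁻¹ᵁ U) h ((v.app U).hom x) := by
  simp only [evalAt]
  rw [Scheme.Hom.comp_appLE]
  rfl

theorem le_preimage_basicOpen {P : Spec (CommRingCat.of R) ⟶ X} {U : X.Opens}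
    (h : ⊤ ≤ P ⁻¹ᵁ U) (x : Γ(X, U)) (hx : IsUnit (evalAt P U h x)) :
    ⊤ ≤ P ⁻¹ᵁ (X.basicOpen x) := by
  have h1 : IsUnit ((P.appLE U ⊤ h).hom x) := by
    have := hx.map (Scheme.ΓSpecIso (CommRingCat.of R)).inv.hom
    change IsUnit ((P.appLE U ⊤ h ≫ (Scheme.ΓSpecIso (CommRingCat.of R)).hom ≫
      (Scheme.ΓSpecIso (CommRingCat.of R)).inv).hom x) at this
    rwa [Iso.hom_inv_id, Category.comp_id] at this
  have h2 := Scheme.basicOpen_appLE P ⊤ U h x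
  rw [Scheme.basicOpen_of_isUnit _ h1] at h2
  exact h2.le.trans inf_le_right

/-- Reduces questions about points in an affine open set to ring homomorphisms out of its sections.
-/
theorem eq_specMap_fromSpec {U : X.Opens} (hU : IsAffineOpen U) (P : Spec (CommRingCat.of R) ⟶ X)
    (hP : ⊤ ≤ P ⁻¹ᵁ U) : P = Spec.map (CommRingCat.ofHom (evalAt P U hP)) ≫ hU.fromSpec := by
  have h := IsAffineOpen.SpecMap_appLE_fromSpec P hU (isAffineOpen_top _) hP
  rw [IsAffineOpen.fromSpec_top, Scheme.isoSpec_Spec_inv] at h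
  change _ = Spec.map (P.appLE U ⊤ hP ≫ (Scheme.ΓSpecIso (CommRingCat.of R)).hom) ≫ _
  rw [Spec.map_comp, Category.assoc, h, ← Category.assoc, ← Spec.map_comp]
  simp

theorem evalAt_ext {U : X.Opens} (hU : IsAffineOpen U) {P Q : Spec (CommRingCat.of R) ⟶ X}
    (hP : ⊤ ≤ P ⁻¹ᵁ U) (hQ : ⊤ ≤ Q ⁻¹ᵁ U) (h : ∀ s, evalAt P U hP s = evalAt Q U hQ s) : P = Q := by
  rw [eq_specMap_fromSpec hU P hP, eq_specMap_fromSpec hU Q hQ, RingHom.ext h]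

theorem specMap_fromSpec_le {U : X.Opens} (hU : IsAffineOpen U) (φ : Γ(X, U) →+* R) :
    ⊤ ≤ (Spec.map (CommRingCat.ofHom φ) ≫ hU.fromSpec) ⁻¹ᵁ U := by
  rw [Scheme.Hom.comp_preimage, hU.fromSpec_preimage_self]
  exact le_rfl

theorem evalAt_specMap_fromSpec {U : X.Opens} (hU : IsAffineOpen U) (φ : Γ(X, U) →+* R)
    (s : Γ(X, U)) :
    evalAt (Spec.map (CommRingCat.ofHom φ) ≫ hU.fromSpec) U (specMap_fromSpec_le hU φ) s = φ s := by
  refine (evalAt_specMap (R := Γ(X, U)) φ hU.fromSpec U hU.fromSpec_preimage_self.ge _ s).trans ?_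
  congr 1
  change ((hU.fromSpec.appLE U ⊤ _ ≫ (Scheme.ΓSpecIso _).hom)).hom s = s
  have : hU.fromSpec.appLE U ⊤ hU.fromSpec_preimage_self.ge ≫ (Scheme.ΓSpecIso _).hom = 𝟙 _ := by
    rw [Scheme.Hom.appLE, hU.fromSpec_app_self, Category.assoc, Category.assoc,
      ← Functor.map_comp_assoc]
    have e : (eqToHom hU.fromSpec_preimage_self).op ≫
      (homOfLE hU.fromSpec_preimage_self.ge).op = 𝟙 _ := rfl
    rw [e, CategoryTheory.Functor.map_id, Category.id_comp, Iso.inv_hom_id]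
  rw [this]
  rfl

theorem evalAt_fromSpecStalk (x : X) {U : X.Opens} (hx : x ∈ U)
    (h : ⊤ ≤ (X.fromSpecStalk x) ⁻¹ᵁ U) (s : Γ(X, U)) :
    evalAt (R := X.presheaf.stalk x) (X.fromSpecStalk x) U h s = (X.presheaf.germ U x hx).hom s := by
  change (((X.fromSpecStalk x).appLE U ⊤ _ ≫ (Scheme.ΓSpecIso _).hom)).hom s = _
  congr 2
  rw [Scheme.Hom.appLE, Scheme.fromSpecStalk_app hx, Category.assoc, Category.assoc, Category.assoc,
      ← Functor.map_comp_assoc]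
  have e : (homOfLE le_top).op ≫ (homOfLE h).op = 𝟙 _ := rfl
  rw [e, CategoryTheory.Functor.map_id, Category.id_comp, Iso.inv_hom_id, Category.comp_id]

theorem evalAt_scalar {k : Type u} [Field k] {s : X ⟶ Spec (CommRingCat.of k)} [Algebra k R]
    (P : Spec (CommRingCat.of R) ⟶ X)
    (hP : P ≫ s = Spec.map (CommRingCat.ofHom (algebraMap k R))) (U : X.Opens)
    (h : ⊤ ≤ P ⁻¹ᵁ U) (c : k) : evalAt P U h (scalar s U c) = algebraMap k R c := by
  have h1 : scalar s U c = (X.presheaf.map (homOfLE (le_top : U ≤ ⊤)).op).hom (scalar s ⊤ c) :=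
    (map_scalar s _ c).symm
  rw [h1, evalAt_res]
  change (P.appLE ⊤ ⊤ _ ≫ (Scheme.ΓSpecIso (CommRingCat.of R)).hom).hom
    (((Scheme.ΓSpecIso (CommRingCat.of k)).inv ≫ s.appTop ≫ X.presheaf.map (𝟙 _)).hom c) = _
  rw [← CommRingCat.comp_apply]
  have : ((Scheme.ΓSpecIso (CommRingCat.of k)).inv ≫ s.appTop ≫ X.presheaf.map (𝟙 _)) ≫
    P.appLE ⊤ ⊤ le_top ≫ (Scheme.ΓSpecIso (CommRingCat.of R)).hom =
      CommRingCat.ofHom (algebraMap k R) := by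
    rw [CategoryTheory.Functor.map_id, Category.comp_id, Category.assoc]
    have : s.appTop ≫ P.appLE ⊤ ⊤ le_top = (P ≫ s).appTop := by
      exact (Scheme.Hom.comp_appLE P s ⊤ ⊤ le_top).symm.trans (Scheme.Hom.appLE_eq_app (P ≫ s))
    rw [reassoc_of% this, hP, Scheme.ΓSpecIso_naturality, Iso.inv_hom_id_assoc]
  rw [this]
  rfl

/-- A morphism to `Spec k` is a ring homomorphism out of `k`, so compatibility with the structure
maps can be tested on the values of constants over one open set. -/
theorem comp_eq_specMap_of_evalAt_scalar {k : Type u} [Field k] {s : X ⟶ Spec (CommRingCat.of k)}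
    [Algebra k R] (P : Spec (CommRingCat.of R) ⟶ X) (U : X.Opens)
    (h : ⊤ ≤ P ⁻¹ᵁ U) (hc : ∀ c, evalAt P U h (scalar s U c) = algebraMap k R c) :
    P ≫ s = Spec.map (CommRingCat.ofHom (algebraMap k R)) := by
  obtain ⟨φ, hφ⟩ := Spec.map_surjective (P ≫ s)
  rw [← hφ]
  congr 1
  ext c
  let := φ.hom.toAlgebra
  have := evalAt_scalar (s := s) P (k := k) (hφ.symm) U h c
  exact this.symm.trans (hc c)

end Eval
end CurvesOverFiniteFields

end

/-! ### Finiteness of H⁰ and H¹ for a cover by two charts. -/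

noncomputable section

namespace CurvesOverFiniteFields

section Alg
variable {k A N M : Type*} [Field k] [CommRing A] [CommRing N] [CommRing M] [Algebra k A]
  [Algebra k N] [Algebra k M]

/-- The algebraic form of the finiteness of the first cohomology of two-chart coverings. -/
theorem finite_quotient_sup (α : A →ₐ[k] M) (β : N →ₐ[k] M) (f : A) (g : N)
    (hfg : α f * β g = 1) (hα : ∀ x : M, ∃ (n : ℕ) (a : A), x = α a * β g ^ n)
    (hβ : ∀ x : M, ∃ (n : ℕ) (b : N), x * β g ^ n = β b)
    (hfin : (Polynomial.aeval (R := k) f : Polynomial k →ₐ[k] A).toRingHom.Finite) :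
    FiniteDimensional k (M ⧸ (LinearMap.range α.toLinearMap ⊔ LinearMap.range β.toLinearMap)) := by
  let _ : Algebra (Polynomial k) A := (Polynomial.aeval (R := k) f).toRingHom.toAlgebra
  have hfin' : Module.Finite (Polynomial k) A := hfin
  obtain ⟨S, hS⟩ := hfin'.fg_top
  choose n b hb using fun a : A => hβ (α a)
  let n₀ := S.sup n
  -- From the exponent `n₀` on, `α a * β g ^ m` lies in the range of `β` for every generator `a ∈
  -- S`, so only finitely many products remain.
  let T : Set M := (fun p : ℕ × A => α p.2 * β g ^ p.1) '' (Set.Iio n₀ ×ˢ (S : Set A))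
  have hT : T.Finite := ((Set.finite_Iio n₀).prod S.finite_toSet).image _
  let R := LinearMap.range α.toLinearMap ⊔ LinearMap.range β.toLinearMap
  let W := R ⊔ Submodule.span k T
  have hS' (a : A) (ha : a ∈ S) (m : ℕ) : α a * β g ^ m ∈ W := by
    rcases lt_or_ge m n₀ with h | h
    · exact Submodule.mem_sup_right (Submodule.subset_span ⟨(m, a), ⟨h, ha⟩, rfl⟩)
    · have h1 : n a ≤ m := (Finset.le_sup (f := n) ha).trans h
      refine Submodule.mem_sup_left (Submodule.mem_sup_right ⟨b a * g ^ (m - n a), ?_⟩)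
      change β _ = _
      rw [map_mul, ← hb, map_pow, mul_assoc, ← pow_add, Nat.add_sub_cancel' h1]
  -- Since `α f * β g = 1`, a factor `f` lowers the exponent of `g` by one. If no `g` is left, the
  -- element lies in the range of `α`.
  have key (a : A) : ∀ m, α a * β g ^ m ∈ W := by
    have ha : a ∈ Submodule.span (Polynomial k) (S : Set A) := hS ▸ trivial
    induction ha using Submodule.span_induction with
    | mem x h => exact hS' x h
    | zero => intro m; rw [map_zero, zero_mul]; exact W.zero_mem
    | add x y _ _ hx hy => intro m; rw [map_add, add_mul]; exact W.add_mem (hx m) (hy m)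
    | smul p x _ hx =>
      change ∀ m, α (Polynomial.aeval f p * x) * β g ^ m ∈ W
      induction p using Polynomial.induction_on' with
      | add p q hp hq =>
        intro m
        rw [map_add, add_mul, map_add, add_mul]
        exact W.add_mem (hp m) (hq m)
      | monomial j c =>
        induction j with
        | zero =>
          intro m
          rw [Polynomial.monomial_zero_left, Polynomial.aeval_C, ← Algebra.smul_def, map_smul,
            smul_mul_assoc]
          exact W.smul_mem _ (hx m)
        | succ j ih =>
          have e : Polynomial.aeval f (Polynomial.monomial (j + 1) c) * x =
              f * (Polynomial.aeval f (Polynomial.monomial j c) * x) := by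
            simp only [Polynomial.aeval_monomial]; ring
          intro m
          rw [e]
          cases m with
          | zero =>
            rw [pow_zero, mul_one]
            exact Submodule.mem_sup_left (Submodule.mem_sup_left ⟨_, rfl⟩)
          | succ m =>
            have := ih m
            rwa [map_mul, pow_succ', mul_mul_mul_comm, hfg, one_mul]
  have hW : W = ⊤ := by
    rw [eq_top_iff]
    rintro x -
    obtain ⟨m, a, rfl⟩ := hα x
    exact key a m
  have h1 : Submodule.map R.mkQ (Submodule.span k T) = ⊤ := by
    have h2 := congrArg (Submodule.map R.mkQ) hW
    rw [Submodule.map_top, Submodule.range_mkQ] at h2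
    rwa [Submodule.map_sup, Submodule.mkQ_map_self, bot_sup_eq] at h2
  refine ⟨?_⟩
  rw [← h1]
  exact (Submodule.fg_span hT).map _

/-- The coefficients of a monic equation over the subring generated by `S` lift along `ψ.comp φ`,
and injectivity of `ψ` carries the equation back to `B`. -/
theorem isIntegralElem_of_comp {A B F : Type*} [CommRing A] [CommRing B] [Field F] (φ : A →+* B)
    (ψ : B →+* F) (hψ : Function.Injective ψ) (S : Set F)
    (hS : S ⊆ (ψ.comp φ).range) (b : B)
    (hb : ψ b ∈ integralClosure (Subring.closure S) F) : φ.IsIntegralElem b := by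
  obtain ⟨p, hp, hp0⟩ := hb
  have hle : Subring.closure S ≤ (ψ.comp φ).range := Subring.closure_le.mpr hS
  let p' := p.map (Subring.inclusion hle)
  have hp' : p'.Monic := hp.map _
  obtain ⟨q, hq, -, hqm⟩ := Polynomial.lifts_and_natDegree_eq_and_monic
    ((Polynomial.lifts_iff_coeff_lifts _).mpr fun n => by
      obtain ⟨x, hx⟩ := (ψ.comp φ).rangeRestrict_surjective (p'.coeff n)
      exact ⟨x, hx⟩) hp'
  refine ⟨q, hqm, hψ ?_⟩
  rw [map_zero, Polynomial.hom_eval₂, ← hp0]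
  have e1 : ψ.comp φ = ((ψ.comp φ).range.subtype).comp (ψ.comp φ).rangeRestrict := rfl
  rw [e1, ← Polynomial.eval₂_map, hq, Polynomial.eval₂_map]
  rfl

end Alg

variable {k : Type u} [Field k] {X : Scheme.{u}} (s : X ⟶ Spec (CommRingCat.of k))

theorem le_preimage_of_closedPoint_mem {R : Type u} [CommRing R] [IsLocalRing R]
    (l : Spec (CommRingCat.of R) ⟶ X) {U : X.Opens} (h : l (IsLocalRing.closedPoint R) ∈ U) :
    ⊤ ≤ l ⁻¹ᵁ U := by
  have : l ⁻¹ᵁ U = ⊤ := (IsLocalRing.closed_point_mem_iff (R := R)).mp h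
  exact this.ge

/-- By the valuative criterion `P` extends to `Spec O`. If the closed point lands in `V`, then `g`
is invertible on `Spec O` because its inverse `f` has value in `O`, so the extension still lands in
`X.basicOpen g ≤ U`. In every case the functions on `U` can be evaluated in `O`. -/
theorem evalAt_mem_valuationSubring [UniversallyClosed s] {U V : X.Opens}
    (hUV : U ⊔ V = ⊤) {F : Type u} [Field F] (P : Spec (CommRingCat.of F) ⟶ X)
    (hPU : ⊤ ≤ P ⁻¹ᵁ U) (hPV : ⊤ ≤ P ⁻¹ᵁ V) (f : Γ(X, U)) (g : Γ(X, V)) (hg : X.basicOpen g ≤ U)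
    (hfg : evalAt P U hPU f * evalAt P V hPV g = 1) (O : ValuationSubring F)
    (hk : ∀ c, evalAt P U hPU (scalar s U c) ∈ O) (hf : evalAt P U hPU f ∈ O)
    (b : Γ(X, U)) : evalAt P U hPU b ∈ O := by
  let φ : k →+* O := ((evalAt P U hPU).comp (scalar s U)).codRestrict O.toSubring hk
  have sq : CommSq P (Spec.map (CommRingCat.ofHom (algebraMap O F))) s
      (Spec.map (CommRingCat.ofHom φ)) := by
    refine ⟨?_⟩
    rw [← Spec.map_comp, ← CommRingCat.ofHom_comp]
    let _ : Algebra k F := ((algebraMap O F).comp φ).toAlgebra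
    exact comp_eq_specMap_of_evalAt_scalar P U hPU fun c => rfl
  have hX : ValuativeCriterion.Existence s := by
    have h : UniversallyClosed s := inferInstance
    rw [UniversallyClosed.eq_valuativeCriterion] at h
    exact h.1
  obtain ⟨⟨l, hl, -⟩⟩ := hX ⟨O, F, _, _, sq⟩
  dsimp only at l hl
  have hmem (W : X.Opens) (hW : ⊤ ≤ l ⁻¹ᵁ W) (hPW : ⊤ ≤ P ⁻¹ᵁ W) (x : Γ(X, W)) :
      (evalAt l W hW x : F) = evalAt P W hPW x := by
    have hW' : ⊤ ≤ (Spec.map (CommRingCat.ofHom (algebraMap O F)) ≫ l) ⁻¹ᵁ W := hl.symm ▸ hPW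
    refine (evalAt_specMap (algebraMap O F) l W hW hW' x).symm.trans ?_
    congr 1
    simp only [hl]
  have hU : ⊤ ≤ l ⁻¹ᵁ U := by
    have h0 : l (IsLocalRing.closedPoint O) ∈ U ⊔ V := hUV ▸ trivial
    rcases h0 with h | h
    · exact le_preimage_of_closedPoint_mem l h
    · have hV := le_preimage_of_closedPoint_mem l h
      have hu : IsUnit (evalAt l V hV g) := by
        refine IsUnit.of_mul_eq_one ⟨_, hf⟩ (Subtype.ext ?_)
        rw [mul_comm]
        change evalAt P U hPU f * (evalAt l V hV g : F) = 1
        rw [hmem V hV hPV, hfg]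
      exact (le_preimage_basicOpen hV g hu).trans (l.preimage_mono hg)
  rw [← hmem U hU hPU b]
  exact Subtype.property _

theorem le_preimage_fromSpecStalk {U : X.Opens} {x : X} (hx : x ∈ U) :
    ⊤ ≤ X.fromSpecStalk x ⁻¹ᵁ U := by
  rintro y -
  have h : X.fromSpecStalk x y ∈ Set.range (X.fromSpecStalk x) := ⟨y, rfl⟩
  rw [Scheme.range_fromSpecStalk] at h
  have h' : X.fromSpecStalk x y ⤳ x := h
  exact h'.mem_open U.isOpen hx

variable [IsIntegral X]

/-- The integral closure of `k[f]` in the function field is the intersection of the valuation rings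
containing `k` and `f`, and `evalAt_mem_valuationSubring` puts every function on `U` in each of
them. -/
theorem isIntegralElem_aeval [UniversallyClosed s] {U V : X.Opens}
    (hUV : U ⊔ V = ⊤) (hη : genericPoint X ∈ U ⊓ V) (f : Sec s U) (g : Sec s V)
    (hg : X.basicOpen (U := V) g ≤ U)
    (hfg : Sec.res s (inf_le_left : U ⊓ V ≤ U) f * Sec.res s (inf_le_right : U ⊓ V ≤ V) g = 1)
    (b : Sec s U) :
    (Polynomial.aeval (R := k) f : Polynomial k →ₐ[k] Sec s U).toRingHom.IsIntegralElem b := by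
  let P : Spec (CommRingCat.of X.functionField) ⟶ X := X.fromSpecStalk (genericPoint X)
  have hPU : ⊤ ≤ P ⁻¹ᵁ U := le_preimage_fromSpecStalk hη.1
  have hPV : ⊤ ≤ P ⁻¹ᵁ V := le_preimage_fromSpecStalk hη.2
  have hev (W : X.Opens) (hW : genericPoint X ∈ W) (h : ⊤ ≤ P ⁻¹ᵁ W) (x : Γ(X, W)) :
      evalAt P W h x = toFunctionField W hW x := evalAt_fromSpecStalk _ hW h x
  let ψ : Sec s U →+* X.functionField := toFunctionField U hη.1
  refine isIntegralElem_of_comp _ ψ (toFunctionField_injective U hη.1)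
    (Set.range (fun c => ψ (scalar s U c)) ∪ {ψ f}) ?_ b ?_
  · rintro _ (⟨c, rfl⟩ | rfl)
    · exact ⟨Polynomial.C c, congrArg ψ (Polynomial.aeval_C f c)⟩
    · exact ⟨Polynomial.X, congrArg ψ (Polynomial.aeval_X f)⟩
  · change ψ b ∈ (integralClosure (Subring.closure _) X.functionField).toSubring
    rw [← iInf_valuationSubring_superset, Subring.mem_iInf]
    rintro ⟨O, hO⟩
    have := evalAt_mem_valuationSubring s hUV P hPU hPV f g hg ?_ O ?_ ?_ b
    · exact (hev U hη.1 hPU b) ▸ this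
    · refine (congr($(hev U hη.1 hPU f) * $(hev V hη.2 hPV g))).trans ?_
      refine (congr($((toFunctionField_map (inf_le_left : U ⊓ V ≤ U) hη f).symm) *
        $((toFunctionField_map (inf_le_right : U ⊓ V ≤ V) hη g).symm))).trans ?_
      exact (map_mul _ _ _).symm.trans ((congrArg _ hfg).trans (map_one _))
    · intro c
      exact (hev U hη.1 hPU _).symm ▸ hO (Or.inl ⟨c, rfl⟩)
    · exact (hev U hη.1 hPU f).symm ▸ hO (Or.inr rfl)

theorem exists_mul_pow_eq_map {U W : X.Opens} (hU : IsAffineOpen U) (hWU : W ≤ U) (f : Γ(X, U))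
    (hf : X.basicOpen f = W) (hη : genericPoint X ∈ W) (x : Γ(X, W)) :
    ∃ (n : ℕ) (a : Γ(X, U)), x * (X.presheaf.map (homOfLE hWU).op).hom f ^ n =
      (X.presheaf.map (homOfLE hWU).op).hom a := by
  obtain ⟨n, a, h⟩ := (mem_range_toFunctionField_basicOpen_iff hU f hf.symm hη _).mp ⟨x, rfl⟩
  refine ⟨n, a, toFunctionField_injective W hη ?_⟩
  rw [map_mul, map_pow, toFunctionField_map hWU hη, toFunctionField_map hWU hη, h]

omit [IsIntegral X] in
theorem finiteType_scalar [LocallyOfFiniteType s] {U : X.Opens} (hU : IsAffineOpen U) :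
    (scalar s U).FiniteType := by
  have h := s.finiteType_appLE (isAffineOpen_top _) hU le_top
  exact RingHom.FiniteType.comp h (RingHom.FiniteType.of_surjective _
    (Scheme.ΓSpecIso (CommRingCat.of k)).commRingCatIsoToRingEquiv.symm.surjective)

theorem finite_aeval [UniversallyClosed s] [LocallyOfFiniteType s] {U V : X.Opens}
    (hU : IsAffineOpen U) (hUV : U ⊔ V = ⊤) (hη : genericPoint X ∈ U ⊓ V) (f : Sec s U)
    (g : Sec s V) (hg : X.basicOpen (U := V) g ≤ U)
    (hfg : Sec.res s (inf_le_left : U ⊓ V ≤ U) f * Sec.res s (inf_le_right : U ⊓ V ≤ V) g = 1) :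
    (Polynomial.aeval (R := k) f : Polynomial k →ₐ[k] Sec s U).toRingHom.Finite := by
  refine RingHom.IsIntegral.to_finite (isIntegralElem_aeval s hUV hη f g hg hfg) ?_
  refine RingHom.FiniteType.of_comp_finiteType (f := Polynomial.C) ?_
  convert! finiteType_scalar s hU
  ext c
  exact Polynomial.aeval_C f c

/-- `H¹` is finite dimensional, for a two-chart covering. -/
theorem finite_sections_quotient [UniversallyClosed s] [LocallyOfFiniteType s] {U V : X.Opens}
    (hU : IsAffineOpen U) (hV : IsAffineOpen V) (hUV : U ⊔ V = ⊤) (hη : genericPoint X ∈ U ⊓ V)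
    (f : Sec s U) (g : Sec s V) (hf : X.basicOpen (U := U) f = U ⊓ V)
    (hg : X.basicOpen (U := V) g = U ⊓ V)
    (hfg : Sec.res s (inf_le_left : U ⊓ V ≤ U) f * Sec.res s (inf_le_right : U ⊓ V ≤ V) g = 1) :
    FiniteDimensional k (Sec s (U ⊓ V) ⧸
      (LinearMap.range (Sec.res s (inf_le_left : U ⊓ V ≤ U)).toLinearMap ⊔
        LinearMap.range (Sec.res s (inf_le_right : U ⊓ V ≤ V)).toLinearMap)) := by
  refine finite_quotient_sup (Sec.res s _) (Sec.res s _) f g hfg (fun x => ?_)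
    (exists_mul_pow_eq_map hV inf_le_right g hg hη)
    (finite_aeval s hU hUV hη f g (hg.le.trans inf_le_left) hfg)
  obtain ⟨n, a, h⟩ := exists_mul_pow_eq_map hU inf_le_left f hf hη x
  refine ⟨n, a, ?_⟩
  have h1 : x * Sec.res s (inf_le_left : U ⊓ V ≤ U) f ^ n = Sec.res s inf_le_left a := h
  rw [← h1, mul_assoc, ← mul_pow, hfg, one_pow, mul_one]

/-- `H⁰` is finite dimensional, for a two-chart covering. -/
theorem finite_sections_inf [UniversallyClosed s] [LocallyOfFiniteType s] {U V : X.Opens}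
    (hUV : U ⊔ V = ⊤) :
    FiniteDimensional k
      ↥(LinearMap.range (Sec.res s (inf_le_left : U ⊓ V ≤ U)).toLinearMap ⊓
        LinearMap.range (Sec.res s (inf_le_right : U ⊓ V ≤ V)).toLinearMap) := by
  have h1 : (scalar s ⊤).Finite := by
    have h := finite_appTop_of_universallyClosed k s
    have e : scalar s ⊤ = s.appTop.hom.comp (Scheme.ΓSpecIso (CommRingCat.of k)).inv.hom := by
      simp only [scalar]
      have : X.presheaf.map (homOfLE (le_top : (⊤ : X.Opens) ≤ ⊤)).op = 𝟙 _ :=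
        X.presheaf.map_id _
      rw [this, Category.comp_id]
      rfl
    rw [e]
    exact h.comp (RingHom.Finite.of_surjective _
      (Scheme.ΓSpecIso (CommRingCat.of k)).commRingCatIsoToRingEquiv.symm.surjective)
  have h2 : FiniteDimensional k (Sec s ⊤) := h1
  refine Submodule.finiteDimensional_of_le
    (S₂ := LinearMap.range (Sec.res s (le_top : U ⊓ V ≤ ⊤)).toLinearMap) ?_
  rintro z ⟨⟨x, hx⟩, ⟨y, hy⟩⟩
  obtain ⟨r, hr, -⟩ := exists_secRes_eq_two (F := structureSheafAb X) le_top le_top hUV.ge x y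
    (hx.trans hy.symm)
  refine ⟨r, Eq.trans ?_ hx⟩
  rw [← hr]
  exact (secRes_secRes (F := structureSheafAb X) inf_le_left le_top r).symm

end CurvesOverFiniteFields

end

/-! ### Covers of projective curves by two charts. -/

noncomputable section

namespace CurvesOverFiniteFields

section Chart

theorem preimage_basicOpen_eq {X : Scheme.{u}} {R : Type u} [CommRing R]
    (P : Spec (CommRingCat.of R) ⟶ X) (U : X.Opens) (h : ⊤ ≤ P ⁻¹ᵁ U) (x : Γ(X, U)) :
    P ⁻¹ᵁ X.basicOpen x = PrimeSpectrum.basicOpen (evalAt P U h x) := by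
  have h2 := Scheme.basicOpen_appLE P ⊤ U h x
  rw [top_inf_eq] at h2
  exact h2.symm.trans (basicOpen_eq_of_affine' _)

variable {σ : Type*} {A : Type u} [CommRing A] [SetLike σ A] [AddSubgroupClass σ A]
  (𝒜 : ℕ → σ) [GradedRing 𝒜]

open HomogeneousLocalization

theorem le_preimage_awayι {f : A} {m : ℕ} (hf : f ∈ 𝒜 m) (hm : 0 < m) :
    ⊤ ≤ Proj.awayι 𝒜 f hf hm ⁻¹ᵁ Proj.basicOpen 𝒜 f := by
  rintro y -
  change _ ∈ Proj.basicOpen 𝒜 f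
  rw [← Proj.opensRange_awayι 𝒜 f hf hm]
  exact ⟨y, rfl⟩

theorem evalAt_awayι {f : A} {m : ℕ} (hf : f ∈ 𝒜 m) (hm : 0 < m) (a : Away 𝒜 f) :
    evalAt (R := Away 𝒜 f) (Proj.awayι 𝒜 f hf hm) (Proj.basicOpen 𝒜 f) (le_preimage_awayι 𝒜 hf hm)
      ((Proj.awayToSection 𝒜 f).hom a) = a := by
  have hU := Proj.isAffineOpen_basicOpen 𝒜 f hf hm
  let φ : Γ(Proj 𝒜, Proj.basicOpen 𝒜 f) →+* Away 𝒜 f := (Proj.basicOpenIsoAway 𝒜 f hf hm).inv.hom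
  have h : Proj.awayι 𝒜 f hf hm = Spec.map (CommRingCat.ofHom φ) ≫ hU.fromSpec := by
    rw [Proj.awayι, Iso.inv_comp_eq, Proj.basicOpenIsoSpec_hom, Proj.basicOpenToSpec,
      Category.assoc, ← Proj.basicOpenIsoAway_hom 𝒜 f hf hm, ← Spec.map_comp_assoc]
    change _ = _ ≫ Spec.map ((Proj.basicOpenIsoAway 𝒜 f hf hm).inv ≫ _) ≫ _
    rw [Iso.inv_hom_id, Spec.map_id, Category.id_comp, hU.toSpecΓ_fromSpec]
  have h1 := evalAt_specMap_fromSpec hU φ ((Proj.awayToSection 𝒜 f).hom a)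
  simp only [h]
  refine h1.trans ?_
  have := (Proj.basicOpenIsoAway 𝒜 f hf hm).hom_inv_id
  rw [Proj.basicOpenIsoAway_hom] at this
  exact congr($this a)

/-- The section is a power of `g / f`, which on the chart of `f` vanishes exactly where `g` does. -/
theorem basicOpen_awayToSection {f g : A} {m : ℕ} (hf : f ∈ 𝒜 m) (hm : 0 < m) (hg : g ∈ 𝒜 m) :
    (Proj 𝒜).basicOpen ((Proj.awayToSection 𝒜 f).hom (Away.isLocalizationElem hf hg)) =
      Proj.basicOpen 𝒜 f ⊓ Proj.basicOpen 𝒜 g := by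
  have h := preimage_basicOpen_eq (R := Away 𝒜 f) (Proj.awayι 𝒜 f hf hm) _
    (le_preimage_awayι 𝒜 hf hm) ((Proj.awayToSection 𝒜 f).hom (Away.isLocalizationElem hf hg))
  rw [evalAt_awayι, ← Proj.awayι_preimage_basicOpen 𝒜 hf hm hg hm] at h
  ext x
  constructor
  · intro hx
    have hxf := (Proj 𝒜).basicOpen_le _ hx
    refine ⟨hxf, ?_⟩
    obtain ⟨y, rfl⟩ : x ∈ (Proj.awayι 𝒜 f hf hm).opensRange :=
      (Proj.opensRange_awayι 𝒜 f hf hm).symm ▸ hxf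
    exact h.le hx
  · rintro ⟨hxf, hxg⟩
    obtain ⟨y, rfl⟩ : x ∈ (Proj.awayι 𝒜 f hf hm).opensRange :=
      (Proj.opensRange_awayι 𝒜 f hf hm).symm ▸ hxf
    exact h.ge hxg

theorem awayToSection_mul_awayToSection {f g : A} {m : ℕ} (hf : f ∈ 𝒜 m) (hg : g ∈ 𝒜 m)
    {W : (Proj 𝒜).Opens} (hW : W = Proj.basicOpen 𝒜 (f * g)) (h₁ : W ≤ Proj.basicOpen 𝒜 f)
    (h₂ : W ≤ Proj.basicOpen 𝒜 g) :
    ((Proj 𝒜).presheaf.map (homOfLE h₁).op).hom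
        ((Proj.awayToSection 𝒜 f).hom (Away.isLocalizationElem hf hg)) *
      ((Proj 𝒜).presheaf.map (homOfLE h₂).op).hom
        ((Proj.awayToSection 𝒜 g).hom (Away.isLocalizationElem hg hf)) = 1 := by
  subst hW
  have e₁ := congr($(Proj.awayMap_awayToSection 𝒜 hg (f := f) rfl) (Away.isLocalizationElem hf hg))
  have e₂ := congr($(Proj.awayMap_awayToSection 𝒜 hf (f := g) (mul_comm f g))
    (Away.isLocalizationElem hg hf))
  refine (congr($(e₁.symm) * $(e₂.symm))).trans ?_
  refine (map_mul (Proj.awayToSection 𝒜 (f * g)).hom _ _).symm.trans ?_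
  refine (congrArg _ ?_).trans (map_one (Proj.awayToSection 𝒜 (f * g)).hom)
  change awayMap 𝒜 hg rfl _ * awayMap 𝒜 hf (mul_comm f g) _ = _
  rw [awayMap_mk, awayMap_mk]
  ext
  rw [val_mul, Away.val_mk, Away.val_mk, Localization.mk_mul, val_one, ← Localization.mk_one,
    Localization.mk_eq_mk_iff, Localization.r_iff_exists]
  refine ⟨1, ?_⟩
  simp only [Submonoid.coe_mul, Submonoid.coe_one]
  ring

end Chart

section Avoidance

variable {A : Type u} [CommRing A] {σ : Type*} [SetLike σ A] [AddSubgroupClass σ A]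
  (𝒜 : ℕ → σ) [GradedRing 𝒜]

theorem exists_mem_not_mem_of_not_le {I J : HomogeneousIdeal 𝒜} (h : ¬ I ≤ J) :
    ∃ (d : ℕ) (a : A), a ∈ 𝒜 d ∧ a ∈ I ∧ a ∉ J := by
  by_contra! hc
  refine h fun a ha => ?_
  change a ∈ J.toIdeal
  rw [J.isHomogeneous.mem_iff]
  exact fun i => hc i _ (SetLike.coe_mem _) (I.isHomogeneous i ha)

theorem exists_pos_degree_not_mem (x : ProjectiveSpectrum 𝒜) :
    ∃ (d : ℕ) (a : A), 0 < d ∧ a ∈ 𝒜 d ∧ a ∉ x.asHomogeneousIdeal := by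
  obtain ⟨d, a, had, haI, haJ⟩ := exists_mem_not_mem_of_not_le 𝒜 x.not_irrelevant_le
  refine ⟨d, a, Nat.pos_of_ne_zero ?_, had, haJ⟩
  rintro rfl
  have h0 : GradedRing.proj 𝒜 0 a = 0 := haI
  rw [GradedRing.proj_apply, DirectSum.decompose_of_mem_same 𝒜 had] at h0
  exact haJ (h0 ▸ zero_mem _)

/-- Multiply homogeneous elements, one from each member of `Q`, that avoid the prime `x`. -/
theorem exists_homogeneous_mem_not_mem (Q : Set (ProjectiveSpectrum 𝒜)) (hQ : Q.Finite)
    (x : ProjectiveSpectrum 𝒜) (h : ∀ q ∈ Q, ¬ q.asHomogeneousIdeal ≤ x.asHomogeneousIdeal) :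
    ∃ (d : ℕ) (a : A), 0 < d ∧ a ∈ 𝒜 d ∧ (∀ q ∈ Q, a ∈ q.asHomogeneousIdeal) ∧
      a ∉ x.asHomogeneousIdeal := by
  induction Q, hQ using Set.Finite.induction_on with
  | empty =>
    obtain ⟨d, a, hd, had, ha⟩ := exists_pos_degree_not_mem 𝒜 x
    exact ⟨d, a, hd, had, by simp, ha⟩
  | @insert q Q _ _ ih =>
    obtain ⟨d, a, hd, had, haQ, hax⟩ := ih fun q hq => h q (Or.inr hq)
    obtain ⟨e, b, hbe, hbq, hbx⟩ := exists_mem_not_mem_of_not_le 𝒜 (h q (Or.inl rfl))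
    refine ⟨d + e, a * b, by omega, SetLike.mul_mem_graded had hbe, ?_, fun hab => ?_⟩
    · rintro q' (rfl | hq')
      · exact Ideal.mul_mem_left q'.asHomogeneousIdeal.toIdeal _ hbq
      · exact Ideal.mul_mem_right _ q'.asHomogeneousIdeal.toIdeal (haQ q' hq')
    · exact (x.isPrime.mem_or_mem hab).elim hax hbx

/-- Homogeneous prime avoidance. -/
theorem exists_homogeneous_not_mem (Q : Set (ProjectiveSpectrum 𝒜)) (hQ : Q.Finite)
    (h : ∀ q ∈ Q, ∀ q' ∈ Q, q.asHomogeneousIdeal ≤ q'.asHomogeneousIdeal → q = q') :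
    ∃ (d : ℕ) (a : A), 0 < d ∧ a ∈ 𝒜 d ∧ ∀ q ∈ Q, a ∉ q.asHomogeneousIdeal := by
  induction Q, hQ using Set.Finite.induction_on with
  | empty => exact ⟨1, 0, one_pos, zero_mem _, by simp⟩
  | @insert x Q hx hQ ih =>
    obtain ⟨d, a, hd, had, haQ⟩ := ih fun q hq q' hq' => h q (Or.inr hq) q' (Or.inr hq')
    by_cases hax : a ∈ x.asHomogeneousIdeal
    · obtain ⟨e, b, he, hbe, hbQ, hbx⟩ := exists_homogeneous_mem_not_mem 𝒜 Q hQ x fun q hq hle =>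
        hx (h q (Or.inr hq) x (Or.inl rfl) hle ▸ hq)
      -- Here `a` vanishes at `x` and nowhere on `Q`, while `b` vanishes on all of `Q` and not at
      -- `x`. The exponents bring both to degree `d * e`.
      refine ⟨d * e, a ^ e + b ^ d, Nat.mul_pos hd he, add_mem ?_ ?_, ?_⟩
      · have := SetLike.pow_mem_graded e had
        rwa [smul_eq_mul, mul_comm] at this
      · exact SetLike.pow_mem_graded d hbe
      · rintro q (rfl | hq) hmem
        · have h1 : a ^ e ∈ q.asHomogeneousIdeal.toIdeal := Ideal.pow_mem_of_mem _ hax e he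
          exact hbx (q.isPrime.mem_of_pow_mem d ((Ideal.add_mem_iff_right _ h1).mp hmem))
        · have h1 : b ^ d ∈ q.asHomogeneousIdeal.toIdeal := Ideal.pow_mem_of_mem _ (hbQ q hq) d hd
          exact haQ q hq (q.isPrime.mem_of_pow_mem e ((Ideal.add_mem_iff_left _ h1).mp hmem))
    · refine ⟨d, a, hd, had, ?_⟩
      rintro q (rfl | hq)
      · exact hax
      · exact haQ q hq

end Avoidance

section Topology

theorem eq_of_specializes_of_topologicalKrullDim_le_one {X : Type*} [TopologicalSpace X] [T0Space X]
    (hX : topologicalKrullDim X ≤ 1) {η x y : X} (hηx : η ⤳ x) (hxη : x ≠ η) (h : x ⤳ y) :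
    x = y := by
  by_contra hxy
  let Z (z : X) : IrreducibleCloseds X := ⟨closure {z}, isIrreducible_singleton.closure, isClosed_closure⟩
  have hlt {a b : X} (hab : a ⤳ b) (hne : a ≠ b) : Z b < Z a := by
    refine lt_of_le_of_ne (specializes_iff_closure_subset.mp hab) fun he => hne ?_
    have : closure {b} = closure {a} := congrArg (fun T : IrreducibleCloseds X => (T : Set X)) he
    exact (inseparable_iff_closure_eq.mpr this).eq.symm
  let p : LTSeries (IrreducibleCloseds X) :=
    { length := 2
      toFun := ![Z y, Z x, Z η]
      step := fun i => by
        fin_cases i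
        · exact hlt h hxy
        · exact hlt hηx hxη.symm }
  have := Order.LTSeries.length_le_krullDim p
  have h2 : ((2 : ℕ) : WithBot ℕ∞) ≤ ((1 : ℕ) : WithBot ℕ∞) := this.trans hX
  norm_cast at h2

/-- There are finitely many irreducible components. The generic point of each differs from `η`,
hence in dimension at most one has no proper specialization, so each component is a point. -/
theorem finite_of_isClosed_of_notMem {X : Type*} [TopologicalSpace X] [T0Space X] [QuasiSober X]
    [NoetherianSpace X] (hX : topologicalKrullDim X ≤ 1) {η : X} (hη : ∀ x, η ⤳ x) {Z : Set X}
    (hZ : IsClosed Z) (hηZ : η ∉ Z) : Z.Finite := by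
  obtain ⟨S, hS, hcl, hirr, rfl⟩ := NoetherianSpace.exists_finite_set_isClosed_irreducible hZ
  refine hS.sUnion fun t ht => ?_
  obtain ⟨z, hz⟩ := QuasiSober.sober (hirr t ht) (hcl t ht)
  refine (Set.finite_singleton z).subset fun y hy => ?_
  have hzy : z ⤳ y := specializes_iff_mem_closure.mpr (hz.def.symm ▸ hy)
  have hzη : z ≠ η := by
    rintro rfl
    refine hηZ (Set.mem_sUnion_of_mem ?_ ht)
    exact hz.def ▸ subset_closure rfl
  exact (eq_of_specializes_of_topologicalKrullDim_le_one hX (hη z) hzη hzy).symm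

end Topology

/-- A pair of affine charts, each given in the other by the nonvanishing of a function. -/
structure TwoChart (X : Scheme.{u}) where
  U : X.Opens
  V : X.Opens
  isAffineOpen_left : IsAffineOpen U
  isAffineOpen_right : IsAffineOpen V
  f : Γ(X, U)
  g : Γ(X, V)
  basicOpen_f : X.basicOpen f = U ⊓ V
  basicOpen_g : X.basicOpen g = U ⊓ V
  mul_eq_one : (X.presheaf.map (homOfLE (inf_le_left : U ⊓ V ≤ U)).op).hom f *
    (X.presheaf.map (homOfLE (inf_le_right : U ⊓ V ≤ V)).op).hom g = 1

/-- The preimage of a pair of charts under an affine morphism. -/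
def TwoChart.pull {X Y : Scheme.{u}} (c : TwoChart Y) (v : X ⟶ Y) [IsAffineHom v] : TwoChart X where
  U := v ⁻¹ᵁ c.U
  V := v ⁻¹ᵁ c.V
  isAffineOpen_left := c.isAffineOpen_left.preimage v
  isAffineOpen_right := c.isAffineOpen_right.preimage v
  f := (v.app c.U).hom c.f
  g := (v.app c.V).hom c.g
  basicOpen_f := (Scheme.preimage_basicOpen v c.f).symm.trans (congrArg _ c.basicOpen_f)
  basicOpen_g := (Scheme.preimage_basicOpen v c.g).symm.trans (congrArg _ c.basicOpen_g)
  mul_eq_one := by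
    have e₁ := congr($(v.naturality (homOfLE (inf_le_left : c.U ⊓ c.V ≤ c.U)).op) c.f)
    have e₂ := congr($(v.naturality (homOfLE (inf_le_right : c.U ⊓ c.V ≤ c.V)).op) c.g)
    refine (congr($(e₁.symm) * $(e₂.symm))).trans ?_
    exact (map_mul (v.app (c.U ⊓ c.V)).hom _ _).symm.trans
      ((congrArg _ c.mul_eq_one).trans (map_one _))

/-- The two charts of projective space given by two homogeneous elements of the same degree. -/
def projTwoChart {σ : Type*} {A : Type u} [CommRing A] [SetLike σ A] [AddSubgroupClass σ A]
    (𝒜 : ℕ → σ) [GradedRing 𝒜] {a b : A} {m : ℕ} (hm : 0 < m) (ha : a ∈ 𝒜 m) (hb : b ∈ 𝒜 m) :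
    TwoChart (Proj 𝒜) where
  U := Proj.basicOpen 𝒜 a
  V := Proj.basicOpen 𝒜 b
  isAffineOpen_left := Proj.isAffineOpen_basicOpen 𝒜 a ha hm
  isAffineOpen_right := Proj.isAffineOpen_basicOpen 𝒜 b hb hm
  f := (Proj.awayToSection 𝒜 a).hom (HomogeneousLocalization.Away.isLocalizationElem ha hb)
  g := (Proj.awayToSection 𝒜 b).hom (HomogeneousLocalization.Away.isLocalizationElem hb ha)
  basicOpen_f := basicOpen_awayToSection 𝒜 ha hm hb
  basicOpen_g := (basicOpen_awayToSection 𝒜 hb hm ha).trans (inf_comm _ _)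
  mul_eq_one := awayToSection_mul_awayToSection 𝒜 ha hb (Proj.basicOpen_mul 𝒜 a b).symm _ _

section Curve

variable {k : Type u} [Field k] {Y : Scheme.{u}} {s : Y ⟶ Spec (CommRingCat.of k)}

attribute [local instance] MvPolynomial.gradedAlgebra

theorem isProper_projectiveSpaceToSpec (n : ℕ) : IsProper (projectiveSpaceToSpec k n) := by
  let 𝒜 := MvPolynomial.homogeneousSubmodule (Fin (n + 1)) k
  have h1 : Algebra.FiniteType (𝒜 0) (MvPolynomial (Fin (n + 1)) k) := by
    have : IsScalarTower k (𝒜 0) (MvPolynomial (Fin (n + 1)) k) :=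
      .of_algebraMap_eq (R := k) (S := 𝒜 0) fun _ => rfl
    exact Algebra.FiniteType.of_restrictScalars_finiteType k _ _
  have h2 : Function.Surjective (algebraMap k (𝒜 0)) := by
    rintro ⟨p, hp⟩
    refine ⟨p.coeff 0, Subtype.ext ?_⟩
    have hp' : p.totalDegree = 0 := (MvPolynomial.totalDegree_zero_iff_isHomogeneous (p := p)).mpr hp
    exact (MvPolynomial.totalDegree_eq_zero_iff_eq_C.mp hp').symm
  have h3 : IsClosedImmersion (Spec.map (CommRingCat.ofHom (algebraMap k (𝒜 0)))) :=
    IsClosedImmersion.spec_of_surjective _ h2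
  have h4 : IsProper (Proj.toSpecZero 𝒜) := inferInstance
  exact inferInstanceAs (IsProper (Proj.toSpecZero 𝒜 ≫ _))

theorem IsProjectiveCurve.isProper (h : IsProjectiveCurve s) : IsProper s := by
  obtain ⟨n, i, hi, rfl⟩ := h.isProjective
  have := isProper_projectiveSpaceToSpec (k := k) n
  infer_instance

theorem IsProjectiveCurve.isNoetherian (h : IsProjectiveCurve s) : IsNoetherian Y := by
  have := h.isProper
  have h1 : IsLocallyNoetherian Y := LocallyOfFiniteType.isLocallyNoetherian s
  have h2 : CompactSpace Y := (quasiCompact_iff_compactSpace (f := s)).mp inferInstance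
  exact {}

theorem IsProjectiveCurve.eq_of_specializes [IsIntegral Y] (h : IsProjectiveCurve s) {x y : Y}
    (hx : x ≠ genericPoint Y) (hxy : x ⤳ y) : x = y :=
  eq_of_specializes_of_topologicalKrullDim_le_one h.dim_eq_one.le (genericPoint_specializes x) hx hxy

theorem IsProjectiveCurve.finite_of_isClosed [IsIntegral Y] (h : IsProjectiveCurve s) {Z : Set Y}
    (hZ : IsClosed Z) (hη : genericPoint Y ∉ Z) : Z.Finite := by
  have := h.isNoetherian
  exact finite_of_isClosed_of_notMem h.dim_eq_one.le genericPoint_specializes hZ hη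

/-- Let `V` be the nonvanishing locus of a form `a` that vanishes on `T` but not at the generic
point. Its complement is finite, so some form `b` vanishes at none of its points, and the
nonvanishing locus of `b` is `U`. Powers equalize the degrees, and quotients of the two forms give
the chart functions. -/
theorem IsProjectiveCurve.exists_twoChart [IsIntegral Y] (h : IsProjectiveCurve s) {T : Set Y}
    (hT : T.Finite) (hη : genericPoint Y ∉ T) :
    ∃ c : TwoChart Y, c.U ⊔ c.V = ⊤ ∧ genericPoint Y ∈ c.U ⊓ c.V ∧
      ∀ t ∈ T, t ∈ c.U ∧ t ∉ c.V := by
  obtain ⟨n, i₀, hi₀, -⟩ := h.isProjective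
  let 𝒜 := MvPolynomial.homogeneousSubmodule (Fin (n + 1)) k
  let i : Y ⟶ Proj 𝒜 := i₀
  have hi : IsClosedImmersion i := hi₀
  let j : Y → ProjectiveSpectrum 𝒜 := i
  have hj {x y : Y} (hxy : (j x).asHomogeneousIdeal ≤ (j y).asHomogeneousIdeal) : x ⤳ y := by
    have h1 : i x ⤳ i y := specializes_iff_mem_closure.mpr
      ((ProjectiveSpectrum.le_iff_mem_closure 𝒜 (j x) (j y)).mp hxy)
    exact i.isEmbedding.isInducing.specializes_iff.mp h1
  obtain ⟨d, a, hd, had, haT, haη⟩ := exists_homogeneous_mem_not_mem 𝒜 (j '' T) (hT.image j)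
    (j (genericPoint Y)) (by
      rintro _ ⟨t, ht, rfl⟩ hle
      have := (hj hle).antisymm (genericPoint_specializes t)
      exact hη (this.eq ▸ ht))
  let Z : Set Y := ((i ⁻¹ᵁ Proj.basicOpen 𝒜 a : Y.Opens) : Set Y)ᶜ
  have hZη : genericPoint Y ∉ Z := fun h => h haη
  have hZ : Z.Finite := h.finite_of_isClosed (Opens.isOpen _).isClosed_compl hZη
  -- If `a` has no zeros on `Y`, the generic point is used instead, which keeps `U` nonempty. Prime
  -- avoidance needs a set without proper specializations.
  obtain ⟨Z', hZZ', hZ', hne, hanti⟩ : ∃ Z' : Set Y, Z ⊆ Z' ∧ Z'.Finite ∧ Z'.Nonempty ∧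
      ∀ x ∈ Z', ∀ y ∈ Z', x ⤳ y → x = y := by
    rcases Z.eq_empty_or_nonempty with hZe | hZe
    · exact ⟨{genericPoint Y}, hZe ▸ Set.empty_subset _, Set.finite_singleton _,
        Set.singleton_nonempty _, fun x hx y hy _ => hx.trans hy.symm⟩
    · exact ⟨Z, subset_rfl, hZ, hZe, fun x hx y _ => h.eq_of_specializes fun he => hZη (he ▸ hx)⟩
  obtain ⟨e, b, he, hbe, hbZ⟩ := exists_homogeneous_not_mem 𝒜 (j '' Z') (hZ'.image j) (by
    rintro _ ⟨x, hx, rfl⟩ _ ⟨y, hy, rfl⟩ hle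
    exact congrArg j (hanti x hx y hy (hj hle)))
  have ha' : a ^ e ∈ 𝒜 (d * e) := by
    have := SetLike.pow_mem_graded e had
    rwa [smul_eq_mul, mul_comm] at this
  have hb' : b ^ d ∈ 𝒜 (d * e) := SetLike.pow_mem_graded d hbe
  let c := (projTwoChart 𝒜 (Nat.mul_pos hd he) hb' ha').pull i
  have hcU : c.U = i ⁻¹ᵁ Proj.basicOpen 𝒜 b := congrArg (i ⁻¹ᵁ ·) (Proj.basicOpen_pow 𝒜 b d hd)
  have hcV : c.V = i ⁻¹ᵁ Proj.basicOpen 𝒜 a := congrArg (i ⁻¹ᵁ ·) (Proj.basicOpen_pow 𝒜 a e he)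
  have hZU (z : Y) (hz : z ∈ Z') : z ∈ c.U := hcU ▸ hbZ _ ⟨z, hz, rfl⟩
  refine ⟨c, ?_, ⟨?_, hcV ▸ haη⟩, fun t ht => ?_⟩
  · rw [eq_top_iff]
    rintro x -
    by_cases hx : x ∈ c.V
    · exact Or.inr hx
    · exact Or.inl (hZU x (hZZ' fun hxa => hx (hcV ▸ hxa)))
  · obtain ⟨z, hz⟩ := hne
    exact genericPoint_mem_of_mem (hZU z hz)
  · have htV : t ∉ c.V := fun hV => by
      rw [hcV] at hV
      exact hV (haT _ ⟨t, ht, rfl⟩)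
    exact ⟨hZU t (hZZ' fun hxa => htV (hcV ▸ hxa)), htV⟩

end Curve

end CurvesOverFiniteFields

end

/-! ### The normalization is an isomorphism over a dense open set. -/

noncomputable section

namespace CurvesOverFiniteFields

open Opposite

section Normalization

/-- Over an affine open set the sections of the relative normalization are an integral closure
inside the sections of `X`. -/
theorem toNormalization_app_injective {X Y : Scheme.{u}} (f : X ⟶ Y) [QuasiCompact f]
    [QuasiSeparated f] {U : Y.Opens} (hU : IsAffineOpen U) :
    Function.Injective (f.toNormalization.app (f.fromNormalization ⁻¹ᵁ U)).hom := by
  let := (f.app U).hom.toAlgebra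
  rw [f.toNormalization_app_preimage ⟨U, hU⟩]
  have h1 : Function.Injective (f.normalizationObjIso hU).hom.hom :=
    (f.normalizationObjIso hU).commRingCatIsoToRingEquiv.injective
  have h2 : Function.Injective (integralClosure Γ(Y, U) Γ(X, f ⁻¹ᵁ U)).val.toRingHom :=
    Subtype.val_injective
  have h3 {V W : X.Opens} (h : V = W) :
      Function.Injective (X.presheaf.map (eqToHom h).op).hom := by
    subst h
    exact (X.presheaf.mapIso (eqToIso rfl).op).commRingCatIsoToRingEquiv.injective
  exact (h3 _).comp (h2.comp h1)

variable {C Y : Scheme.{u}} [IsIntegral Y] [QuasiSeparatedSpace Y] {v : C ⟶ Y}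

theorem IsNormalizationMap.isIntegralHom (h : IsNormalizationMap v) : IsIntegralHom v := by
  obtain ⟨e, rfl⟩ := h
  infer_instance

/-- The canonical map to the normalization lifts the generic point of `Y` to `C`. Evaluation at this
lift embeds the functions on `C` over an affine open set in the function field of `Y`. -/
theorem IsNormalizationMap.exists_point (h : IsNormalizationMap v) :
    ∃ P : Spec (Y.presheaf.stalk (genericPoint Y)) ⟶ C, P ≫ v = Y.fromSpecStalk (genericPoint Y) ∧
      ∀ (U : Y.Opens) (Z : C.Opens), IsAffineOpen U → Z = v ⁻¹ᵁ U →
        Function.Injective (P.app Z).hom := by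
  obtain ⟨e, rfl⟩ := h
  refine ⟨(Y.fromSpecStalk (genericPoint Y)).toNormalization ≫ e.inv, by simp, ?_⟩
  rintro U Z hU rfl
  have h0 : e.inv ⁻¹ᵁ (e.hom ≫ (Y.fromSpecStalk (genericPoint Y)).fromNormalization) ⁻¹ᵁ U =
      (Y.fromSpecStalk (genericPoint Y)).fromNormalization ⁻¹ᵁ U := by
    rw [← Scheme.Hom.comp_preimage, Iso.inv_hom_id_assoc]
  have h1 (Z) (hZ : Z = (Y.fromSpecStalk (genericPoint Y)).fromNormalization ⁻¹ᵁ U) :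
      Function.Injective ((Y.fromSpecStalk (genericPoint Y)).toNormalization.app Z).hom := by
    subst hZ
    exact toNormalization_app_injective _ hU
  rw [Scheme.Hom.comp_app]
  refine (h1 _ h0).comp ?_
  exact (asIso (e.inv.app _)).commRingCatIsoToRingEquiv.injective

theorem IsNormalizationMap.injective_evalAt (h : IsNormalizationMap v) :
    ∃ P : Spec (CommRingCat.of Y.functionField) ⟶ C,
      P ≫ v = Y.fromSpecStalk (genericPoint Y) ∧
      ∀ (U : Y.Opens) (hP : ⊤ ≤ P ⁻¹ᵁ v ⁻¹ᵁ U), IsAffineOpen U →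
        Function.Injective (evalAt P (v ⁻¹ᵁ U) hP) := by
  obtain ⟨P, hP, hinj⟩ := h.exists_point
  refine ⟨P, hP, fun U hPU hU => ?_⟩
  have h3 {V W : (Spec (CommRingCat.of Y.functionField)).Opens} (h : V ≤ W) (h' : W ≤ V) :
      Function.Injective ((Spec (CommRingCat.of Y.functionField)).presheaf.map (homOfLE h).op).hom := by
    obtain rfl := le_antisymm h h'
    exact ((Spec (CommRingCat.of Y.functionField)).presheaf.mapIso
      (eqToIso rfl).op).commRingCatIsoToRingEquiv.injective
  exact (Scheme.ΓSpecIso (CommRingCat.of Y.functionField)).commRingCatIsoToRingEquiv.injective.comp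
    ((h3 _ le_top).comp (hinj U _ hU rfl))

theorem IsNormalizationMap.map_genericPoint [IsIntegral C] (h : IsNormalizationMap v) :
    v (genericPoint C) = genericPoint Y := by
  obtain ⟨P, hP, -⟩ := h.exists_point
  have h1 : v (P (IsLocalRing.closedPoint (Y.presheaf.stalk (genericPoint Y)))) = genericPoint Y := by
    refine (Scheme.Hom.comp_apply P v _).symm.trans ?_
    rw [hP]
    exact Scheme.fromSpecStalk_closedPoint
  have h2 := (genericPoint_specializes (P (IsLocalRing.closedPoint
    (Y.presheaf.stalk (genericPoint Y))))).map v.continuous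
  rw [h1] at h2
  exact (h2.antisymm (genericPoint_specializes _)).eq

theorem IsNormalizationMap.app_injective (h : IsNormalizationMap v) (U : Y.Opens)
    (hη : genericPoint Y ∈ U) : Function.Injective (v.app U).hom := by
  obtain ⟨P, hP, -⟩ := h.injective_evalAt
  have hle : ⊤ ≤ (P ≫ v) ⁻¹ᵁ U := hP ▸ le_preimage_fromSpecStalk hη
  have h1 (x : Γ(Y, U)) : evalAt P (v ⁻¹ᵁ U) hle ((v.app U).hom x) = toFunctionField U hη x := by
    rw [← evalAt_comp P v U hle hle x]
    simp only [hP]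
    exact evalAt_fromSpecStalk _ hη _ x
  intro x y hxy
  apply toFunctionField_injective U hη
  rw [← h1, ← h1, hxy]

theorem IsNormalizationMap.exists_mul_eq (h : IsNormalizationMap v) {U : Y.Opens}
    (hU : IsAffineOpen U) (hη : genericPoint Y ∈ U) (b : Γ(C, v ⁻¹ᵁ U)) :
    ∃ a a' : Γ(Y, U), a ≠ 0 ∧ (v.app U).hom a * b = (v.app U).hom a' := by
  obtain ⟨P, hP, hinj⟩ := h.injective_evalAt
  have hle : ⊤ ≤ (P ≫ v) ⁻¹ᵁ U := hP ▸ le_preimage_fromSpecStalk hη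
  have h1 (x : Γ(Y, U)) : evalAt P (v ⁻¹ᵁ U) hle ((v.app U).hom x) = toFunctionField U hη x := by
    rw [← evalAt_comp P v U hle hle x]
    simp only [hP]
    exact evalAt_fromSpecStalk _ hη _ x
  have : Nonempty U := ⟨⟨_, hη⟩⟩
  have hfrac := functionField_isFractionRing_of_isAffineOpen Y U hU
  obtain ⟨x, y, hy, hxy⟩ := IsFractionRing.div_surjective (A := Γ(Y, U)) (evalAt P (v ⁻¹ᵁ U) hle b)
  have hy0 : y ≠ 0 := nonZeroDivisors.ne_zero hy
  refine ⟨y, x, hy0, hinj U hle hU ?_⟩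
  have hy1 : toFunctionField U hη y ≠ 0 := (map_ne_zero_iff _ (toFunctionField_injective U hη)).mpr hy0
  rw [map_mul, h1, h1, ← hxy]
  exact mul_div_cancel₀ _ hy1

/-- A product of denominators of finitely many module generators is a common denominator. -/
theorem IsNormalizationMap.exists_conductor [IsFinite v] (h : IsNormalizationMap v) {U : Y.Opens}
    (hU : IsAffineOpen U) (hη : genericPoint Y ∈ U) :
    ∃ a : Γ(Y, U), a ≠ 0 ∧ ∀ b : Γ(C, v ⁻¹ᵁ U), ∃ a', (v.app U).hom a * b = (v.app U).hom a' := by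
  let _ : Algebra Γ(Y, U) Γ(C, v ⁻¹ᵁ U) := (v.app U).hom.toAlgebra
  have hfin : Module.Finite Γ(Y, U) Γ(C, v ⁻¹ᵁ U) := IsFinite.finite_app (f := v) U hU
  obtain ⟨S, hS⟩ := hfin.fg_top
  have : Nonempty U := ⟨⟨_, hη⟩⟩
  choose a a' ha haa' using fun b => h.exists_mul_eq hU hη b
  refine ⟨∏ b ∈ S, a b, Finset.prod_ne_zero_iff.mpr fun b _ => ha b, fun b => ?_⟩
  have hb : b ∈ Submodule.span Γ(Y, U) (S : Set Γ(C, v ⁻¹ᵁ U)) := hS ▸ trivial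
  induction hb using Submodule.span_induction with
  | mem x hx =>
    classical
    refine ⟨(∏ b ∈ S.erase x, a b) * a' x, ?_⟩
    rw [← Finset.prod_erase_mul S a hx, map_mul, map_mul, mul_assoc, haa']
  | zero => exact ⟨0, by rw [mul_zero, map_zero]⟩
  | add x y _ _ hx hy =>
    obtain ⟨x', hx'⟩ := hx
    obtain ⟨y', hy'⟩ := hy
    exact ⟨x' + y', by rw [mul_add, hx', hy', map_add]⟩
  | smul r x _ hx =>
    obtain ⟨x', hx'⟩ := hx
    refine ⟨r * x', ?_⟩
    rw [Algebra.smul_def, mul_left_comm, hx', map_mul]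
    rfl

omit [IsIntegral Y] [QuasiSeparatedSpace Y] in
theorem app_bijective_of_isIso_restrict {W : Y.Opens} (hW : IsIso (v ∣_ W)) (W' : Y.Opens)
    (h : W' ≤ W) : Function.Bijective (v.app W').hom := by
  have e : W.ι ''ᵁ (W.ι ⁻¹ᵁ W') = W' := by
    rw [Scheme.Hom.image_preimage_eq_opensRange_inf, Scheme.Opens.opensRange_ι]
    exact inf_eq_right.mpr h
  have h1 : IsIso (v.app (W.ι ''ᵁ (W.ι ⁻¹ᵁ W'))) := by
    have h2 : IsIso ((v ∣_ W).app (W.ι ⁻¹ᵁ W')) := inferInstance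
    rw [morphismRestrict_app] at h2
    have h3 : IsIso (C.presheaf.map
        (eqToHom (image_morphismRestrict_preimage v W (W.ι ⁻¹ᵁ W'))).op) :=
      (C.presheaf.mapIso (eqToIso (image_morphismRestrict_preimage v W _)).op).isIso_hom
    exact @IsIso.of_isIso_comp_right _ _ _ _ _ _ _ h3 h2
  rw [e] at h1
  exact (asIso (v.app W')).commRingCatIsoToRingEquiv.bijective

theorem IsNormalizationMap.exists_open [IsFinite v] [IsIntegral C] (h : IsNormalizationMap v) :
    ∃ W : Y.Opens, genericPoint Y ∈ W ∧ ∀ W' ≤ W, Function.Bijective (v.app W').hom := by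
  obtain ⟨_, ⟨U : Y.Opens, hU, rfl⟩, hη, -⟩ := Y.isBasis_affineOpens.exists_subset_of_mem_open
    (Set.mem_univ (genericPoint Y)) isOpen_univ
  change genericPoint Y ∈ U at hη
  obtain ⟨a, ha, hcond⟩ := h.exists_conductor hU hη
  have hηa : genericPoint Y ∈ Y.basicOpen a := by
    rw [Scheme.mem_basicOpen Y a (genericPoint Y) hη, isUnit_iff_ne_zero]
    exact (map_ne_zero_iff _ (toFunctionField_injective U hη)).mpr ha
  have hηC : genericPoint C ∈ v ⁻¹ᵁ Y.basicOpen a := by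
    change v (genericPoint C) ∈ Y.basicOpen a
    rwa [h.map_genericPoint]
  refine ⟨Y.basicOpen a, hηa, app_bijective_of_isIso_restrict ?_⟩
  rw [isIso_morphismRestrict_iff_isIso_app _ (hU.basicOpen a)]
  have hsurj : Function.Surjective (v.app (Y.basicOpen a)).hom := by
    intro z
    obtain ⟨n, b, hb⟩ := exists_mul_pow_eq_map (hU.preimage v) (v.preimage_mono (Y.basicOpen_le a))
      ((v.app U).hom a) (Scheme.preimage_basicOpen v a).symm hηC z
    obtain ⟨x, hx⟩ := hcond b
    let r : Γ(Y, U) →+* Γ(Y, Y.basicOpen a) := (Y.presheaf.map (homOfLE (Y.basicOpen_le a)).op).hom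
    obtain ⟨i, hi⟩ : IsUnit (r a) := RingedSpace.isUnit_res_basicOpen _ a
    have hnat (x : Γ(Y, U)) : (v.app (Y.basicOpen a)).hom (r x) =
        (C.presheaf.map (homOfLE (v.preimage_mono (Y.basicOpen_le a))).op).hom ((v.app U).hom x) :=
      congr($(v.naturality (homOfLE (Y.basicOpen_le a)).op) x)
    -- With `z = b / a ^ n`, the numerator `b` need not come from `Y`, but `a * b` does; this costs
    -- one more power of `a`.
    refine ⟨r x * (↑(i ^ (n + 1))⁻¹ : Γ(Y, Y.basicOpen a)), ?_⟩
    have hui : IsUnit ((v.app (Y.basicOpen a)).hom (↑(i ^ (n + 1)) : Γ(Y, Y.basicOpen a))) :=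
      (Units.isUnit _).map _
    apply hui.mul_left_injective
    change _ * _ = _ * _
    rw [← map_mul, mul_assoc, Units.inv_mul, mul_one, Units.val_pow_eq_pow_val, hi, map_pow, hnat,
      hnat, ← hx, map_mul, ← hb]
    ring
  have := h.app_injective _ hηa
  exact (RingEquiv.ofBijective _ ⟨this, hsurj⟩).toCommRingCatIso.isIso_hom

end Normalization

end CurvesOverFiniteFields

end

/-! ### Sections of colimits of presheafed spaces. -/

noncomputable section

namespace CurvesOverFiniteFields

open Opposite

section Colimits

universe w w'

variable {J : Type w} [Category.{w'} J] [HasLimitsOfShape Jᵒᵖ CommRingCat.{u}]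
  [HasColimitsOfShape J TopCat.{u}] [PreservesLimitsOfShape Jᵒᵖ (forget CommRingCat.{u})]

theorem presheafedSpace_colimit_ext (F : J ⥤ PresheafedSpace.{_, _, u} CommRingCat.{u})
    (U : Opens (colimit F).carrier) (s t : (colimit F).presheaf.obj (op U))
    (h : ∀ j, ((colimit.ι F j).c.app (op U)).hom s = ((colimit.ι F j).c.app (op U)).hom t) :
    s = t := by
  apply (PresheafedSpace.colimitPresheafObjIsoComponentwiseLimit F U).commRingCatIsoToRingEquiv.injective
  refine Concrete.limit_ext _ _ _ fun j => ?_
  have := PresheafedSpace.colimitPresheafObjIsoComponentwiseLimit_hom_π F U j.unop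
  refine (congr($this s)).trans ((h j.unop).trans (congr($this t)).symm)

theorem presheafedSpace_colimit_exists (F : J ⥤ PresheafedSpace.{_, _, u} CommRingCat.{u})
    (U : Opens (colimit F).carrier)
    (x : ∀ j, (F.obj j).presheaf.obj (op ((Opens.map (colimit.ι F j).base).obj U)))
    (hx : ∀ (i j) (φ : i ⟶ j) (r : op ((Opens.map (F.map φ).base).obj
      ((Opens.map (colimit.ι F j).base).obj U)) ⟶ op ((Opens.map (colimit.ι F i).base).obj U)),
        ((F.obj i).presheaf.map r).hom (((F.map φ).c.app _).hom (x j)) = x i) :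
    ∃ s : (colimit F).presheaf.obj (op U), ∀ j, ((colimit.ι F j).c.app (op U)).hom s = x j := by
  let D := PresheafedSpace.componentwiseDiagram F U
  let hD := isLimitOfPreserves (forget CommRingCat) (limit.isLimit D)
  let y : ↥(limit (C := CommRingCat) D) :=
    (Types.isLimitEquivSections hD).symm ⟨fun j => x j.unop, fun {i j} φ => hx _ _ φ.unop _⟩
  have hy (j) : (limit.π (C := CommRingCat) D j).hom y = x j.unop :=
    Types.isLimitEquivSections_symm_apply hD ⟨fun j => x j.unop, fun {i j} φ => hx _ _ φ.unop _⟩ j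
  refine ⟨(PresheafedSpace.colimitPresheafObjIsoComponentwiseLimit F U).inv.hom y, fun j => ?_⟩
  have := PresheafedSpace.colimitPresheafObjIsoComponentwiseLimit_inv_ι_app F U j
  exact (congr($this y)).trans (hy (op j))

variable {F : J ⥤ PresheafedSpace.{_, _, u} CommRingCat.{u}} {c : Cocone F} (hc : IsColimit c)
include hc

/-- Stated for an arbitrary colimit cocone, since it is applied to images under forgetful functors
of colimits of locally ringed spaces. -/
theorem presheafedSpace_isColimit_ext (U : Opens c.pt.carrier) (s t : c.pt.presheaf.obj (op U))
    (h : ∀ j, ((c.ι.app j).c.app (op U)).hom s = ((c.ι.app j).c.app (op U)).hom t) : s = t := by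
  obtain ⟨c, ι⟩ := c
  obtain ⟨e, rfl⟩ : ∃ e : colimit F ≅ c,
      ι = (colimit.cocone F).ι ≫ (Functor.const J).map e.hom := by
    refine ⟨(colimit.isColimit F).coconePointUniqueUpToIso hc, ?_⟩
    ext1
    funext j
    exact ((colimit.isColimit F).comp_coconePointUniqueUpToIso_hom hc j).symm
  have he' : IsIso e.hom.c := PresheafedSpace.c_isIso_of_iso e.hom
  have he : IsIso (e.hom.c.app (op U)) := NatIso.isIso_app_of_isIso e.hom.c (op U)
  apply (asIso (e.hom.c.app (op U))).commRingCatIsoToRingEquiv.injective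
  exact presheafedSpace_colimit_ext F _ _ _ h

theorem presheafedSpace_isColimit_exists (U : Opens c.pt.carrier)
    (x : ∀ j, (F.obj j).presheaf.obj (op ((Opens.map (c.ι.app j).base).obj U)))
    (hx : ∀ (i j) (φ : i ⟶ j) (r : op ((Opens.map (F.map φ).base).obj
      ((Opens.map (c.ι.app j).base).obj U)) ⟶ op ((Opens.map (c.ι.app i).base).obj U)),
        ((F.obj i).presheaf.map r).hom (((F.map φ).c.app _).hom (x j)) = x i) :
    ∃ s : c.pt.presheaf.obj (op U), ∀ j, ((c.ι.app j).c.app (op U)).hom s = x j := by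
  obtain ⟨c, ι⟩ := c
  obtain ⟨e, rfl⟩ : ∃ e : colimit F ≅ c,
      ι = (colimit.cocone F).ι ≫ (Functor.const J).map e.hom := by
    refine ⟨(colimit.isColimit F).coconePointUniqueUpToIso hc, ?_⟩
    ext1
    funext j
    exact ((colimit.isColimit F).comp_coconePointUniqueUpToIso_hom hc j).symm
  have he' : IsIso e.hom.c := PresheafedSpace.c_isIso_of_iso e.hom
  have he : IsIso (e.hom.c.app (op U)) := NatIso.isIso_app_of_isIso e.hom.c (op U)
  obtain ⟨s, hs⟩ := presheafedSpace_colimit_exists F ((Opens.map e.hom.base).obj U) x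
    (fun i j φ r => by
      have h1 := hx i j φ r
      exact h1)
  obtain ⟨t, rfl⟩ := (asIso (e.hom.c.app (op U))).commRingCatIsoToRingEquiv.surjective s
  exact ⟨t, hs⟩

end Colimits

end CurvesOverFiniteFields

end

/-! ### Points and functions of the glued curve. -/

noncomputable section

namespace CurvesOverFiniteFields

open Opposite

section AppLE

/-- The map on sections induced by a morphism of locally ringed spaces. -/
def lrsAppLE {X Z : LocallyRingedSpace.{u}} (m : X ⟶ Z) (V : Opens Z) (W : Opens X)
    (h : W ≤ (Opens.map m.base).obj V) : Z.presheaf.obj (op V) ⟶ X.presheaf.obj (op W) :=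
  m.c.app (op V) ≫ X.presheaf.map (homOfLE h).op

theorem lrsAppLE_congr {X Z : LocallyRingedSpace.{u}} {m m' : X ⟶ Z} (e : m = m') (V : Opens Z)
    (W : Opens X) (h : W ≤ (Opens.map m.base).obj V) :
    lrsAppLE m V W h = lrsAppLE m' V W (e ▸ h) := by
  subst e
  rfl

theorem lrsAppLE_self {X Z : LocallyRingedSpace.{u}} (m : X ⟶ Z) (V : Opens Z) :
    lrsAppLE m V ((Opens.map m.base).obj V) le_rfl = m.c.app (op V) := by
  have : X.presheaf.map (homOfLE (le_refl ((Opens.map m.base).obj V))).op = 𝟙 _ :=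
    X.presheaf.map_id _
  exact (congrArg (m.c.app (op V) ≫ ·) this).trans (Category.comp_id _)

theorem lrsAppLE_comp {X Z T : LocallyRingedSpace.{u}} (m : X ⟶ Z) (n : Z ⟶ T) (V : Opens T)
    (V' : Opens Z) (W : Opens X) (h : V' ≤ (Opens.map n.base).obj V)
    (h' : W ≤ (Opens.map m.base).obj V') (h'' : W ≤ (Opens.map (m ≫ n).base).obj V) :
    lrsAppLE (m ≫ n) V W h'' = lrsAppLE n V V' h ≫ lrsAppLE m V' W h' := by
  simp only [lrsAppLE, Category.assoc]
  rw [m.c.naturality_assoc]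
  have e : X.presheaf.map (homOfLE h'').op =
      X.presheaf.map ((Opens.map m.base).map (homOfLE h)).op ≫ X.presheaf.map (homOfLE h').op :=
    X.presheaf.map_comp ((Opens.map m.base).map (homOfLE h)).op (homOfLE h').op
  exact (Category.assoc (n.c.app (op V)) (m.c.app _) (X.presheaf.map (homOfLE h'').op)).trans
    (congrArg (fun t => n.c.app (op V) ≫ m.c.app _ ≫ t) e)

end AppLE

variable {k : Type u} [Field k] [Fintype k] {C : Scheme.{u}} (s : C ⟶ Spec (CommRingCat.of k))
  (K : Type u) [Field K] [Algebra k K]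

/-- The quotient map onto the glued curve. -/
def gluedProj : C.toLocallyRingedSpace ⟶ gluedCurve s K := coequalizer.π _ _

theorem comp_gluedProj (P : RationalPoint s K) :
    P.1.toLRSHom ≫ gluedProj s K = (frobenius s K P).1.toLRSHom ≫ gluedProj s K := by
  have h := coequalizer.condition (pointsMap s K) (frobeniusPointsMap s K)
  have h' := congrArg (Sigma.ι (fun _ : RationalPoint s K =>
    (Spec (CommRingCat.of K)).toLocallyRingedSpace) P ≫ ·) h
  have h1 : Sigma.ι (fun _ : RationalPoint s K => (Spec (CommRingCat.of K)).toLocallyRingedSpace) P ≫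
      pointsMap s K = P.1.toLRSHom := by simp [pointsMap]
  have h2 : Sigma.ι (fun _ : RationalPoint s K => (Spec (CommRingCat.of K)).toLocallyRingedSpace) P ≫
      frobeniusPointsMap s K = (frobenius s K P).1.toLRSHom := by simp [frobeniusPointsMap]
  have h3 := Category.assoc (Sigma.ι (fun _ : RationalPoint s K =>
    (Spec (CommRingCat.of K)).toLocallyRingedSpace) P) (pointsMap s K) (gluedProj s K)
  have h4 := Category.assoc (Sigma.ι (fun _ : RationalPoint s K =>
    (Spec (CommRingCat.of K)).toLocallyRingedSpace) P) (frobeniusPointsMap s K) (gluedProj s K)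
  rw [h1] at h3
  rw [h2] at h4
  exact h3.trans (Eq.trans h' h4.symm)

/-- Frobenius acts trivially on the one-point space `Spec K`, so conjugate points have the same
image. -/
theorem pointsMap_base : (pointsMap s K).base = (frobeniusPointsMap s K).base := by
  ext y
  let F := Discrete.functor (fun _ : RationalPoint s K =>
    (Spec (CommRingCat.of K)).toLocallyRingedSpace)
  obtain ⟨⟨P⟩, z, hz⟩ := SheafedSpace.isColimit_exists_rep _
    (isColimitOfPreserves LocallyRingedSpace.forgetToSheafedSpace (colimit.isColimit F)) y
  let ι := Sigma.ι (fun _ : RationalPoint s K =>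
    (Spec (CommRingCat.of K)).toLocallyRingedSpace) P
  have hz : ι.base z = y := hz
  have h1 : ι ≫ pointsMap s K = P.1.toLRSHom := by simp [ι, pointsMap]
  have h2 : ι ≫ frobeniusPointsMap s K = (frobenius s K P).1.toLRSHom := by
    simp [ι, frobeniusPointsMap]
  rw [← hz]
  change (ι ≫ pointsMap s K).base z = (ι ≫ frobeniusPointsMap s K).base z
  rw [h1, h2]
  change P.1 z = P.1 _
  congr 1
  have : Subsingleton (Spec (CommRingCat.of K)) :=
    inferInstanceAs (Subsingleton (PrimeSpectrum K))
  exact Subsingleton.elim _ _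

/-- The underlying space is the coequalizer of two equal maps, so the gluing affects only the
structure sheaf. -/
theorem isIso_gluedProj_base : IsIso (gluedProj s K).base := by
  have h := isColimitCoforkMapOfIsColimit
    (LocallyRingedSpace.forgetToSheafedSpace.{u} ⋙ SheafedSpace.forget _)
    (coequalizer.condition (pointsMap s K) (frobeniusPointsMap s K))
    (coequalizerIsCoequalizer (pointsMap s K) (frobeniusPointsMap s K))
  exact isIso_colimit_cocone_parallelPair_of_eq (pointsMap_base s K) h

theorem gluedProj_app_injective (U : Opens (gluedCurve s K)) :
    Function.Injective ((gluedProj s K).c.app (op U)).hom := by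
  have h := isColimitCoforkMapOfIsColimit
    (LocallyRingedSpace.forgetToSheafedSpace.{u} ⋙ SheafedSpace.forgetToPresheafedSpace)
    (coequalizer.condition (pointsMap s K) (frobeniusPointsMap s K))
    (coequalizerIsCoequalizer (pointsMap s K) (frobeniusPointsMap s K))
  intro a b hab
  refine presheafedSpace_isColimit_ext h U a b fun j => ?_
  rcases j with _ | _
  · exact congrArg ((pointsMap s K).c.app _).hom hab
  · exact hab

omit [Fintype k] in
theorem pointsSpace_ext (U : Opens (pointsSpace s K)) (a b : (pointsSpace s K).presheaf.obj (op U))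
    (h : ∀ P, ((Sigma.ι (fun _ : RationalPoint s K =>
      (Spec (CommRingCat.of K)).toLocallyRingedSpace) P).c.app (op U)).hom a =
        ((Sigma.ι (fun _ : RationalPoint s K =>
          (Spec (CommRingCat.of K)).toLocallyRingedSpace) P).c.app (op U)).hom b) : a = b := by
  let F := Discrete.functor (fun _ : RationalPoint s K =>
    (Spec (CommRingCat.of K)).toLocallyRingedSpace)
  exact presheafedSpace_isColimit_ext (isColimitOfPreserves
    (LocallyRingedSpace.forgetToSheafedSpace.{u} ⋙ SheafedSpace.forgetToPresheafedSpace)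
    (colimit.isColimit F)) U a b fun ⟨P⟩ => h P

theorem evalAt_eq_iff_appLE_eq {R : Type u} [CommRing R] {X : Scheme.{u}} (P Q : Spec (CommRingCat.of R) ⟶ X)
    (V : X.Opens) (h : ⊤ ≤ P ⁻¹ᵁ V) (h' : ⊤ ≤ Q ⁻¹ᵁ V) (x : Γ(X, V)) :
    evalAt P V h x = evalAt Q V h' x ↔
      (lrsAppLE P.toLRSHom V ⊤ h).hom x = (lrsAppLE Q.toLRSHom V ⊤ h').hom x :=
  (Scheme.ΓSpecIso (CommRingCat.of R)).commRingCatIsoToRingEquiv.injective.eq_iff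

theorem lrsAppLE_eq_of_evalAt_eq {F : Type u} [Field F] {X : Scheme.{u}}
    (P Q : Spec (CommRingCat.of F) ⟶ X) (V : X.Opens) (x : Γ(X, V))
    (W : (Spec (CommRingCat.of F)).Opens) (h : W ≤ P ⁻¹ᵁ V) (h' : W ≤ Q ⁻¹ᵁ V)
    (hx : ∀ (h : ⊤ ≤ P ⁻¹ᵁ V) (h' : ⊤ ≤ Q ⁻¹ᵁ V), evalAt P V h x = evalAt Q V h' x) :
    (lrsAppLE P.toLRSHom V W h).hom x = (lrsAppLE Q.toLRSHom V W h').hom x := by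
  have hs : Subsingleton (Spec (CommRingCat.of F)) :=
    inferInstanceAs (Subsingleton (PrimeSpectrum F))
  by_cases hW : ∃ z, z ∈ W
  · obtain ⟨z, hz⟩ := hW
    obtain rfl : W = ⊤ := top_le_iff.mp fun y _ => Subsingleton.elim z y ▸ hz
    exact (evalAt_eq_iff_appLE_eq P Q V h h' x).mp (hx h h')
  · obtain rfl : W = ⊥ := le_bot_iff.mp fun y hy => hW ⟨y, hy⟩
    have : Subsingleton Γ(Spec (CommRingCat.of F), ⊥) :=
      CommRingCat.subsingleton_of_isTerminal (Spec (CommRingCat.of F)).sheaf.isTerminalOfEmpty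
    exact Subsingleton.elim (α := Γ(Spec (CommRingCat.of F), ⊥)) _ _

theorem presheaf_map_self {X : LocallyRingedSpace.{u}} (U : Opens X) (r : op U ⟶ op U)
    (x : X.presheaf.obj (op U)) : (X.presheaf.map r).hom x = x := by
  obtain rfl : r = 𝟙 _ := Subsingleton.elim _ _
  exact congr($(X.presheaf.map_id _).hom x)

theorem pointsMap_compat (V : C.Opens) (x : Γ(C, V))
    (hx : ∀ (P : RationalPoint s K) (h : ⊤ ≤ P.1 ⁻¹ᵁ V) (h' : ⊤ ≤ (frobenius s K P).1 ⁻¹ᵁ V),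
        evalAt P.1 _ h x = evalAt (frobenius s K P).1 _ h' x) (W : Opens (pointsSpace s K))
    (h : W ≤ (Opens.map (pointsMap s K).base).obj V)
    (h' : W ≤ (Opens.map (frobeniusPointsMap s K).base).obj V) :
    (lrsAppLE (pointsMap s K) V W h).hom x = (lrsAppLE (frobeniusPointsMap s K) V W h').hom x := by
  refine pointsSpace_ext s K _ _ _ fun P => ?_
  let ι := Sigma.ι (fun _ : RationalPoint s K =>
    (Spec (CommRingCat.of K)).toLocallyRingedSpace) P
  have h1 : ι ≫ pointsMap s K = P.1.toLRSHom := by simp [ι, pointsMap]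
  have h2 : ι ≫ frobeniusPointsMap s K = (frobenius s K P).1.toLRSHom := by
    simp [ι, frobeniusPointsMap]
  have e1 := lrsAppLE_comp ι (pointsMap s K) V W _ h le_rfl fun y hy => h hy
  have e2 := lrsAppLE_comp ι (frobeniusPointsMap s K) V W _ h' le_rfl fun y hy => h' hy
  rw [lrsAppLE_self] at e1 e2
  have e3 := (lrsAppLE_congr h1 V _ fun y hy => h hy).symm.trans e1
  have e4 := (lrsAppLE_congr h2 V _ fun y hy => h' hy).symm.trans e2
  exact (congr(($e3).hom x)).symm.trans
    ((lrsAppLE_eq_of_evalAt_eq _ _ _ _ _ _ _ (hx P)).trans congr(($e4).hom x))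

/-- Sections of a coequalizer are the sections with equal pullbacks along both maps. The source is a
coproduct of copies of `Spec K`, so equality can be tested at each `K`-point. -/
theorem mem_range_gluedProj_app_iff (U : Opens (gluedCurve s K))
    (x : C.presheaf.obj (op ((Opens.map (gluedProj s K).base).obj U))) :
    x ∈ Set.range ((gluedProj s K).c.app (op U)).hom ↔
      ∀ (P : RationalPoint s K) (h : ⊤ ≤ P.1 ⁻¹ᵁ (Opens.map (gluedProj s K).base).obj U)
        (h' : ⊤ ≤ (frobenius s K P).1 ⁻¹ᵁ (Opens.map (gluedProj s K).base).obj U),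
        evalAt P.1 _ h x = evalAt (frobenius s K P).1 _ h' x := by
  constructor
  · rintro ⟨y, rfl⟩ P h h'
    rw [evalAt_eq_iff_appLE_eq]
    have h1 := lrsAppLE_comp P.1.toLRSHom (gluedProj s K) U _ ⊤ le_rfl h h
    have h2 := lrsAppLE_comp (frobenius s K P).1.toLRSHom (gluedProj s K) U _ ⊤ le_rfl h' h'
    rw [lrsAppLE_self] at h1 h2
    have h3 := lrsAppLE_congr (comp_gluedProj s K P) U ⊤ h
    exact congr(($(h1.symm.trans (h3.trans h2))).hom y)
  · intro hx
    have hc := isColimitCoforkMapOfIsColimit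
      (LocallyRingedSpace.forgetToSheafedSpace.{u} ⋙ SheafedSpace.forgetToPresheafedSpace)
      (coequalizer.condition (pointsMap s K) (frobeniusPointsMap s K))
      (coequalizerIsCoequalizer (pointsMap s K) (frobeniusPointsMap s K))
    obtain ⟨y, hy⟩ := presheafedSpace_isColimit_exists hc U
      (fun j => match j with
        | .zero => ((pointsMap s K).c.app _).hom x
        | .one => x) (by
      rintro _ _ (_ | _ | _) r
      · exact presheaf_map_self _ r _
      · have h1 := pointsMap_compat s K _ x hx _ le_rfl (leOfHom r.unop)
        rw [lrsAppLE_self] at h1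
        exact h1.symm
      · rename_i i
        rcases i with _ | _ <;> exact presheaf_map_self _ r _)
    exact ⟨y, hy .one⟩

end CurvesOverFiniteFields

end

/-! ### Gluing morphisms and the universal property. -/

noncomputable section

namespace CurvesOverFiniteFields

open Opposite

variable {k : Type u} [Field k] [Fintype k] {C Y : Scheme.{u}} {s : C ⟶ Spec (CommRingCat.of k)}
  {K : Type u} [Field K] [Algebra k K]

variable (s K) in
/-- The morphism `w` is a homeomorphism which identifies the functions on `Y` with the functions
on `C` that take equal values at each `K`-rational point and its Frobenius conjugate. -/
structure IsGluing (w : C ⟶ Y) : Prop where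
  isIso_base : IsIso w.base
  injective (U : Y.Opens) : Function.Injective (w.app U).hom
  mem_range_iff (U : Y.Opens) (x : Γ(C, w ⁻¹ᵁ U)) : x ∈ Set.range (w.app U).hom ↔
    ∀ (P : RationalPoint s K) (h : ⊤ ≤ P.1 ⁻¹ᵁ w ⁻¹ᵁ U)
      (h' : ⊤ ≤ (frobenius s K P).1 ⁻¹ᵁ w ⁻¹ᵁ U),
      evalAt P.1 _ h x = evalAt (frobenius s K P).1 _ h' x

theorem isGluing_of_isIso (m : gluedCurve s K ⟶ Y.toLocallyRingedSpace) [IsIso m] :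
    IsGluing s K (⟨gluedProj s K ≫ m⟩ : C ⟶ Y) := by
  have hb : IsIso m.base := inferInstanceAs (IsIso
    ((LocallyRingedSpace.forgetToSheafedSpace ⋙ SheafedSpace.forget _).map m))
  have hi : IsIso ((LocallyRingedSpace.forgetToSheafedSpace ⋙
    SheafedSpace.forgetToPresheafedSpace).map m) := inferInstance
  have hc : IsIso m.c := PresheafedSpace.c_isIso_of_iso ((LocallyRingedSpace.forgetToSheafedSpace ⋙
    SheafedSpace.forgetToPresheafedSpace).map m)
  have hU (U : Y.Opens) : IsIso (m.c.app (op U)) := NatIso.isIso_app_of_isIso m.c (op U)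
  have hbij (U : Y.Opens) : Function.Bijective (m.c.app (op U)).hom :=
    have := hU U
    (asIso (m.c.app (op U))).commRingCatIsoToRingEquiv.bijective
  have := isIso_gluedProj_base s K
  refine ⟨inferInstanceAs (IsIso ((gluedProj s K).base ≫ m.base)), fun U => ?_, fun U x => ?_⟩
  · exact (gluedProj_app_injective s K _).comp (hbij U).1
  · refine Iff.trans ?_ (mem_range_gluedProj_app_iff s K ((Opens.map m.base).obj U) x)
    constructor
    · rintro ⟨y, rfl⟩
      exact ⟨_, rfl⟩
    · rintro ⟨y, rfl⟩
      obtain ⟨z, rfl⟩ := (hbij U).2 y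
      exact ⟨z, rfl⟩

/-- Both structure sheaves are the same subsheaf of the functions on `C`, so `m` is a homeomorphism
that is bijective on sections; the forgetful functors to presheafed spaces reflect isomorphisms. -/
theorem isIso_of_isGluing (m : gluedCurve s K ⟶ Y.toLocallyRingedSpace)
    (h : IsGluing s K (⟨gluedProj s K ≫ m⟩ : C ⟶ Y)) : IsIso m := by
  have := isIso_gluedProj_base s K
  have hb : IsIso m.base :=
    have : IsIso ((gluedProj s K).base ≫ m.base) := h.isIso_base
    IsIso.of_isIso_comp_left (gluedProj s K).base m.base
  have hU (U : Y.Opens) : IsIso (m.c.app (op U)) := by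
    have hbij : Function.Bijective (m.c.app (op U)).hom := by
      constructor
      · exact Function.Injective.of_comp (h.injective U)
      · intro y
        have h1 := (mem_range_gluedProj_app_iff s K ((Opens.map m.base).obj U) _).mp ⟨y, rfl⟩
        obtain ⟨z, hz⟩ := (h.mem_range_iff U _).mpr h1
        exact ⟨z, gluedProj_app_injective s K _ hz⟩
    exact (RingEquiv.ofBijective _ hbij).toCommRingCatIso.isIso_hom
  have hc : IsIso m.c := by
    have (U : (Opens Y)ᵒᵖ) : IsIso (m.c.app U) := hU U.unop
    exact NatIso.isIso_of_isIso_app m.c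
  have hp : IsIso ((LocallyRingedSpace.forgetToSheafedSpace ⋙
      SheafedSpace.forgetToPresheafedSpace).map m) := by
    let m' := (LocallyRingedSpace.forgetToSheafedSpace ⋙
      SheafedSpace.forgetToPresheafedSpace).map m
    have : IsIso m'.base := hb
    have : IsIso m'.c := hc
    exact PresheafedSpace.isIso_of_components m'
  have hp' : IsIso (SheafedSpace.forgetToPresheafedSpace.map
    (LocallyRingedSpace.forgetToSheafedSpace.map m)) := hp
  have hq : IsIso (LocallyRingedSpace.forgetToSheafedSpace.map m) :=
    isIso_of_reflects_iso _ SheafedSpace.forgetToPresheafedSpace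
  exact isIso_of_reflects_iso m LocallyRingedSpace.forgetToSheafedSpace

theorem gluedProj_gluedCurveToSpec : gluedProj s K ≫ gluedCurveToSpec s K = s.toLRSHom :=
  coequalizer.π_desc _ _

theorem IsIsoToGluedCurve.exists_isGluing {sY : Y ⟶ Spec (CommRingCat.of k)}
    (h : IsIsoToGluedCurve sY s K) : ∃ w : C ⟶ Y, w ≫ sY = s ∧ IsGluing s K w := by
  obtain ⟨e, he⟩ := h
  refine ⟨⟨gluedProj s K ≫ e.inv⟩, ?_, isGluing_of_isIso e.inv⟩
  have h1 : (gluedProj s K ≫ e.inv) ≫ sY.toLRSHom = s.toLRSHom := by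
    rw [← he, Category.assoc, e.inv_hom_id_assoc, gluedProj_gluedCurveToSpec]
  exact Scheme.Hom.ext' h1

theorem eq_of_evalAt_eq_of_subsingleton {F : Type u} [Field F] (P Q : Spec (CommRingCat.of F) ⟶ Y)
    (z : Spec (CommRingCat.of F)) (hz : P z = Q z)
    (h : ∀ (U : Y.Opens) (h : ⊤ ≤ P ⁻¹ᵁ U) (h' : ⊤ ≤ Q ⁻¹ᵁ U) (x : Γ(Y, U)),
      evalAt P U h x = evalAt Q U h' x) : P = Q := by
  have hs : Subsingleton (Spec (CommRingCat.of F)) :=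
    inferInstanceAs (Subsingleton (PrimeSpectrum F))
  obtain ⟨_, ⟨U, hU, rfl⟩, hzU, -⟩ :=
    Y.isBasis_affineOpens.exists_subset_of_mem_open (Set.mem_univ (P z)) isOpen_univ
  have hP : ⊤ ≤ P ⁻¹ᵁ U := fun y _ => by
    rw [Subsingleton.elim y z]
    exact hzU
  have hQ : ⊤ ≤ Q ⁻¹ᵁ U := fun y _ => by
    rw [Subsingleton.elim y z]
    change Q z ∈ U
    rw [← hz]
    exact hzU
  exact evalAt_ext hU hP hQ (h U hP hQ)

theorem frobenius_apply (P : RationalPoint s K) (z : Spec (CommRingCat.of K)) :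
    (frobenius s K P).1 z = P.1 z := by
  have hs : Subsingleton (Spec (CommRingCat.of K)) :=
    inferInstanceAs (Subsingleton (PrimeSpectrum K))
  change P.1 _ = P.1 z
  congr 1
  exact Subsingleton.elim _ _

theorem IsGluing.comp_eq {w : C ⟶ Y} (h : IsGluing s K w) (P : RationalPoint s K) :
    P.1 ≫ w = (frobenius s K P).1 ≫ w := by
  let z : Spec (CommRingCat.of K) := (⊥ : PrimeSpectrum K)
  refine eq_of_evalAt_eq_of_subsingleton _ _ z ?_ fun U h1 h2 x => ?_
  · exact congrArg w (frobenius_apply P z).symm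
  · have h3 := (h.mem_range_iff U _).mp ⟨x, rfl⟩ P h1 h2
    rw [evalAt_comp P.1 w U h1 h1, evalAt_comp _ w U h2 h2]
    exact h3

/-- Since `w` takes equal values on conjugate `K`-points, it factors through the coequalizer, and
the factor is an isomorphism. -/
theorem IsGluing.isIsoToGluedCurve {sY : Y ⟶ Spec (CommRingCat.of k)} {w : C ⟶ Y}
    (hw : w ≫ sY = s) (h : IsGluing s K w) : IsIsoToGluedCurve sY s K := by
  have hcond : pointsMap s K ≫ w.toLRSHom = frobeniusPointsMap s K ≫ w.toLRSHom := by
    apply Sigma.hom_ext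
    intro P
    simp only [pointsMap, frobeniusPointsMap, colimit.ι_desc_assoc, Cofan.mk_ι_app]
    exact congrArg Scheme.Hom.toLRSHom (h.comp_eq P)
  obtain ⟨m, hm⟩ : ∃ m : gluedCurve s K ⟶ Y.toLocallyRingedSpace,
      gluedProj s K ≫ m = w.toLRSHom :=
    ⟨coequalizer.desc _ hcond, coequalizer.π_desc _ _⟩
  obtain rfl : w = ⟨gluedProj s K ≫ m⟩ := Scheme.Hom.ext' hm.symm
  have := isIso_of_isGluing m h
  refine ⟨(asIso m).symm, ?_⟩
  change inv m ≫ _ = _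
  rw [IsIso.inv_comp_eq]
  refine coequalizer.hom_ext ?_
  refine (gluedProj_gluedCurveToSpec (s := s) (K := K)).trans ?_
  have h1 : (gluedProj s K ≫ m) ≫ sY.toLRSHom = s.toLRSHom := congrArg Scheme.Hom.toLRSHom hw
  exact h1.symm.trans (Category.assoc (gluedProj s K) m sY.toLRSHom)

end CurvesOverFiniteFields

end

/-! ### Quadratic extensions of finite fields. -/

noncomputable section

namespace CurvesOverFiniteFields

open Opposite

section Algebra

variable {k K : Type*} [Field k] [Fintype k] [Field K] [Finite K] [Algebra k K]

theorem mem_range_algebraMap_iff_frobenius_eq (x : K) :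
    x ∈ Set.range (algebraMap k K) ↔ FiniteField.frobeniusAlgHom k K x = x := by
  constructor
  · rintro ⟨c, rfl⟩
    exact AlgHom.commutes _ _
  · intro h
    refine (IsGalois.mem_range_algebraMap_iff_fixed (F := k) (E := K) x).mpr fun σ => ?_
    obtain ⟨n, rfl⟩ := (FiniteField.bijective_frobeniusAlgEquivOfAlgebraic_pow k K).2 σ
    have h1 (n : ℕ) : (FiniteField.frobeniusAlgEquivOfAlgebraic k K ^ n) x = x := by
      induction n with
      | zero => rfl
      | succ n ih =>
        rw [pow_succ]
        exact (congrArg _ h).trans ih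
    exact h1 _

theorem frobenius_frobenius_apply (hK : Module.finrank k K = 2) (x : K) :
    FiniteField.frobeniusAlgHom k K (FiniteField.frobeniusAlgHom k K x) = x := by
  have h := pow_orderOf_eq_one (FiniteField.frobeniusAlgHom k K)
  rw [FiniteField.orderOf_frobeniusAlgHom, hK, pow_two] at h
  exact congr($h x)

/-- Two points with values in a quadratic extension that have the same kernel are conjugate. -/
theorem eq_or_eq_frobenius_comp {B : Type*} [CommRing B] [Algebra k B]
    (hK : Module.finrank k K = 2) (φ ψ : B →ₐ[k] K) (h : ∀ b, φ b = 0 → ψ b = 0) :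
    ψ = φ ∨ ψ = (FiniteField.frobeniusAlgHom k K).comp φ := by
  let F := FiniteField.frobeniusAlgHom k K
  have hF (x : K) : F (F x) = x := frobenius_frobenius_apply hK x
  have key (b : B) : ψ b = φ b ∨ ψ b = F (φ b) := by
    -- Trace and norm give a quadratic polynomial over `k` with roots `φ b` and `F (φ b)`. Its value
    -- at `b` is killed by `φ`, hence by `ψ`.
    obtain ⟨t, ht⟩ := (mem_range_algebraMap_iff_frobenius_eq (k := k) (φ b + F (φ b))).mpr (by
      change F _ = _
      rw [map_add, hF, add_comm])
    obtain ⟨n, hn⟩ := (mem_range_algebraMap_iff_frobenius_eq (k := k) (φ b * F (φ b))).mpr (by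
      change F _ = _
      rw [map_mul, hF, mul_comm])
    have h1 := h (b * b - algebraMap k B t * b + algebraMap k B n) (by
      rw [map_add, map_sub, map_mul, map_mul, AlgHom.commutes, AlgHom.commutes, ht, hn]
      ring)
    rw [map_add, map_sub, map_mul, map_mul, AlgHom.commutes, AlgHom.commutes, ht, hn] at h1
    have h2 : (ψ b - φ b) * (ψ b - F (φ b)) = 0 := by
      rw [← h1]
      ring
    exact (mul_eq_zero.mp h2).imp sub_eq_zero.mp sub_eq_zero.mp
  by_contra! hne
  obtain ⟨h1, h2⟩ := hne
  obtain ⟨b, hb⟩ := DFunLike.ne_iff.mp h1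
  obtain ⟨c, hc⟩ := DFunLike.ne_iff.mp h2
  have hb' : ψ b = F (φ b) := (key b).resolve_left hb
  have hc' : ψ c = φ c := (key c).resolve_right hc
  -- A group is not the union of two proper subgroups, here the loci where `ψ` agrees with `φ` and
  -- with its conjugate.
  rcases key (b + c) with h3 | h3
  · rw [map_add, map_add, hc', add_left_inj] at h3
    exact hb h3
  · rw [map_add, map_add, map_add, hb', add_right_inj] at h3
    exact hc h3

end Algebra

/-! ### Rational points and Frobenius. -/

section Points

variable {k : Type u} [Field k] {X Y : Scheme.{u}} {s : X ⟶ Spec (CommRingCat.of k)}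
  {K L : Type u} [Field K] [Algebra k K] [Field L] [Algebra k L]

namespace RationalPoint

/-- The underlying point of a rational point. -/
def point (P : RationalPoint s K) : X := P.1 (⊥ : PrimeSpectrum K)

theorem apply_eq_point (P : RationalPoint s K) (z : Spec (CommRingCat.of K)) : P.1 z = P.point := by
  have hs : Subsingleton (Spec (CommRingCat.of K)) :=
    inferInstanceAs (Subsingleton (PrimeSpectrum K))
  exact congrArg P.1 (Subsingleton.elim z (⊥ : PrimeSpectrum K))

theorem le_preimage_iff (P : RationalPoint s K) (U : X.Opens) : ⊤ ≤ P.1 ⁻¹ᵁ U ↔ P.point ∈ U := by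
  refine ⟨fun h => h (Set.mem_univ (⊥ : PrimeSpectrum K)), fun h z _ => ?_⟩
  change P.1 z ∈ U
  rwa [apply_eq_point]

/-- Evaluation of sections at a rational point. -/
def eval (P : RationalPoint s K) {U : X.Opens} (h : P.point ∈ U) : Sec s U →ₐ[k] K :=
  { evalAt P.1 U ((P.le_preimage_iff U).mpr h) with
    commutes' := evalAt_scalar P.1 P.2 U _ }

theorem eval_res (P : RationalPoint s K) {U V : X.Opens} (hUV : U ≤ V) (h : P.point ∈ U)
    (x : Sec s V) : P.eval h (Sec.res s hUV x) = P.eval (hUV h) x :=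
  evalAt_res _ _ _ _

theorem eval_ne_zero_iff (P : RationalPoint s K) {U : X.Opens} (h : P.point ∈ U) (x : Sec s U) :
    P.eval h x ≠ 0 ↔ P.point ∈ X.basicOpen (U := U) x := by
  rw [← isUnit_iff_ne_zero, ← le_preimage_iff]
  refine ⟨fun hx => le_preimage_basicOpen _ x hx, fun hx => ?_⟩
  have h1 := (X.toRingedSpace.isUnit_res_basicOpen (U := U) x).map (evalAt P.1 _ hx)
  have h2 := evalAt_res P.1 (X.basicOpen_le (U := U) x) hx x
  exact h2 ▸ h1

theorem ext_of_eval {P Q : RationalPoint s K} {U : X.Opens} (hU : IsAffineOpen U)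
    (hP : P.point ∈ U) (hQ : Q.point ∈ U) (h : P.eval hP = Q.eval hQ) : P = Q :=
  Subtype.ext (evalAt_ext hU _ _ fun x => congr($h x))

theorem exists_isAffineOpen (x : X) : ∃ U : X.Opens, IsAffineOpen U ∧ x ∈ U := by
  obtain ⟨_, ⟨U, hU, rfl⟩, hxU, -⟩ :=
    X.isBasis_affineOpens.exists_subset_of_mem_open (Set.mem_univ x) isOpen_univ
  exact ⟨U, hU, hxU⟩

theorem exists_eval_eq {U : X.Opens} (hU : IsAffineOpen U) (φ : Sec s U →ₐ[k] K) :
    ∃ (P : RationalPoint s K) (h : P.point ∈ U), P.eval h = φ := by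
  let φ' : Γ(X, U) →+* K := φ.toRingHom
  have h1 := evalAt_specMap_fromSpec hU φ'
  let P : RationalPoint s K := ⟨Spec.map (CommRingCat.ofHom φ') ≫ hU.fromSpec,
    comp_eq_specMap_of_evalAt_scalar _ U (specMap_fromSpec_le hU φ') fun c =>
      (h1 _).trans (φ.commutes c)⟩
  exact ⟨P, (P.le_preimage_iff U).mp (specMap_fromSpec_le hU φ'), AlgHom.ext h1⟩

/-- The map on rational points induced by a homomorphism of fields. -/
def baseMap (φ : L →ₐ[k] K) (P : RationalPoint s L) : RationalPoint s K :=
  ⟨Spec.map (CommRingCat.ofHom φ.toRingHom) ≫ P.1, by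
    rw [Category.assoc, P.2, ← Spec.map_comp, ← CommRingCat.ofHom_comp]
    congr 2
    exact φ.comp_algebraMap⟩

@[simp]
theorem point_baseMap (φ : L →ₐ[k] K) (P : RationalPoint s L) : (P.baseMap φ).point = P.point :=
  P.apply_eq_point _

theorem eval_baseMap (φ : L →ₐ[k] K) (P : RationalPoint s L) {U : X.Opens} (h : P.point ∈ U)
    (h' : (P.baseMap φ).point ∈ U) : (P.baseMap φ).eval h' = φ.comp (P.eval h) :=
  AlgHom.ext fun x => evalAt_specMap φ.toRingHom P.1 U _ _ x

/-- The map on rational points induced by a morphism of schemes. -/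
def push {sY : Y ⟶ Spec (CommRingCat.of k)} {v : X ⟶ Y} (hv : v ≫ sY = s)
    (P : RationalPoint s K) : RationalPoint sY K :=
  ⟨P.1 ≫ v, by rw [Category.assoc, hv, P.2]⟩

theorem point_push {sY : Y ⟶ Spec (CommRingCat.of k)} {v : X ⟶ Y} (hv : v ≫ sY = s)
    (P : RationalPoint s K) : (P.push hv).point = v P.point :=
  rfl

theorem eval_push {sY : Y ⟶ Spec (CommRingCat.of k)} {v : X ⟶ Y} (hv : v ≫ sY = s)
    (P : RationalPoint s K) {U : Y.Opens} (h : P.point ∈ v ⁻¹ᵁ U) (x : Sec sY U) :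
    (P.push hv).eval (U := U) h x = P.eval h (Sec.pull hv U x) :=
  evalAt_comp P.1 v U _ _ x

theorem baseMap_push {sY : Y ⟶ Spec (CommRingCat.of k)} {v : X ⟶ Y} (hv : v ≫ sY = s)
    (φ : L →ₐ[k] K) (P : RationalPoint s L) : (P.push hv).baseMap φ = (P.baseMap φ).push hv :=
  Subtype.ext (Category.assoc _ _ _).symm

theorem baseMap_injective (φ : L →ₐ[k] K) :
    Function.Injective (baseMap φ : RationalPoint s L → RationalPoint s K) := by
  intro P Q h
  obtain ⟨U, hU, hP⟩ := exists_isAffineOpen P.point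
  have hP' : (P.baseMap φ).point ∈ U := by rwa [point_baseMap]
  have hQ : Q.point ∈ U := by rwa [← point_baseMap φ Q, ← h, point_baseMap]
  have hQ' : (Q.baseMap φ).point ∈ U := by rwa [point_baseMap]
  refine ext_of_eval hU hP hQ (AlgHom.ext fun x => φ.injective ?_)
  have h1 := congr($(eval_baseMap φ P hP hP') x)
  have h2 := congr($(eval_baseMap φ Q hQ hQ') x)
  refine h1.symm.trans (Eq.trans ?_ h2)
  congr 1
  congr 1

variable [Fintype k]

theorem frobenius_push {sY : Y ⟶ Spec (CommRingCat.of k)} {v : X ⟶ Y} (hv : v ≫ sY = s)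
    (P : RationalPoint s K) : frobenius sY K (P.push hv) = (frobenius s K P).push hv :=
  baseMap_push hv _ P

theorem point_frobenius (P : RationalPoint s K) : (frobenius s K P).point = P.point :=
  P.point_baseMap _

theorem eval_frobenius (P : RationalPoint s K) {U : X.Opens} (h : P.point ∈ U)
    (h' : (frobenius s K P).point ∈ U) (x : Sec s U) :
    (frobenius s K P).eval h' x = FiniteField.frobeniusAlgHom k K (P.eval h x) :=
  congr($(eval_baseMap _ P h h') x)

theorem frobenius_eq_iff (P : RationalPoint s K) {U : X.Opens} (hU : IsAffineOpen U)
    (h : P.point ∈ U) : frobenius s K P = P ↔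
      ∀ x, FiniteField.frobeniusAlgHom k K (P.eval h x) = P.eval h x := by
  have h' : (frobenius s K P).point ∈ U := by rwa [point_frobenius]
  constructor
  · intro e x
    rw [← P.eval_frobenius h h']
    congr 1
    congr 1
  · intro e
    refine ext_of_eval hU h' h (AlgHom.ext fun x => ?_)
    rw [P.eval_frobenius h h', e x]

theorem frobenius_frobenius [Finite K] (hK : Module.finrank k K = 2) (P : RationalPoint s K) :
    frobenius s K (frobenius s K P) = P := by
  obtain ⟨U, hU, hP⟩ := exists_isAffineOpen P.point
  have h1 : (frobenius s K P).point ∈ U := by rwa [point_frobenius]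
  have h2 : (frobenius s K (frobenius s K P)).point ∈ U := by rwa [point_frobenius]
  refine ext_of_eval hU h2 hP (AlgHom.ext fun x => ?_)
  rw [eval_frobenius _ h1, eval_frobenius _ hP, frobenius_frobenius_apply hK]

/-- Frobenius fixes `P` exactly when all values of functions at `P` lie in `k`, that is, when
evaluation at `P` factors through `k`. -/
theorem mem_range_baseMap_iff [Finite K] (P : RationalPoint s K) :
    P ∈ Set.range (baseMap (Algebra.ofId k K) : RationalPoint s k → RationalPoint s K) ↔
      frobenius s K P = P := by
  obtain ⟨U, hU, hP⟩ := exists_isAffineOpen P.point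
  rw [frobenius_eq_iff P hU hP]
  constructor
  · rintro ⟨Q, rfl⟩ x
    rw [eval_baseMap _ Q (by rwa [point_baseMap] at hP)]
    exact AlgHom.commutes _ _
  · intro h
    have h1 : (P.eval hP).range ≤ (Algebra.ofId k K).range := by
      rintro _ ⟨x, rfl⟩
      exact (mem_range_algebraMap_iff_frobenius_eq _).mpr (h x)
    let e : k ≃ₐ[k] (Algebra.ofId k K).range :=
      AlgEquiv.ofInjective _ (algebraMap k K).injective
    obtain ⟨Q, hQ, hφ⟩ := exists_eval_eq hU ((e.symm : _ →ₐ[k] k).comp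
      ((Subalgebra.inclusion h1).comp (P.eval hP).rangeRestrict))
    have hQ' : (Q.baseMap (Algebra.ofId k K)).point ∈ U := by rwa [point_baseMap]
    refine ⟨Q, ext_of_eval hU hQ' hP (AlgHom.ext fun x => ?_)⟩
    rw [eval_baseMap _ Q hQ, hφ]
    exact congrArg Subtype.val (e.apply_symm_apply _)

/-- The underlying point determines which functions vanish, and over a quadratic extension this
leaves two conjugate evaluations. -/
theorem eq_or_eq_frobenius [Finite K] (hK : Module.finrank k K = 2) (P Q : RationalPoint s K)
    (h : P.point = Q.point) : Q = P ∨ Q = frobenius s K P := by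
  obtain ⟨U, hU, hP⟩ := exists_isAffineOpen P.point
  have hQ : Q.point ∈ U := h ▸ hP
  have hF : (frobenius s K P).point ∈ U := by rwa [point_frobenius]
  refine (eq_or_eq_frobenius_comp hK (P.eval hP) (Q.eval hQ) fun b hb => ?_).imp
    (fun e => ext_of_eval hU hQ hP e) (fun e => ext_of_eval hU hQ hF (e.trans
      (AlgHom.ext fun x => (P.eval_frobenius hP hF x).symm)))
  by_contra hb'
  rw [← ne_eq, eval_ne_zero_iff, ← h, ← eval_ne_zero_iff _ hP] at hb'
  exact hb' hb

omit [Fintype k] in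
theorem finite [CompactSpace X] [LocallyOfFiniteType s] [Finite K] :
    Finite (RationalPoint s K) := by
  obtain ⟨t, ht⟩ := (isCompact_univ (X := X)).elim_finite_subcover
    (fun x : X => ((exists_isAffineOpen x).choose : Set X))
    (fun x => (exists_isAffineOpen x).choose.isOpen)
    fun x _ => Set.mem_iUnion.mpr ⟨x, (exists_isAffineOpen x).choose_spec.2⟩
  have hfin (x : X) : Finite (Sec s (exists_isAffineOpen x).choose →ₐ[k] K) := by
    have h1 : Algebra.FiniteType k (Sec s (exists_isAffineOpen x).choose) :=
      finiteType_scalar s (exists_isAffineOpen x).choose_spec.1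
    obtain ⟨S, hS⟩ := h1.out
    refine Finite.of_injective (fun φ : _ →ₐ[k] K => fun a : S => φ a) fun φ ψ h => ?_
    exact AlgHom.ext_of_adjoin_eq_top hS fun a ha => congrFun h ⟨a, ha⟩
  have hmem (P : RationalPoint s K) : ∃ x : t, P.point ∈ (exists_isAffineOpen x.1).choose := by
    obtain ⟨x, hx, hP⟩ := Set.mem_iUnion₂.mp (ht (Set.mem_univ P.point))
    exact ⟨⟨x, hx⟩, hP⟩
  choose i hi using hmem
  refine Finite.of_injective (β := Σ x : t, (Sec s (exists_isAffineOpen x.1).choose →ₐ[k] K))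
    (fun P => ⟨i P, P.eval (hi P)⟩) fun P Q h => ?_
  have h1 : i P = i Q := congrArg Sigma.fst h
  have hQ : Q.point ∈ (exists_isAffineOpen (i P).1).choose := h1 ▸ hi Q
  have h2 : ∀ (x : t) (_ : x = i Q) (hQ : Q.point ∈ (exists_isAffineOpen x.1).choose),
      (⟨x, Q.eval hQ⟩ : Σ x : t, (Sec s (exists_isAffineOpen x.1).choose →ₐ[k] K)) =
        ⟨i Q, Q.eval (hi Q)⟩ := by
    rintro _ rfl _
    rfl
  exact ext_of_eval (exists_isAffineOpen (i P).1).choose_spec.1 (hi P) hQ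
    (eq_of_heq (Sigma.mk.inj (h.trans (h2 _ h1 hQ).symm)).2)

end RationalPoint

end Points

end CurvesOverFiniteFields

end

/-! ### Frobenius invariant sections and a local criterion for gluing. -/

noncomputable section

namespace CurvesOverFiniteFields

open Opposite

/-- Injectivity makes local preimages unique, so they agree on overlaps and glue. -/
theorem mem_range_app_of_locally {C Y : Scheme.{u}} {w : C ⟶ Y}
    (hinj : ∀ U : Y.Opens, Function.Injective (w.app U).hom) {O : Y.Opens} (x : Γ(C, w ⁻¹ᵁ O))
    (h : ∀ y ∈ O, ∃ (O' : Y.Opens) (hO : O' ≤ O), y ∈ O' ∧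
      (C.presheaf.map (homOfLE (w.preimage_mono hO)).op).hom x ∈ Set.range (w.app O').hom) :
    x ∈ Set.range (w.app O).hom := by
  have hnat {U V : Y.Opens} (hUV : U ≤ V) (a : Γ(Y, V)) :
      (w.app U).hom ((Y.presheaf.map (homOfLE hUV).op).hom a) =
        (C.presheaf.map (homOfLE (w.preimage_mono hUV)).op).hom ((w.app V).hom a) :=
    congr($(w.naturality (homOfLE hUV).op) a)
  have hres {U V W : C.Opens} (hUV : U ≤ V) (hVW : V ≤ W) (b : Γ(C, W)) :
      (C.presheaf.map (homOfLE hUV).op).hom ((C.presheaf.map (homOfLE hVW).op).hom b) =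
        (C.presheaf.map (homOfLE (hUV.trans hVW)).op).hom b := by
    rw [← CommRingCat.comp_apply, ← C.presheaf.map_comp]
    rfl
  choose! U hUO hyU a ha using h
  have hcov : O ≤ ⨆ y : O, U y := fun y hy => Opens.mem_iSup.mpr ⟨⟨y, hy⟩, hyU y hy⟩
  obtain ⟨t, ht, -⟩ := TopCat.Sheaf.existsUnique_gluing' Y.sheaf (fun y : O => U y) O
    (fun y => homOfLE (hUO y y.2)) hcov (fun y => a y) fun y z => by
      apply hinj
      refine (hnat inf_le_left _).trans (Eq.trans ?_ (hnat inf_le_right _).symm)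
      rw [ha y y.2, ha z z.2, hres, hres]
  refine ⟨t, TopCat.Sheaf.eq_of_locally_eq' C.sheaf (fun y : O => w ⁻¹ᵁ U y) _
    (fun y => homOfLE (w.preimage_mono (hUO y y.2))) (fun c hc => ?_) _ _ fun y => ?_⟩
  · obtain ⟨y, hy⟩ := Opens.mem_iSup.mp (hcov hc)
    exact Opens.mem_iSup.mpr ⟨y, hy⟩
  · refine (hnat (hUO y y.2) t).symm.trans (Eq.trans ?_ (ha y y.2))
    exact congrArg (w.app (U y)).hom (ht y)

section

variable {k : Type u} [Field k] [Fintype k] {C Y : Scheme.{u}} {sC : C ⟶ Spec (CommRingCat.of k)}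
  {sY : Y ⟶ Spec (CommRingCat.of k)} {K : Type u} [Field K] [Algebra k K] [Finite K]

variable (K) in
/-- The sections whose value at each `K`-rational point is invariant under Frobenius. -/
def invariantSec (sC : C ⟶ Spec (CommRingCat.of k)) (V : C.Opens) : Subalgebra k (Sec sC V) :=
  ⨅ (P : RationalPoint sC K) (h : P.point ∈ V),
    AlgHom.equalizer ((FiniteField.frobeniusAlgHom k K).comp (P.eval h)) (P.eval h)

omit [Finite K] in
theorem mem_invariantSec {V : C.Opens} {x : Sec sC V} : x ∈ invariantSec K sC V ↔
    ∀ (P : RationalPoint sC K) (h : P.point ∈ V),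
      FiniteField.frobeniusAlgHom k K (P.eval h x) = P.eval h x := by
  simp [invariantSec, Algebra.mem_iInf, AlgHom.mem_equalizer]

/-- The values of this power at `K`-points are 0 or 1. It shows that a power of every function on
`C` descends, which forces a gluing to be injective on points. -/
theorem pow_mem_invariantSec {V : C.Opens} (x : Sec sC V) :
    x ^ (Nat.card K - 1) ∈ invariantSec K sC V := by
  have : Fintype K := Fintype.ofFinite K
  rw [mem_invariantSec]
  intro P h
  rw [map_pow, Nat.card_eq_fintype_card]
  by_cases h0 : P.eval h x = 0
  · have : Fintype.card K - 1 ≠ 0 := by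
      have := Fintype.one_lt_card (α := K)
      omega
    rw [h0, zero_pow this, map_zero]
  · rw [FiniteField.pow_card_sub_one_eq_one _ h0, map_one]

omit [Finite K] in
theorem res_mem_invariantSec {V V' : C.Opens} (hV : V ≤ V') {x : Sec sC V'}
    (hx : x ∈ invariantSec K sC V') : Sec.res sC hV x ∈ invariantSec K sC V := by
  rw [mem_invariantSec] at hx ⊢
  intro P h
  rw [P.eval_res]
  exact hx P _

omit [Finite K] in
theorem isGluing_mem_range_iff {w : C ⟶ Y} (hw : w ≫ sY = sC) (U : Y.Opens) :
    ((Sec.pull hw U).range = invariantSec K sC (w ⁻¹ᵁ U)) ↔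
      ∀ x : Γ(C, w ⁻¹ᵁ U), x ∈ Set.range (w.app U).hom ↔
        ∀ (P : RationalPoint sC K) (h : ⊤ ≤ P.1 ⁻¹ᵁ w ⁻¹ᵁ U)
          (h' : ⊤ ≤ (frobenius sC K P).1 ⁻¹ᵁ w ⁻¹ᵁ U),
          evalAt P.1 _ h x = evalAt (frobenius sC K P).1 _ h' x := by
  have key (x : Sec sC (w ⁻¹ᵁ U)) : x ∈ invariantSec K sC (w ⁻¹ᵁ U) ↔
      ∀ (P : RationalPoint sC K) (h : ⊤ ≤ P.1 ⁻¹ᵁ w ⁻¹ᵁ U)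
        (h' : ⊤ ≤ (frobenius sC K P).1 ⁻¹ᵁ w ⁻¹ᵁ U),
          evalAt P.1 _ h x = evalAt (frobenius sC K P).1 _ h' x := by
    rw [mem_invariantSec]
    refine forall_congr' fun P => ?_
    constructor
    · intro hx h h'
      have h1 := (P.le_preimage_iff _).mp h
      exact (hx h1).symm.trans (P.eval_frobenius h1 ((RationalPoint.le_preimage_iff _ _).mp h') x).symm
    · intro hx h
      have h1 : (frobenius sC K P).point ∈ w ⁻¹ᵁ U := by rwa [P.point_frobenius]
      exact (P.eval_frobenius h h1 x).symm.trans
        (hx ((P.le_preimage_iff _).mpr h) ((RationalPoint.le_preimage_iff _ _).mpr h1)).symm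
  rw [SetLike.ext_iff]
  exact forall_congr' fun x => iff_congr Iff.rfl (key x)

omit [Finite K] in
theorem range_pull_le_invariantSec {w : C ⟶ Y} (hw : w ≫ sY = sC)
    (hpush : ∀ P : RationalPoint sC K, frobenius sY K (P.push hw) = P.push hw) (U : Y.Opens) :
    (Sec.pull hw U).range ≤ invariantSec K sC (w ⁻¹ᵁ U) := by
  rintro _ ⟨a, rfl⟩
  refine mem_invariantSec.mpr fun P h => ?_
  change FiniteField.frobeniusAlgHom k K (P.eval h (Sec.pull hw U a)) =
    P.eval h (Sec.pull hw U a)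
  rw [← P.eval_push hw h]
  have h1 : (frobenius sY K (P.push hw)).point ∈ U := by
    rw [RationalPoint.point_frobenius]
    exact h
  rw [← RationalPoint.eval_frobenius (P.push hw) h h1]
  congr 1
  congr 1
  exact hpush P

/-- A criterion for `w` to be the gluing of the `K`-rational points along Frobenius. -/
theorem isGluing_of_locally {w : C ⟶ Y} (hw : w ≫ sY = sC) [IsIntegralHom w] [Surjective w]
    (hinj : ∀ U : Y.Opens, Function.Injective (w.app U).hom)
    (hpush : ∀ P : RationalPoint sC K, frobenius sY K (P.push hw) = P.push hw)
    (hloc : ∀ (y : Y) (O : Y.Opens), y ∈ O → ∃ O' ≤ O, y ∈ O' ∧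
      invariantSec K sC (w ⁻¹ᵁ O') ≤ (Sec.pull hw O').range) : IsGluing sC K w := by
  have hrange (U : Y.Opens) : (Sec.pull hw U).range = invariantSec K sC (w ⁻¹ᵁ U) := by
    refine le_antisymm (range_pull_le_invariantSec hw hpush U) fun x hx => ?_
    refine mem_range_app_of_locally hinj x fun y hy => ?_
    obtain ⟨O', hO, hyO, hle⟩ := hloc y U hy
    exact ⟨O', hO, hyO, hle (res_mem_invariantSec (w.preimage_mono hO) hx)⟩
  have hptinj : Function.Injective w := by
    intro c c' hcc
    obtain ⟨U, hU, hyU⟩ := RationalPoint.exists_isAffineOpen (w c)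
    have hU' := hU.preimage w
    -- A positive power of `b` comes from `Y`, so the nonvanishing locus of `b` is a preimage and
    -- cannot separate two points with the same image.
    have hmem (b : Γ(C, w ⁻¹ᵁ U)) : c ∈ C.basicOpen b ↔ c' ∈ C.basicOpen b := by
      obtain ⟨a, ha⟩ := (hrange U).ge (pow_mem_invariantSec (sC := sC) (K := K) b)
      obtain ⟨a, ha⟩ : ∃ a : Γ(Y, U), (w.app U).hom a = b ^ (Nat.card K - 1) := ⟨a, ha⟩
      have hpos : 0 < Nat.card K - 1 := by
        have := Finite.one_lt_card (α := K)
        omega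
      have h1 : C.basicOpen b = w ⁻¹ᵁ Y.basicOpen a := by
        rw [Scheme.preimage_basicOpen, ← C.basicOpen_pow b hpos]
        exact congrArg _ ha.symm
      rw [h1]
      change w c ∈ Y.basicOpen a ↔ w c' ∈ Y.basicOpen a
      rw [hcc]
    obtain ⟨p, rfl⟩ : c ∈ Set.range hU'.fromSpec := by
      rw [hU'.range_fromSpec]
      exact hyU
    obtain ⟨p', rfl⟩ : c' ∈ Set.range hU'.fromSpec := by
      rw [hU'.range_fromSpec]
      change w c' ∈ U
      rwa [← hcc]
    congr 1
    refine PrimeSpectrum.ext (Ideal.ext fun b => not_iff_not.mp ?_)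
    have hb (p : PrimeSpectrum Γ(C, w ⁻¹ᵁ U)) :
        b ∉ p.asIdeal ↔ hU'.fromSpec p ∈ C.basicOpen b := by
      rw [← PrimeSpectrum.mem_basicOpen, ← hU'.fromSpec_preimage_basicOpen]
      rfl
    exact (hb p).trans ((hmem b).trans (hb p').symm)
  refine ⟨TopCat.isIso_of_bijective_of_isClosedMap _ ⟨hptinj, w.surjective⟩ w.isClosedMap, hinj,
    fun U => (isGluing_mem_range_iff hw U).mp (hrange U)⟩

end

end CurvesOverFiniteFields

end

/-! ### Counting dimensions at the points that do not lift. -/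

noncomputable section

namespace CurvesOverFiniteFields

open Opposite

section Gaps

variable {k A B : Type*} [Field k] [CommRing A] [Algebra k A] [CommRing B] [Algebra k B]

/-- If the range of `A → B` has codimension at most the number of `k`-points of `A` that do not
extend to `B`, then each of these points has residue degree two in `B`, and the range is defined by
the condition that the values at these points lie in `k`. -/
theorem finrank_eq_two_of_gaps (f : A →ₐ[k] B)
    [FiniteDimensional k (B ⧸ LinearMap.range f.toLinearMap)] {E : Type*} [Fintype E]
    (φ : E → A →ₐ[k] k) (n : E → Ideal B) [hmax : ∀ e, (n e).IsMaximal]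
    (hn : Function.Injective n)
    (hφ : ∀ e a, f a - algebraMap k B (φ e a) ∈ n e)
    (hext : ∀ (e : E) (ψ : B →ₐ[k] k), ψ.comp f ≠ φ e)
    (hle : Module.finrank k (B ⧸ LinearMap.range f.toLinearMap) ≤ Fintype.card E) :
    (∀ e, Module.finrank k (B ⧸ n e) = 2) ∧ ∀ b,
      (∀ e, Ideal.Quotient.mk (n e) b ∈ Set.range (algebraMap k (B ⧸ n e))) → b ∈ f.range := by
  classical
  let Q (e : E) := (B ⧸ n e) ⧸ LinearMap.range (Algebra.linearMap k (B ⧸ n e))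
  -- This map is surjective by the Chinese remainder theorem and kills the range of `f`, so the
  -- codimension bounds the sum of the dimensions of the `Q e`.
  let L : B →ₗ[k] ∀ e, Q e := LinearMap.pi fun e =>
    (Submodule.mkQ _).comp (Ideal.Quotient.mkₐ k (n e)).toLinearMap
  have hL (b : B) (e : E) : L b e = Submodule.Quotient.mk (Ideal.Quotient.mk (n e) b) := rfl
  have hLsurj : Function.Surjective L := by
    intro x
    choose y hy using fun e => Submodule.Quotient.mk_surjective _ (x e)
    choose z hz using fun e => Ideal.Quotient.mk_surjective (y e)
    obtain ⟨b, hb⟩ := Ideal.exists_forall_sub_mem_ideal (I := n)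
      (fun i j hij => Ideal.isCoprime_iff_sup_eq.mpr
        (Ideal.IsMaximal.coprime_of_ne (hmax i) (hmax j) (hn.ne hij))) z
    refine ⟨b, funext fun e => ?_⟩
    rw [hL, ← hy, ← hz, Ideal.Quotient.eq.mpr (hb e)]
  have hker : LinearMap.range f.toLinearMap ≤ LinearMap.ker L := by
    rintro _ ⟨a, rfl⟩
    refine funext fun e => ?_
    refine (hL _ e).trans ((Submodule.Quotient.mk_eq_zero _).mpr ⟨φ e a, ?_⟩)
    exact (Ideal.Quotient.eq.mpr (hφ e a)).symm
  let M := (LinearMap.range f.toLinearMap).liftQ L hker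
  have hM : Function.Surjective M := fun x => by
    obtain ⟨b, rfl⟩ := hLsurj x
    exact ⟨Submodule.Quotient.mk b, rfl⟩
  have hfin : FiniteDimensional k (∀ e, Q e) := Module.Finite.of_surjective M hM
  have hfinQ (e : E) : FiniteDimensional k (Q e) :=
    Module.Finite.of_surjective (LinearMap.proj (R := k) (φ := Q) e) (Function.surjective_eval e)
  have hfinB (e : E) : FiniteDimensional k (B ⧸ n e) :=
    Module.Finite.of_submodule_quotient (LinearMap.range (Algebra.linearMap k (B ⧸ n e)))
  -- If `Q e` vanished, the residue field would be `k` and `φ e` would extend to `B`.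
  have hpos (e : E) : 1 ≤ Module.finrank k (Q e) := by
    by_contra hlt
    have h0 : Module.finrank k (Q e) = 0 := by omega
    have h1 : Subsingleton (Q e) := Module.finrank_zero_iff.mp h0
    have h2 := Submodule.Quotient.subsingleton_iff.mp h1
    have h3 : Function.Bijective (algebraMap k (B ⧸ n e)) :=
      ⟨(algebraMap k (B ⧸ n e)).injective, LinearMap.range_eq_top.mp h2⟩
    let i : k ≃ₐ[k] (B ⧸ n e) := AlgEquiv.ofBijective (Algebra.ofId k _) h3
    refine hext e ((i.symm : _ →ₐ[k] k).comp (Ideal.Quotient.mkₐ k (n e))) (AlgHom.ext fun a => ?_)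
    refine i.injective ((i.apply_symm_apply _).trans ?_)
    exact Ideal.Quotient.eq.mpr (hφ e a)
  have hsum : ∑ e, Module.finrank k (Q e) ≤ Fintype.card E := by
    rw [← Module.finrank_pi_fintype]
    exact (LinearMap.finrank_le_finrank_of_surjective hM).trans hle
  have hone (e : E) : Module.finrank k (Q e) = 1 := by
    have h1 : ∑ e : E, 1 = ∑ e, Module.finrank k (Q e) :=
      le_antisymm (Finset.sum_le_sum fun e _ => hpos e) (hsum.trans (by simp))
    exact ((Finset.sum_eq_sum_iff_of_le fun e _ => hpos e).mp h1 e (Finset.mem_univ e)).symm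
  refine ⟨fun e => ?_, fun b hb => ?_⟩
  · have h1 := Submodule.finrank_quotient_add_finrank
      (LinearMap.range (Algebra.linearMap k (B ⧸ n e)))
    have h2 : Module.finrank k (LinearMap.range (Algebra.linearMap k (B ⧸ n e))) = 1 := by
      rw [LinearMap.finrank_range_of_inj (algebraMap k (B ⧸ n e)).injective, Module.finrank_self]
    rw [h2] at h1
    exact h1.symm.trans (congrArg (· + 1) (hone e))
  · have h1 : Module.finrank k (∀ e, Q e) = Fintype.card E := by
      rw [Module.finrank_pi_fintype, Finset.sum_congr rfl fun e _ => hone e]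
      simp
    have h2 : Module.finrank k (B ⧸ LinearMap.range f.toLinearMap) =
        Module.finrank k (∀ e, Q e) :=
      le_antisymm (hle.trans h1.ge) (LinearMap.finrank_le_finrank_of_surjective hM)
    have h3 : Function.Injective M :=
      (LinearMap.injective_iff_surjective_of_finrank_eq_finrank h2).mpr hM
    have h4 : (Submodule.Quotient.mk b : B ⧸ LinearMap.range f.toLinearMap) = 0 := by
      refine h3 (Eq.trans (funext fun e => ?_) (map_zero M).symm)
      exact (Submodule.Quotient.mk_eq_zero _).mpr (hb e)
    exact (Submodule.Quotient.mk_eq_zero _).mp h4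

end Gaps

variable {k : Type u} [Field k] {C Y : Scheme.{u}} {sC : C ⟶ Spec (CommRingCat.of k)}
  {sY : Y ⟶ Spec (CommRingCat.of k)} {K : Type u} [Field K] [Algebra k K]

theorem arithmeticGenus_eq_of_twoChart [Finite k] (hC : IsProjectiveCurve sC)
    (hY : IsProjectiveCurve sY) [IsIntegral C] [IsIntegral Y] {v : C ⟶ Y} [IsAffineHom v]
    (hv : v ≫ sY = sC) (c : TwoChart Y) (hc : c.U ⊔ c.V = ⊤) (hηY : genericPoint Y ∈ c.U ⊓ c.V)
    (hη : genericPoint C ∈ v ⁻¹ᵁ c.U ⊓ v ⁻¹ᵁ c.V)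
    (hbij : ∀ W ≤ c.V, Function.Bijective (Sec.pull hv W)) :
    FiniteDimensional k (Sec sC (v ⁻¹ᵁ c.U) ⧸ LinearMap.range (Sec.pull hv c.U).toLinearMap) ∧
      arithmeticGenus sY = arithmeticGenus sC +
        (Module.finrank k
          (Sec sC (v ⁻¹ᵁ c.U) ⧸ LinearMap.range (Sec.pull hv c.U).toLinearMap) : ℤ) := by
  have := hC.isProper
  have := hY.isProper
  have hC' : v ⁻¹ᵁ c.U ⊔ v ⁻¹ᵁ c.V = ⊤ := congrArg (v ⁻¹ᵁ ·) hc
  have := finite_sections_inf sC hC'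
  have := finite_sections_quotient sY c.isAffineOpen_left c.isAffineOpen_right hc hηY c.f c.g
    c.basicOpen_f c.basicOpen_g c.mul_eq_one
  exact arithmeticGenus_eq_add_finrank hv c.isAffineOpen_left c.isAffineOpen_right hc
    (c.isAffineOpen_left.preimage v) (c.isAffineOpen_right.preimage v) hη hbij

theorem RationalPoint.exists_push_eq {v : C ⟶ Y} [IsAffineHom v] (hv : v ≫ sY = sC)
    (P : RationalPoint sY K) {U : Y.Opens} (hU : IsAffineOpen U) (h : P.point ∈ U)
    (ψ : Sec sC (v ⁻¹ᵁ U) →ₐ[k] K) (hψ : ψ.comp (Sec.pull hv U) = P.eval h) :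
    ∃ Q : RationalPoint sC K, Q.push hv = P := by
  obtain ⟨Q, hQ, rfl⟩ := exists_eval_eq (hU.preimage v) ψ
  refine ⟨Q, ext_of_eval hU hQ h (AlgHom.ext fun x => ?_)⟩
  rw [Q.eval_push hv hQ, ← hψ]
  rfl

/-- The number of points over a quadratic extension that are not defined over the base field. -/
theorem card_frobenius_ne [Fintype k] [Finite K] [CompactSpace C] [LocallyOfFiniteType sC] :
    numPoints sC K = numPoints sC k + Nat.card {P : RationalPoint sC K // frobenius sC K P ≠ P} := by
  have : Finite (RationalPoint sC K) := RationalPoint.finite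
  have h1 : numPoints sC k = Nat.card {P : RationalPoint sC K // frobenius sC K P = P} := by
    refine Nat.card_congr ((Equiv.ofInjective _
      (RationalPoint.baseMap_injective (s := sC) (Algebra.ofId k K))).trans
        (Equiv.subtypeEquivRight fun P => P.mem_range_baseMap_iff))
  rw [h1, ← Nat.card_sum]
  classical
  exact Nat.card_congr (Equiv.sumCompl _).symm

end CurvesOverFiniteFields

end

/-! ### From the two inequalities to the gluing. -/

noncomputable section

namespace CurvesOverFiniteFields

open Opposite

variable {k : Type u} [Field k] [Fintype k] {C Y : Scheme.{u}} {sC : C ⟶ Spec (CommRingCat.of k)}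
  {sY : Y ⟶ Spec (CommRingCat.of k)} {K : Type u} [Field K] [Algebra k K]

/-- If all sections over an affine open set with Frobenius invariant values come from `Y`, then the
same is true for the basic open subsets. -/
theorem invariantSec_basicOpen_le [IsIntegral C] {v : C ⟶ Y} [IsAffineHom v] (hv : v ≫ sY = sC)
    {U : Y.Opens} (hU : IsAffineOpen U) (h : invariantSec K sC (v ⁻¹ᵁ U) ≤ (Sec.pull hv U).range)
    (h' : (Sec.pull hv U).range ≤ invariantSec K sC (v ⁻¹ᵁ U))
    (a : Γ(Y, U)) (hη : genericPoint C ∈ v ⁻¹ᵁ Y.basicOpen a) :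
    invariantSec K sC (v ⁻¹ᵁ Y.basicOpen a) ≤ (Sec.pull hv (Y.basicOpen a)).range := by
  intro x hx
  let a' : Sec sY U := a
  let D := Y.basicOpen a
  have hD : D ≤ U := Y.basicOpen_le a
  have hD' : v ⁻¹ᵁ D ≤ v ⁻¹ᵁ U := v.preimage_mono hD
  obtain ⟨n, b, hb⟩ : ∃ (n : ℕ) (b : Sec sC (v ⁻¹ᵁ U)),
      x * Sec.res sC hD' (Sec.pull hv U a') ^ n = Sec.res sC hD' b :=
    exists_mul_pow_eq_map (hU.preimage v) hD' ((v.app U).hom a)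
      (Scheme.preimage_basicOpen v a).symm hη x
  have ha' : Sec.pull hv U a' ∈ invariantSec K sC (v ⁻¹ᵁ U) := h' ⟨a', rfl⟩
  -- The numerator `b` is controlled only where `a` does not vanish. The extra factor `a` makes the
  -- values zero at the remaining points.
  have h1 : Sec.pull hv U a' * b ∈ invariantSec K sC (v ⁻¹ᵁ U) := by
    rw [mem_invariantSec]
    intro P hP
    by_cases h0 : P.eval hP (Sec.pull hv U a') = 0
    · rw [map_mul, h0, zero_mul, map_zero]
    · have hPD : P.point ∈ v ⁻¹ᵁ D := by
        rw [← ne_eq, RationalPoint.eval_ne_zero_iff] at h0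
        exact (Scheme.preimage_basicOpen v a).ge h0
      have h2 : P.eval hP b =
          P.eval hPD x * P.eval hP (Sec.pull hv U a') ^ n := by
        rw [← P.eval_res hD' hPD, ← P.eval_res hD' hPD, ← map_pow, ← map_mul, hb]
      rw [map_mul (P.eval hP), h2, map_mul, map_mul, map_pow, mem_invariantSec.mp ha' P hP,
        mem_invariantSec.mp hx P hPD]
  obtain ⟨d, hd⟩ := h h1
  replace hd : Sec.pull hv U d = Sec.pull hv U a' * b := hd
  have hunit : IsUnit (Sec.res sY hD a') := Y.toRingedSpace.isUnit_res_basicOpen (U := U) a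
  obtain ⟨r, hr⟩ := hunit.exists_left_inv
  refine ⟨r ^ (n + 1) * Sec.res sY hD d, ?_⟩
  change Sec.pull hv D (r ^ (n + 1) * Sec.res sY hD d) = x
  have h3 : Sec.pull hv D r * Sec.res sC hD' (Sec.pull hv U a') = 1 := by
    rw [← Sec.pull_res hv hD, ← map_mul, hr, map_one]
  rw [map_mul, map_pow, Sec.pull_res, hd, map_mul, ← hb]
  calc _ = x * (Sec.pull hv D r * Sec.res sC hD' (Sec.pull hv U a')) ^ (n + 1) := by ring
    _ = x := by rw [h3, one_pow, mul_one]

section Gaps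

variable [Finite K] {v : C ⟶ Y} [IsIntegralHom v]

/-- The rational points of `Y` that do not lift to `C` number at least δ and lie off `V`. Lying over
and `finrank_eq_two_of_gaps` put a quadratic point of `C` above each of them, and counting
conjugates shows that no other non-rational `K`-points exist. -/
theorem exists_points_of_gaps (hK : Module.finrank k K = 2)
    [CompactSpace C] [LocallyOfFiniteType sC] [CompactSpace Y] [LocallyOfFiniteType sY]
    (hv : v ≫ sY = sC) {δ : ℕ}
    (hδ : numPoints sC K = numPoints sC k + 2 * δ) (hpts : numPoints sC k + δ ≤ numPoints sY k)
    {U V : Y.Opens} (hU : IsAffineOpen U) (hV : IsAffineOpen V) (hUV : U ⊔ V = ⊤)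
    (hinj : Function.Injective (Sec.pull hv U)) (hbij : Function.Bijective (Sec.pull hv V))
    [FiniteDimensional k (Sec sC (v ⁻¹ᵁ U) ⧸ LinearMap.range (Sec.pull hv U).toLinearMap)]
    (hle : Module.finrank k
      (Sec sC (v ⁻¹ᵁ U) ⧸ LinearMap.range (Sec.pull hv U).toLinearMap) ≤ δ) :
    (∀ P : RationalPoint sC K, frobenius sC K P ≠ P →
      P.point ∈ v ⁻¹ᵁ U ∧ v P.point ∉ V ∧ frobenius sY K (P.push hv) = P.push hv) ∧
    invariantSec K sC (v ⁻¹ᵁ U) ≤ (Sec.pull hv U).range := by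
  have hfinC : Finite (RationalPoint sC k) := RationalPoint.finite
  have hfinCK : Finite (RationalPoint sC K) := RationalPoint.finite
  have hfinY : Finite (RationalPoint sY k) := RationalPoint.finite
  let E := {P : RationalPoint sY k // P ∉ Set.range (RationalPoint.push hv :
    RationalPoint sC k → RationalPoint sY k)}
  have hE : δ ≤ Nat.card E := by
    have h1 : numPoints sY k = Nat.card (Set.range (RationalPoint.push hv :
        RationalPoint sC k → RationalPoint sY k)) + Nat.card E := by
      classical
      rw [← Nat.card_sum]
      exact Nat.card_congr (Equiv.sumCompl _).symm
    have h2 : Nat.card (Set.range (RationalPoint.push hv :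
        RationalPoint sC k → RationalPoint sY k)) ≤ numPoints sC k :=
      Nat.card_le_card_of_surjective _ Set.rangeFactorization_surjective
    omega
  have : Fintype E := Fintype.ofFinite E
  have hEV (e : E) : e.1.point ∉ V := by
    intro hP
    let i := AlgEquiv.ofBijective (Sec.pull hv V) hbij
    refine e.2 (e.1.exists_push_eq hv hV hP ((e.1.eval hP).comp (i.symm : _ →ₐ[k] _)) ?_)
    ext x
    exact congrArg (e.1.eval hP) (i.symm_apply_apply x)
  have hEU (e : E) : e.1.point ∈ U :=
    (Opens.mem_sup.mp (hUV.ge (Opens.mem_top e.1.point))).resolve_right (hEV e)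
  let φ (e : E) : Sec sY U →ₐ[k] k := e.1.eval (hEU e)
  have hφ (e : E) : Function.Surjective (φ e) := fun c =>
    ⟨algebraMap k _ c, (φ e).commutes c⟩
  let _ : Algebra (Sec sY U) (Sec sC (v ⁻¹ᵁ U)) := (Sec.pull hv U).toRingHom.toAlgebra
  have hint : Algebra.IsIntegral (Sec sY U) (Sec sC (v ⁻¹ᵁ U)) :=
    ⟨IsIntegralHom.isIntegral_app (f := v) U hU⟩
  have hex (e : E) : ∃ n : Ideal (Sec sC (v ⁻¹ᵁ U)), n.IsMaximal ∧
      n.comap (Sec.pull hv U) = RingHom.ker (φ e) := by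
    have : (RingHom.ker (φ e)).IsMaximal := RingHom.ker_isMaximal_of_surjective _ (hφ e)
    refine Ideal.exists_ideal_over_maximal_of_isIntegral (RingHom.ker (φ e)) fun a ha => ?_
    rw [hinj (ha.trans (map_zero (Sec.pull hv U)).symm)]
    exact zero_mem _
  choose n hnmax hn using hex
  have hmem (e : E) (a : Sec sY U) : Sec.pull hv U a ∈ n e ↔ φ e a = 0 := by
    rw [← Ideal.mem_comap, hn, RingHom.mem_ker]
  have hn_inj : Function.Injective n := by
    intro e e' h
    refine Subtype.ext (RationalPoint.ext_of_eval hU (hEU e) (hEU e') (AlgHom.ext fun a => ?_))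
    have h1 : φ e (a - algebraMap k _ (φ e a)) = 0 := by
      rw [map_sub, AlgHom.commutes]
      exact sub_self _
    rw [← hmem, h, hmem, map_sub, AlgHom.commutes] at h1
    exact (sub_eq_zero.mp h1).symm
  obtain ⟨htwo, hrange⟩ := finrank_eq_two_of_gaps (Sec.pull hv U) φ n hn_inj
    (fun e a => by
      have h1 : φ e (a - algebraMap k _ (φ e a)) = 0 := by
        rw [map_sub, AlgHom.commutes]
        exact sub_self _
      rwa [← hmem, map_sub, AlgHom.commutes] at h1)
    (fun e ψ hψ => e.2 (e.1.exists_push_eq hv hU (hEU e) ψ hψ))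
    (hle.trans (hE.trans_eq Nat.card_eq_fintype_card))
  -- The residue field and `K` are both quadratic over `k`, so one embeds in the other.
  have hψ (e : E) : ∃ ψ : Sec sC (v ⁻¹ᵁ U) ⧸ n e →ₐ[k] K, Function.Injective ψ := by
    let _ := Ideal.Quotient.field (n e)
    obtain ⟨ψ⟩ := FiniteField.nonempty_algHom_of_finrank_dvd (F := k)
      (K := Sec sC (v ⁻¹ᵁ U) ⧸ n e) (L := K) ((htwo e).trans hK.symm).dvd
    exact ⟨ψ, ψ.toRingHom.injective⟩
  choose ψ hψ using hψ
  have hP (e : E) := RationalPoint.exists_eval_eq (s := sC) (hU.preimage v)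
    ((ψ e).comp (Ideal.Quotient.mkₐ k (n e)))
  choose P hPU hPeval using hP
  have heval (e : E) (b) : (P e).eval (hPU e) b = ψ e (Ideal.Quotient.mk (n e) b) :=
    congr($(hPeval e) b)
  have hfix (e : E) (b) (h : FiniteField.frobeniusAlgHom k K ((P e).eval (hPU e) b) =
      (P e).eval (hPU e) b) : Ideal.Quotient.mk (n e) b ∈ Set.range (algebraMap k (_ ⧸ n e)) := by
    obtain ⟨c, hc⟩ := (mem_range_algebraMap_iff_frobenius_eq _).mpr h
    refine ⟨c, hψ e ?_⟩
    rw [← heval, ← hc]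
    exact (ψ e).commutes c
  have hne (e : E) : frobenius sC K (P e) ≠ P e := by
    intro h
    rw [(P e).frobenius_eq_iff (hU.preimage v) (hPU e)] at h
    have h1 : Function.Surjective (algebraMap k (Sec sC (v ⁻¹ᵁ U) ⧸ n e)) := fun x => by
      obtain ⟨b, rfl⟩ := Ideal.Quotient.mk_surjective x
      exact hfix e b (h b)
    have h2 := LinearMap.finrank_le_finrank_of_surjective
      (f := Algebra.linearMap k (Sec sC (v ⁻¹ᵁ U) ⧸ n e)) h1
    rw [htwo e, Module.finrank_self] at h2
    omega
  have hker (e : E) (b) : b ∈ n e ↔ (P e).point ∉ C.basicOpen (U := v ⁻¹ᵁ U) b := by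
    rw [← RationalPoint.eval_ne_zero_iff _ (hPU e), not_not, heval, map_eq_zero_iff _ (hψ e),
      Ideal.Quotient.eq_zero_iff_mem]
  have hpt (e e' : E) (h : (P e).point = (P e').point) : e = e' :=
    hn_inj (Ideal.ext fun b => by rw [hker, hker, h])
  let τ : E × Bool → {P : RationalPoint sC K // frobenius sC K P ≠ P} := fun x =>
    if x.2 then ⟨P x.1, hne x.1⟩ else ⟨frobenius sC K (P x.1), fun h => hne x.1 (by
      rwa [RationalPoint.frobenius_frobenius hK, eq_comm] at h)⟩
  have hτpt (x) : (τ x).1.point = (P x.1).point := by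
    rcases x with ⟨e, _ | _⟩
    · exact (P e).point_frobenius
    · rfl
  have hτ : Function.Injective τ := by
    intro x y h
    have h1 : x.1 = y.1 := hpt _ _ ((hτpt x).symm.trans ((congrArg (·.1.point) h).trans (hτpt y)))
    obtain ⟨e, b⟩ := x
    obtain ⟨e', b'⟩ := y
    obtain rfl : e = e' := h1
    have h2 := congrArg Subtype.val h
    rcases b with _ | _ <;> rcases b' with _ | _
    · rfl
    · exact (hne e h2).elim
    · exact (hne e h2.symm).elim
    · rfl
  -- The source has at least 2δ elements and the target exactly 2δ.
  have hτsurj : Function.Surjective τ := by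
    refine (hτ.bijective_of_nat_card_le ?_).2
    have h1 := card_frobenius_ne (sC := sC) (K := K)
    rw [Nat.card_prod, Nat.card_eq_fintype_card (α := Bool), Fintype.card_bool]
    omega
  have hpush (e : E) : (P e).push hv = e.1.baseMap (Algebra.ofId k K) := by
    have h1 : (e.1.baseMap (Algebra.ofId k K)).point ∈ U := by
      rw [RationalPoint.point_baseMap]
      exact hEU e
    refine RationalPoint.ext_of_eval hU (hPU e) h1 (AlgHom.ext fun a => ?_)
    rw [RationalPoint.eval_push, RationalPoint.eval_baseMap _ _ (hEU e)]
    refine (heval e _).trans (Eq.trans ?_ ((ψ e).commutes (φ e a)))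
    congr 1
    refine Ideal.Quotient.eq.mpr ?_
    rw [← AlgHom.commutes (Sec.pull hv U), ← map_sub, hmem, map_sub, AlgHom.commutes]
    exact sub_self _
  have hpt' (e : E) : v (P e).point = e.1.point := by
    rw [← RationalPoint.point_push hv, hpush, RationalPoint.point_baseMap]
  constructor
  · intro Q hQ
    obtain ⟨⟨e, b⟩, hx⟩ := hτsurj ⟨Q, hQ⟩
    have h1 : Q.point = (P e).point := by
      rw [← hτpt (e, b), hx]
    have h2 : frobenius sY K ((P e).push hv) = (P e).push hv := by
      rw [hpush, ← RationalPoint.mem_range_baseMap_iff]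
      exact ⟨_, rfl⟩
    refine ⟨h1 ▸ hPU e, ?_, ?_⟩
    · rw [h1, hpt']
      exact hEV e
    · obtain rfl : (τ (e, b)).1 = Q := congrArg Subtype.val hx
      rcases b with _ | _
      · change frobenius sY K ((frobenius sC K (P e)).push hv) = (frobenius sC K (P e)).push hv
        rw [← RationalPoint.frobenius_push, h2, h2]
      · exact h2
  · intro b hb
    exact hrange b fun e => hfix e b (mem_invariantSec.mp hb (P e) (hPU e))

theorem surjective_of_map_genericPoint [IsIntegral C] [IsIntegral Y]
    (h : v (genericPoint C) = genericPoint Y) : Surjective v := by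
  refine ⟨Set.range_eq_univ.mp (Set.eq_univ_of_univ_subset ?_)⟩
  rw [← genericPoint_closure (α := Y)]
  refine closure_minimal ?_ v.isClosedMap.isClosed_range
  rintro _ rfl
  exact ⟨_, h⟩

/-- The charts are chosen with `V` inside the locus where `v` is an isomorphism, so the genus bound
becomes a codimension bound on `U`. Near a point of `V` every section descends; near any other
point, invariant sections over basic open subsets of `U` do. -/
theorem IsNormalizationMap.isGluing (hK : Module.finrank k K = 2) (hC : IsProjectiveCurve sC)
    (hY : IsProjectiveCurve sY) [IsIntegral C] [IsIntegral Y] [QuasiSeparatedSpace Y]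
    (hv : v ≫ sY = sC) (hnorm : IsNormalizationMap v) {δ : ℕ}
    (hδ : numPoints sC K = numPoints sC k + 2 * δ) (hpts : numPoints sC k + δ ≤ numPoints sY k)
    (hgenus : arithmeticGenus sY ≤ arithmeticGenus sC + δ) : IsGluing sC K v := by
  have := hC.isProper
  have := hY.isProper
  have := hC.isNoetherian
  have := hY.isNoetherian
  have : LocallyOfFiniteType (v ≫ sY) := hv ▸ inferInstance
  have : LocallyOfFiniteType v := locallyOfFiniteType_of_comp v sY
  have : IsFinite v := (IsFinite.iff_isIntegralHom_and_locallyOfFiniteType v).mpr ⟨inferInstance, inferInstance⟩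
  have hgen := hnorm.map_genericPoint
  obtain ⟨W, hηW, hW⟩ := hnorm.exists_open
  have hT : ((W : Set Y)ᶜ).Finite := hY.finite_of_isClosed W.isOpen.isClosed_compl fun h => h hηW
  obtain ⟨c, hc, hη, hTc⟩ := hY.exists_twoChart hT fun h => h hηW
  have hVW : c.V ≤ W := fun y hy => by
    by_contra h
    exact (hTc y h).2 hy
  have hbij (O : Y.Opens) (hO : O ≤ c.V) : Function.Bijective (Sec.pull hv O) :=
    hW O (hO.trans hVW)
  have hηC : genericPoint C ∈ v ⁻¹ᵁ c.U ⊓ v ⁻¹ᵁ c.V := by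
    change v (genericPoint C) ∈ c.U ⊓ c.V
    rwa [hgen]
  obtain ⟨hfin, hdim⟩ := arithmeticGenus_eq_of_twoChart hC hY hv c hc hη hηC hbij
  have hinj (O : Y.Opens) : Function.Injective (v.app O).hom := by
    by_cases hO : ∃ y, y ∈ O
    · obtain ⟨y, hy⟩ := hO
      exact hnorm.app_injective O (genericPoint_mem_of_mem hy)
    · obtain rfl : O = ⊥ := le_bot_iff.mp fun y hy => hO ⟨y, hy⟩
      have : Subsingleton Γ(Y, ⊥) :=
        CommRingCat.subsingleton_of_isTerminal Y.sheaf.isTerminalOfEmpty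
      exact Function.injective_of_subsingleton _
  obtain ⟨hpt, hrange⟩ := exists_points_of_gaps hK hv hδ hpts c.isAffineOpen_left
    c.isAffineOpen_right hc (hinj c.U) (hbij c.V le_rfl) (by omega)
  have hpush (P : RationalPoint sC K) : frobenius sY K (P.push hv) = P.push hv := by
    by_cases hP : frobenius sC K P = P
    · rw [RationalPoint.frobenius_push, hP]
    · exact (hpt P hP).2.2
  have := surjective_of_map_genericPoint hgen
  refine isGluing_of_locally hv hinj hpush fun y O hy => ?_
  by_cases hyV : y ∈ c.V
  · exact ⟨O ⊓ c.V, inf_le_left, ⟨hy, hyV⟩, fun x _ => (hbij _ inf_le_right).2 x⟩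
  · have hyU : y ∈ c.U := (Opens.mem_sup.mp (hc.ge (Opens.mem_top y))).resolve_right hyV
    obtain ⟨a, haO, hya⟩ := c.isAffineOpen_left.exists_basicOpen_le ⟨y, hy⟩ hyU
    refine ⟨Y.basicOpen a, haO, hya, invariantSec_basicOpen_le hv c.isAffineOpen_left hrange
      (range_pull_le_invariantSec hv hpush _) a ?_⟩
    change v (genericPoint C) ∈ Y.basicOpen a
    rw [hgen]
    exact genericPoint_mem_of_mem hya

end Gaps

end CurvesOverFiniteFields

end

/-! ### From the gluing to the two inequalities. -/

noncomputable section

namespace CurvesOverFiniteFields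

open Opposite

section

variable {k : Type u} [Field k] {X : Scheme.{u}} {s : X ⟶ Spec (CommRingCat.of k)}
  {K : Type u} [Field K] [Algebra k K]

theorem RationalPoint.isClosed_singleton_point [IsSeparated s] [FiniteDimensional k K]
    (P : RationalPoint s K) : IsClosed {P.point} := by
  have h : IsFinite (P.1 ≫ s) := by
    rw [P.2, IsFinite.SpecMap_iff]
    exact RingHom.finite_algebraMap.mpr inferInstance
  have : IsFinite P.1 := IsFinite.of_comp P.1 s
  have h1 : Set.range P.1 = {P.point} := by
    refine Set.eq_singleton_iff_unique_mem.mpr ⟨⟨_, P.apply_eq_point (⊥ : PrimeSpectrum K)⟩, ?_⟩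
    rintro _ ⟨z, rfl⟩
    exact P.apply_eq_point z
  rw [← h1]
  exact P.1.isClosedMap.isClosed_range

theorem IsProjectiveCurve.not_isClosed_genericPoint [IsIntegral X] (h : IsProjectiveCurve s) :
    ¬ IsClosed {genericPoint X} := by
  intro hcl
  have h1 : (Set.univ : Set X) = {genericPoint X} := by
    rw [← genericPoint_closure, hcl.closure_eq]
  have : Subsingleton X := Set.subsingleton_univ_iff.mp (h1 ▸ Set.subsingleton_singleton)
  have h2 := topologicalKrullDim_zero_of_discreteTopology X
  rw [h.dim_eq_one] at h2
  exact not_le.mpr zero_lt_one h2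

end

theorem map_genericPoint_of_surjective {X Y : Scheme.{u}} [IsIntegral X] [IsIntegral Y] (w : X ⟶ Y)
    [Surjective w] : w (genericPoint X) = genericPoint Y := by
  have h := (genericPoint_spec X).image w.continuous
  rw [Set.image_univ, w.surjective.range_eq, closure_univ] at h
  exact h.eq (genericPoint_spec Y)

variable {k : Type u} [Field k] [Fintype k] {C Y : Scheme.{u}} {sC : C ⟶ Spec (CommRingCat.of k)}
  {sY : Y ⟶ Spec (CommRingCat.of k)} {K : Type u} [Field K] [Algebra k K] [Finite K] {w : C ⟶ Y}

omit [Finite K] in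
theorem IsGluing.range_pull (h : IsGluing sC K w) (hw : w ≫ sY = sC) (U : Y.Opens) :
    (Sec.pull hw U).range = invariantSec K sC (w ⁻¹ᵁ U) :=
  (isGluing_mem_range_iff hw U).mpr (h.mem_range_iff U)

omit [Finite K] in
theorem IsGluing.bijective (h : IsGluing sC K w) : Function.Bijective w :=
  ((TopCat.isIso_iff_isHomeomorph _).mp h.isIso_base).bijective

omit [Finite K] in
theorem IsGluing.frobenius_push (h : IsGluing sC K w) (hw : w ≫ sY = sC)
    (P : RationalPoint sC K) : frobenius sY K (P.push hw) = P.push hw := by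
  rw [RationalPoint.frobenius_push]
  exact Subtype.ext (h.comp_eq P).symm

omit [Finite K] in
-- The map is proper as a morphism between proper schemes and quasi-finite by injectivity.
-- Finiteness makes it affine, as the genus comparison needs.
theorem IsGluing.isFinite (h : IsGluing sC K w) (hw : w ≫ sY = sC) [IsProper sC] [IsProper sY] :
    IsFinite w := by
  have : IsProper (w ≫ sY) := hw ▸ inferInstance
  have : IsProper w := IsProper.of_comp w sY
  have : LocallyQuasiFinite w := .of_injective h.bijective.1
  exact IsFinite.of_isProper_of_locallyQuasiFinite w

omit [Fintype k] in
theorem finrank_quotient_range_algebraMap (hK : Module.finrank k K = 2) :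
    Module.finrank k (K ⧸ LinearMap.range (Algebra.linearMap k K)) = 1 := by
  have : FiniteDimensional k K := Module.finite_of_finrank_pos (by omega)
  have h1 := Submodule.finrank_quotient_add_finrank (LinearMap.range (Algebra.linearMap k K))
  rw [LinearMap.finrank_range_of_inj (algebraMap k K).injective, Module.finrank_self, hK] at h1
  omega

theorem IsGluing.eq_or_eq_frobenius (h : IsGluing sC K w) (hK : Module.finrank k K = 2)
    (hw : w ≫ sY = sC) {P Q : RationalPoint sC K} (hPQ : P.push hw = Q.push hw) :
    Q = P ∨ Q = frobenius sC K P :=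
  RationalPoint.eq_or_eq_frobenius hK P Q (h.bijective.1 (congrArg RationalPoint.point hPQ))

/-- The fibres over these images are exactly the two-element Frobenius orbits. -/
theorem two_mul_card_range_push (h : IsGluing sC K w) (hK : Module.finrank k K = 2)
    (hw : w ≫ sY = sC) :
    2 * Nat.card (Set.range fun P : {P : RationalPoint sC K // frobenius sC K P ≠ P} =>
      P.1.push hw) = Nat.card {P : RationalPoint sC K // frobenius sC K P ≠ P} := by
  let S := {P : RationalPoint sC K // frobenius sC K P ≠ P}
  let D := Set.range fun P : S => P.1.push hw
  let r (d : D) : S := d.2.choose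
  have hr (d : D) : (r d).1.push hw = d.1 := d.2.choose_spec
  let τ : D × Bool → S := fun x =>
    if x.2 then r x.1 else ⟨frobenius sC K (r x.1).1, fun h => (r x.1).2 (by
      rwa [RationalPoint.frobenius_frobenius hK, eq_comm] at h)⟩
  have hτpush (x) : (τ x).1.push hw = x.1.1 := by
    rcases x with ⟨d, _ | _⟩
    · change (frobenius sC K (r d).1).push hw = d.1
      rw [← RationalPoint.frobenius_push, h.frobenius_push, hr]
    · exact hr d
  have hτ : Function.Bijective τ := by
    constructor
    · rintro ⟨d, b⟩ ⟨d', b'⟩ hx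
      obtain rfl : d = d' := Subtype.ext
        ((hτpush (d, b)).symm.trans ((congrArg (·.1.push hw) hx).trans (hτpush (d', b'))))
      have h2 := congrArg Subtype.val hx
      rcases b with _ | _ <;> rcases b' with _ | _
      · rfl
      · exact ((r d).2 h2).elim
      · exact ((r d).2 h2.symm).elim
      · rfl
    · intro P
      let d : D := ⟨P.1.push hw, P, rfl⟩
      rcases h.eq_or_eq_frobenius hK hw (hr d) with h1 | h1
      · exact ⟨(d, true), Subtype.ext h1.symm⟩
      · exact ⟨(d, false), Subtype.ext h1.symm⟩
  rw [← Nat.card_congr (Equiv.ofBijective τ hτ), Nat.card_prod, mul_comm]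
  simp [D, S]

/-- The image of a conjugate pair is fixed by Frobenius, hence rational. It differs from the images
of rational points of `C`, because `K`-points with the same image are equal or conjugate. -/
theorem IsGluing.card_le (h : IsGluing sC K w) (hK : Module.finrank k K = 2) (hw : w ≫ sY = sC)
    [Finite (RationalPoint sY k)] [Finite (RationalPoint sC k)] [Finite (RationalPoint sC K)] :
    numPoints sC k + Nat.card (Set.range fun P : {P : RationalPoint sC K // frobenius sC K P ≠ P} =>
      P.1.push hw) ≤ numPoints sY k := by
  let D := Set.range fun P : {P : RationalPoint sC K // frobenius sC K P ≠ P} => P.1.push hw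
  have hD (d : D) : ∃ Q : RationalPoint sY k, Q.baseMap (Algebra.ofId k K) = d.1 := by
    obtain ⟨_, P, rfl⟩ := d
    exact (RationalPoint.mem_range_baseMap_iff _).mpr (h.frobenius_push hw P.1)
  choose y hy using hD
  have hfix (Q : RationalPoint sC k) : frobenius sC K (Q.baseMap (Algebra.ofId k K)) =
      Q.baseMap (Algebra.ofId k K) := (RationalPoint.mem_range_baseMap_iff _).mp ⟨Q, rfl⟩
  have hdisj (P Q) (hPQ : P.push hw = (Q : RationalPoint sC k).push hw) : Q = P := by
    apply RationalPoint.baseMap_injective (Algebra.ofId k K)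
    have h1 : (P.baseMap (Algebra.ofId k K)).push hw = (Q.baseMap (Algebra.ofId k K)).push hw := by
      rw [← RationalPoint.baseMap_push, hPQ, RationalPoint.baseMap_push]
    exact (h.eq_or_eq_frobenius hK hw h1).elim id fun h2 => h2.trans (hfix P)
  have hinj : Function.Injective (Sum.elim (RationalPoint.push hw) y :
      RationalPoint sC k ⊕ D → RationalPoint sY k) := by
    refine Function.Injective.sumElim (fun P Q hPQ => (hdisj P Q hPQ).symm) (fun d d' hd => ?_)
      fun P d hP => ?_
    · exact Subtype.ext ((hy d).symm.trans ((congrArg _ hd).trans (hy d')))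
    · obtain ⟨Q, hQ⟩ := d.2
      have h1 : (P.baseMap (Algebra.ofId k K)).push hw = Q.1.push hw := by
        rw [← RationalPoint.baseMap_push, hP, hy]
        exact hQ.symm
      apply Q.2
      rcases h.eq_or_eq_frobenius hK hw h1 with h2 | h2
      · rw [h2, hfix]
      · rw [h2, hfix, hfix]
  have h2 := Nat.card_le_card_of_injective _ hinj
  rwa [Nat.card_sum] at h2

/-- Send a function to its values in `K` modulo `k` at one representative of each pair. Each target
is one-dimensional, and functions in the kernel are Frobenius invariant, hence come from `Y`. -/
theorem IsGluing.finrank_le (h : IsGluing sC K w) (hK : Module.finrank k K = 2) (hw : w ≫ sY = sC)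
    [Finite (RationalPoint sC K)] {U : Y.Opens}
    (hU : ∀ P : RationalPoint sC K, frobenius sC K P ≠ P → P.point ∈ w ⁻¹ᵁ U) :
    Module.finrank k (Sec sC (w ⁻¹ᵁ U) ⧸ LinearMap.range (Sec.pull hw U).toLinearMap) ≤
      Nat.card (Set.range fun P : {P : RationalPoint sC K // frobenius sC K P ≠ P} =>
        P.1.push hw) := by
  let S := {P : RationalPoint sC K // frobenius sC K P ≠ P}
  let D := Set.range fun P : S => P.1.push hw
  let r (d : D) : S := d.2.choose
  have hr (d : D) : (r d).1.push hw = d.1 := d.2.choose_spec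
  have : Fintype D := Fintype.ofFinite D
  have : FiniteDimensional k K := Module.finite_of_finrank_pos (by omega)
  let L : Sec sC (w ⁻¹ᵁ U) →ₗ[k] (D → K ⧸ LinearMap.range (Algebra.linearMap k K)) :=
    LinearMap.pi fun d => (Submodule.mkQ _).comp ((r d).1.eval (hU _ (r d).2)).toLinearMap
  have hL : LinearMap.ker L ≤ LinearMap.range (Sec.pull hw U).toLinearMap := by
    intro b hb
    suffices b ∈ (Sec.pull hw U).range from this
    rw [h.range_pull hw, mem_invariantSec]
    intro P hP
    by_cases hfix : frobenius sC K P = P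
    · rw [← P.eval_frobenius hP (by rwa [P.point_frobenius])]
      congr 1
      congr 1
    · let d : D := ⟨P.push hw, ⟨P, hfix⟩, rfl⟩
      have hd : (r d).1.point ∈ w ⁻¹ᵁ U := hU _ (r d).2
      have h1 : FiniteField.frobeniusAlgHom k K ((r d).1.eval hd b) = (r d).1.eval hd b :=
        (mem_range_algebraMap_iff_frobenius_eq _).mp
          ((Submodule.Quotient.mk_eq_zero _).mp (congrFun hb d))
      have h2 : P.eval hP b = (r d).1.eval hd b := by
        rcases h.eq_or_eq_frobenius hK hw (hr d) with h3 | h3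
        · congr 1
          congr 1
        · rw [← h1, ← (r d).1.eval_frobenius hd (by rwa [RationalPoint.point_frobenius])]
          congr 1
          congr 1
      rw [h2, h1]
  have h1 : Module.finrank k (Sec sC (w ⁻¹ᵁ U) ⧸ LinearMap.ker L) ≤ Nat.card D := by
    rw [L.quotKerEquivRange.finrank_eq]
    refine (Submodule.finrank_le _).trans_eq ?_
    rw [Module.finrank_pi_fintype, Finset.sum_congr rfl fun d _ =>
      finrank_quotient_range_algebraMap hK]
    simp
  have : FiniteDimensional k (Sec sC (w ⁻¹ᵁ U) ⧸ LinearMap.ker L) :=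
    Module.Finite.equiv L.quotKerEquivRange.symm
  exact (LinearMap.finrank_le_finrank_of_surjective
    (Submodule.factor_surjective hL)).trans h1

theorem IsGluing.numPoints_le_and_arithmeticGenus_le (h : IsGluing sC K w)
    (hK : Module.finrank k K = 2) (hC : IsProjectiveCurve sC) (hY : IsProjectiveCurve sY)
    [IsIntegral C] [IsIntegral Y] (hw : w ≫ sY = sC) {δ : ℕ}
    (hδ : numPoints sC K = numPoints sC k + 2 * δ) :
    numPoints sC k + δ ≤ numPoints sY k ∧ arithmeticGenus sY ≤ arithmeticGenus sC + δ := by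
  have := hC.isProper
  have := hY.isProper
  have := hC.isNoetherian
  have := hY.isNoetherian
  have : FiniteDimensional k K := Module.finite_of_finrank_pos (by omega)
  have : Finite (RationalPoint sC K) := RationalPoint.finite
  have : Finite (RationalPoint sC k) := RationalPoint.finite
  have : Finite (RationalPoint sY k) := RationalPoint.finite
  have := h.isFinite hw
  have hcard := two_mul_card_range_push h hK hw
  have hcard' := card_frobenius_ne (sC := sC) (K := K)
  have hle := h.card_le hK hw
  refine ⟨by omega, ?_⟩
  have : Surjective w := ⟨h.bijective.2⟩
  have hgen := map_genericPoint_of_surjective w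
  -- These are the nodes. Off them the invariance condition is empty, so `w` is bijective on
  -- sections over the chart `V` that avoids them.
  let T : Set Y := Set.range fun P : {P : RationalPoint sC K // frobenius sC K P ≠ P} => w P.1.point
  have hηT : genericPoint Y ∉ T := by
    rintro ⟨P, hP⟩
    have h1 : P.1.point = genericPoint C := h.bijective.1 (hP.trans hgen.symm)
    exact hC.not_isClosed_genericPoint (h1 ▸ P.1.isClosed_singleton_point)
  obtain ⟨c, hc, hη, hTc⟩ := hY.exists_twoChart (Set.finite_range _ : T.Finite) hηT
  have hbij (O : Y.Opens) (hO : O ≤ c.V) : Function.Bijective (Sec.pull hw O) := by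
    refine ⟨h.injective O, fun x => ?_⟩
    suffices x ∈ (Sec.pull hw O).range from this
    rw [h.range_pull hw, mem_invariantSec]
    intro P hP
    by_cases hfix : frobenius sC K P = P
    · rw [← P.eval_frobenius hP (by rwa [P.point_frobenius])]
      congr 1
      congr 1
    · exact ((hTc _ ⟨⟨P, hfix⟩, rfl⟩).2 (hO hP)).elim
  have hηC : genericPoint C ∈ w ⁻¹ᵁ c.U ⊓ w ⁻¹ᵁ c.V := by
    change w (genericPoint C) ∈ c.U ⊓ c.V
    rwa [hgen]
  obtain ⟨-, hdim⟩ := arithmeticGenus_eq_of_twoChart hC hY hw c hc hη hηC hbij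
  have hfin := h.finrank_le hK hw (U := c.U) fun P hP => (hTc _ ⟨⟨P, hP⟩, rfl⟩).1
  omega

end CurvesOverFiniteFields

end

theorem propositiona1 {k : Type u} [Field k] [Fintype k]
    (K : Type u) [Field K] [Algebra k K] (hK : Module.finrank k K = 2)
    {C : Scheme.{u}} (sC : C ⟶ Spec (CommRingCat.of k))
    (hC : CurvesOverFiniteFields.IsProjectiveCurve sC)
    [Smooth sC] [GeometricallyIrreducible sC]
    (g : ℕ) (hg : CurvesOverFiniteFields.arithmeticGenus sC = g)
    (δ : ℕ) (hδ : CurvesOverFiniteFields.numPoints sC K =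
      CurvesOverFiniteFields.numPoints sC k + 2 * δ)
    {Y : Scheme.{u}} [IsIntegral Y] [QuasiSeparatedSpace Y] (sY : Y ⟶ Spec (CommRingCat.of k))
    (hY : CurvesOverFiniteFields.IsProjectiveCurve sY)
    (v : C ⟶ Y) (hv : v ≫ sY = sC) (hnorm : CurvesOverFiniteFields.IsNormalizationMap v) :
    (CurvesOverFiniteFields.numPoints sC k + δ ≤ CurvesOverFiniteFields.numPoints sY k ∧
      CurvesOverFiniteFields.arithmeticGenus sY ≤ g + δ) ↔
    CurvesOverFiniteFields.IsIsoToGluedCurve sY sC K := by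
  have : FiniteDimensional k K := Module.finite_of_finrank_pos (by omega)
  have : Finite K := Module.finite_of_finite k
  have := hC.isIntegral
  have := hnorm.isIntegralHom
  rw [← hg]
  constructor
  · rintro ⟨hpts, hgenus⟩
    exact (hnorm.isGluing hK hC hY hv hδ hpts hgenus).isIsoToGluedCurve hv
  · intro h
    -- The map `w` is the quotient map to the glued curve followed by the given isomorphism; it need
    -- not equal `v`.
    obtain ⟨w, hw, hglue⟩ := h.exists_isGluing
    exact hglue.numPoints_le_and_arithmeticGenus_le hK hC hY hw hδ
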